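/- \textbf{Theorem.} Let $\mathcal{C}$ be a braided monoidal category with braiding $c$, which has coequalizers, and whose tensor product preserves coequalizers in each variable (for example an abelian braided tensor category with right exact tensor product). Let $\mathfrak{N}$ be a Hopf algebra in $\mathcal{C}$ with invertible antipode, with multiplication $m$, unit $\eta$, comultiplication $\Delta$ and counit $\epsilon$, and let $R$ be a commutative algebra in $\mathcal{C}$ (that is, $m_R\circ c_{R,R}=m_R$) such that $$c_{\mathfrak{N},R}\circ c_{R,\mathfrak{N}}=\mathrm{id}_{R\otimes\mathfrak{N}}.$$ \emph{Notation.} (1) For a commutative algebra $A$ in a braided monoidal category $\mathcal{D}$ as above, $\mathcal{D}_A^0$ denotes the category of local $A$-modules: left $A$-modules $(M,\rho)$ with $\rho\circ c_{M,A}\circ c_{A,M}=\rho$, with $A$-linear morphisms. It is braided monoidal: the tensor product $M\otimes_A M'$ is the coequalizer of the two morphisms $A\otimes M\otimes M'\to M\otimes M'$ given by the action on $M$, and by $c_{A,M}$ followed by the action on $M'$; the unit object is $A$; the braiding is induced by $c_{M,M'}$. (2) For a Hopf algebra $H$ with invertible antipode in a braided monoidal category $\mathcal{D}$, ${}^{H}_{H}\mathcal{YD}(\mathcal{D})$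 denotes the category of Yetter--Drinfeld modules: objects $X$ of $\mathcal{D}$ with an $H$-action $\rho:H\otimes X\to X$ and an $H$-coaction $\delta:X\to H\otimes X$ such that $$(m\otimes\rho)(\mathrm{id}\otimes c_{H,H}\otimes \mathrm{id})(\Delta\otimes\delta)=(m\otimes\mathrm{id})(\mathrm{id}\otimes c_{X,H})(\delta\otimes\mathrm{id})(\rho\otimes\mathrm{id})(\mathrm{id}\otimes c_{H,X})(\Delta\otimes\mathrm{id}),$$ with $H$-linear and $H$-colinear morphisms. It is braided monoidal: the tensor product is that of $\mathcal{D}$ with the diagonal action and the codiagonal coaction, and the braiding is $(\rho_Y\otimes\mathrm{id})(\mathrm{id}\otimes c_{X,Y})(\delta_X\otimes\mathrm{id}):X\otimes Y\to Y\otimes X$. (3) $S$ denotes $R$ with the trivial action $\epsilon\otimes\mathrm{id}_R$ and the trivial coaction $\eta\otimes\mathrm{id}_R$ of $\mathfrak{N}$. It is a commutative algebra in ${}^{\mathfrak{N}}_{\mathfrak{N}}\mathcal{YD}(\mathcal{C})$ with the multiplication and unit of $R$. (4) The induction functor $\mathrm{ind}_R: X\mapsto R\otimes X$, from the full subcategory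 of objects $X$ of $\mathcal{C}$ with $c_{X,R}\circ c_{R,X}=\mathrm{id}$ to $\mathcal{C}_R^0$, is a braided monoidal functor. Hence $\mathrm{ind}_R(\mathfrak{N})=R\otimes\mathfrak{N}$ is a Hopf algebra, with invertible antipode, in $\mathcal{C}_R^0$. \emph{Claim.} There is an equivalence of braided monoidal categories $$\big({}^{\mathfrak{N}}_{\mathfrak{N}}\mathcal{YD}(\mathcal{C})\big)_S^0\;\simeq\;{}^{\mathrm{ind}_R(\mathfrak{N})}_{\mathrm{ind}_R(\mathfrak{N})}\mathcal{YD}\big(\mathcal{C}_R^0\big),$$ which commutes, up to natural isomorphism, with the forgetful functors of both sides to $\mathcal{C}$. -/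

import Mathlib

open CategoryTheory MonoidalCategory Limits MonObj
open scoped ComonObj HopfObj

universe v u

set_option linter.unusedSectionVars false
set_option linter.style.haveILetI false

namespace BraidedExtension

noncomputable section

section Whisker

variable {C : Type u} [Category.{v} C] [MonoidalCategory C] [BraidedCategory C]
  [∀ X : C, PreservesColimitsOfShape WalkingParallelPair (tensorLeft X)]

/-- Tensoring on the right preserves coequalizers because tensoring on the left does. -/
theorem preserves_tensorRight (X : C) :
    PreservesColimitsOfShape WalkingParallelPair (tensorRight X) :=
  preservesColimitsOfShape_of_natIso (BraidedCategory.tensorLeftIsoTensorRight X)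

/-- `p` is a coequalizer of some pair of morphisms. -/
def RegEpi {P Q : C} (p : P ⟶ Q) : Prop :=
  ∃ (W : C) (f g : W ⟶ P) (w : f ≫ p = g ≫ p), Nonempty (IsColimit (Cofork.ofπ p w))

theorem RegEpi.epi {P Q : C} {p : P ⟶ Q} (h : RegEpi p) : Epi p := by
  obtain ⟨W, f, g, w, ⟨hc⟩⟩ := h
  exact ⟨fun a b hab => Cofork.IsColimit.hom_ext hc hab⟩

theorem regEpi_π {P Q : C} (f g : P ⟶ Q) [HasCoequalizer f g] : RegEpi (coequalizer.π f g) :=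
  ⟨P, f, g, coequalizer.condition f g, ⟨coequalizerIsCoequalizer f g⟩⟩

theorem RegEpi.whiskerLeft {P Q : C} {p : P ⟶ Q} (h : RegEpi p) (Z : C) : RegEpi (Z ◁ p) := by
  obtain ⟨W, f, g, w, ⟨hc⟩⟩ := h
  refine ⟨Z ⊗ W, Z ◁ f, Z ◁ g, by simp only [← whiskerLeft_comp, w], ⟨?_⟩⟩
  exact isColimitCoforkMapOfIsColimit (tensorLeft Z) w hc

theorem RegEpi.whiskerRight {P Q : C} {p : P ⟶ Q} (h : RegEpi p) (Z : C) : RegEpi (p ▷ Z) := by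
  obtain ⟨W, f, g, w, ⟨hc⟩⟩ := h
  haveI := preserves_tensorRight Z
  refine ⟨W ⊗ Z, f ▷ Z, g ▷ Z, by simp only [← comp_whiskerRight, w], ⟨?_⟩⟩
  exact isColimitCoforkMapOfIsColimit (tensorRight Z) w hc

variable {P Q : C} (f g : P ⟶ Q) [HasCoequalizer f g]

/-- A morphism out of `Z ⊗ coequalizer f g`. -/
def descLeft (Z : C) {W : C} (k : Z ⊗ Q ⟶ W) (hk : Z ◁ f ≫ k = Z ◁ g ≫ k) :
    Z ⊗ coequalizer f g ⟶ W :=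
  Cofork.IsColimit.desc (isColimitCoforkMapOfIsColimit (tensorLeft Z) (coequalizer.condition f g)
    (coequalizerIsCoequalizer f g)) k hk

@[simp] theorem π_descLeft (Z : C) {W : C} (k : Z ⊗ Q ⟶ W) (hk : Z ◁ f ≫ k = Z ◁ g ≫ k) :
    Z ◁ coequalizer.π f g ≫ descLeft f g Z k hk = k :=
  Cofork.IsColimit.π_desc' (isColimitCoforkMapOfIsColimit (tensorLeft Z)
    (coequalizer.condition f g) (coequalizerIsCoequalizer f g)) k hk

@[simp] theorem π_descLeft_assoc : type_of% (reassoc_of% @π_descLeft) := @(reassoc_of% @π_descLeft)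

/-- A morphism out of `coequalizer f g ⊗ Z`. -/
def descRight (Z : C) {W : C} (k : Q ⊗ Z ⟶ W) (hk : f ▷ Z ≫ k = g ▷ Z ≫ k) :
    coequalizer f g ⊗ Z ⟶ W :=
  haveI := preserves_tensorRight Z
  Cofork.IsColimit.desc (isColimitCoforkMapOfIsColimit (tensorRight Z) (coequalizer.condition f g)
    (coequalizerIsCoequalizer f g)) k hk

@[simp] theorem π_descRight (Z : C) {W : C} (k : Q ⊗ Z ⟶ W) (hk : f ▷ Z ≫ k = g ▷ Z ≫ k) :
    coequalizer.π f g ▷ Z ≫ descRight f g Z k hk = k :=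
  haveI := preserves_tensorRight Z
  Cofork.IsColimit.π_desc' (isColimitCoforkMapOfIsColimit (tensorRight Z)
    (coequalizer.condition f g) (coequalizerIsCoequalizer f g)) k hk

@[simp] theorem π_descRight_assoc : type_of% (reassoc_of% @π_descRight) := @(reassoc_of% @π_descRight)

end Whisker

/-! ### Local modules over a commutative algebra -/

section LocalModules

variable {C : Type u} [Category.{v} C] [MonoidalCategory C] [BraidedCategory C]

/-- The action morphism of a module object. -/
def act (A : C) [MonObj A] (X : C) [ModObj A X] : A ⊗ X ⟶ X := ModObj.smul (M := A) (X := X)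

@[simp] theorem one_act (A : C) [MonObj A] (X : C) [ModObj A X] : η[A] ▷ X ≫ act A X = (λ_ X).hom :=
  ModObj.one_smul_self (M := A) (X := X)

@[simp] theorem one_act_assoc : type_of% (reassoc_of% @one_act) := @(reassoc_of% @one_act)

theorem mul_act (A : C) [MonObj A] (X : C) [ModObj A X] :
    μ[A] ▷ X ≫ act A X = (α_ A A X).hom ≫ A ◁ act A X ≫ act A X :=
  ModObj.mul_smul_self (M := A) (X := X)

theorem mul_act_assoc : type_of% (reassoc_of% @mul_act) := @(reassoc_of% @mul_act)

/-- A local (dyslectic) module over an algebra `A` in a braided monoidal category: a left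
`A`-module whose action is unchanged by precomposition with the double braiding. -/
structure LocalModule (A : C) [MonObj A] where
  /-- the underlying object -/
  X : C
  [mod : ModObj A X]
  loc : (β_ A X).hom ≫ (β_ X A).hom ≫ act A X = act A X

attribute [instance] LocalModule.mod
attribute [simp] LocalModule.loc

@[simp] theorem LocalModule.loc_assoc : type_of% (reassoc_of% @LocalModule.loc) := @(reassoc_of% @LocalModule.loc)

namespace LocalModule

variable {A : C} [MonObj A]

/-- Morphisms of local modules are the `A`-linear morphisms. -/
@[ext]
structure Hom (M N : LocalModule A) where
  /-- the underlying morphism -/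
  hom : M.X ⟶ N.X
  lin : act A M.X ≫ hom = A ◁ hom ≫ act A N.X

theorem Hom.lin_assoc : type_of% (reassoc_of% @Hom.lin) := @(reassoc_of% @Hom.lin)

instance : Category (LocalModule A) where
  Hom M N := Hom M N
  id M := ⟨𝟙 M.X, by simp⟩
  comp f g := ⟨f.hom ≫ g.hom, by rw [f.lin_assoc, g.lin, whiskerLeft_comp, Category.assoc]⟩

@[simp] theorem id_hom (M : LocalModule A) : Hom.hom (𝟙 M) = 𝟙 M.X := rfl
@[simp] theorem comp_hom {M N P : LocalModule A} (f : M ⟶ N) (g : N ⟶ P) :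
    (f ≫ g).hom = f.hom ≫ g.hom := rfl

@[simp] theorem comp_hom_assoc : type_of% (reassoc_of% @comp_hom) := @(reassoc_of% @comp_hom)

@[ext] theorem hom_ext {M N : LocalModule A} {f g : M ⟶ N} (h : f.hom = g.hom) : f = g :=
  Hom.ext h

/-- The forgetful functor from local modules to the ambient category. -/
@[simps] def forget (A : C) [MonObj A] : LocalModule A ⥤ C where
  obj M := M.X
  map f := f.hom

/-- An `A`-linear isomorphism. -/
@[simps] def isoMk {M N : LocalModule A} (e : M.X ≅ N.X)
    (h : act A M.X ≫ e.hom = A ◁ e.hom ≫ act A N.X) : M ≅ N where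
  hom := ⟨e.hom, h⟩
  inv := ⟨e.inv, by
    rw [Iso.comp_inv_eq, Category.assoc, h, ← whiskerLeft_comp_assoc]; simp⟩

end LocalModule

/-! Operations on (pre-)actions `A ⊗ X ⟶ X`. -/

section PreActions

variable {A : C}

/-- The action of `A` on the left factor of `X ⊗ Y`. -/
def actL {X : C} (a : A ⊗ X ⟶ X) (Y : C) : A ⊗ (X ⊗ Y) ⟶ X ⊗ Y :=
  (α_ A X Y).inv ≫ a ▷ Y

/-- The action of `A` on the right factor of `X ⊗ Y`, through the braiding. -/
def actR (X : C) {Y : C} (b : A ⊗ Y ⟶ Y) : A ⊗ (X ⊗ Y) ⟶ X ⊗ Y :=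
  (α_ A X Y).inv ≫ (β_ A X).hom ▷ Y ≫ (α_ X A Y).hom ≫ X ◁ b

theorem actR_fold {X Y Z : C} (b : A ⊗ Y ⟶ Y) (k : X ⊗ Y ⟶ Z) :
    (α_ A X Y).inv ≫ (β_ A X).hom ▷ Y ≫ (α_ X A Y).hom ≫ X ◁ b ≫ k = actR X b ≫ k := by
  simp [actR]

theorem actL_nat {X X' Y Y' : C} {a : A ⊗ X ⟶ X} {a' : A ⊗ X' ⟶ X'} (f : X ⟶ X')
    (g : Y ⟶ Y') (hf : a ≫ f = A ◁ f ≫ a') :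
    actL a Y ≫ (f ⊗ₘ g) = A ◁ (f ⊗ₘ g) ≫ actL a' Y' := by
  simp only [actL, MonoidalCategory.tensorHom_def, Category.assoc, ← comp_whiskerRight_assoc, hf]
  simp only [comp_whiskerRight, whiskerLeft_comp, Category.assoc]
  rw [associator_inv_naturality_right_assoc, associator_inv_naturality_middle_assoc,
    whisker_exchange]

theorem actR_nat {X X' Y Y' : C} {b : A ⊗ Y ⟶ Y} {b' : A ⊗ Y' ⟶ Y'} (f : X ⟶ X')
    (g : Y ⟶ Y') (hg : b ≫ g = A ◁ g ≫ b') :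
    actR X b ≫ (f ⊗ₘ g) = A ◁ (f ⊗ₘ g) ≫ actR X' b' := by
  simp only [actR, MonoidalCategory.tensorHom_def', Category.assoc, ← whiskerLeft_comp_assoc, hg]
  simp only [whiskerLeft_comp, Category.assoc]
  rw [associator_inv_naturality_middle_assoc, ← comp_whiskerRight_assoc (A ◁ f),
    BraidedCategory.braiding_naturality_right, comp_whiskerRight_assoc,
    associator_naturality_left_assoc, ← whisker_exchange,
    associator_inv_naturality_right_assoc, whisker_exchange_assoc, associator_naturality_right_assoc]

theorem actL_actL_assoc {X : C} (a : A ⊗ X ⟶ X) (Y Z : C) :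
    actL (actL a Y) Z ≫ (α_ X Y Z).hom = A ◁ (α_ X Y Z).hom ≫ actL a (Y ⊗ Z) := by
  simp only [actL]; monoidal

theorem actL_actR_assoc (X : C) {Y : C} (b : A ⊗ Y ⟶ Y) (Z : C) :
    actL (actR X b) Z ≫ (α_ X Y Z).hom = A ◁ (α_ X Y Z).hom ≫ actR X (actL b Z) := by
  simp only [actL, actR]; monoidal

theorem actR_actR_assoc (X Y : C) {Z : C} (c : A ⊗ Z ⟶ Z) :
    actR (X ⊗ Y) c ≫ (α_ X Y Z).hom = A ◁ (α_ X Y Z).hom ≫ actR X (actR Y c) := by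
  simp only [actR, BraidedCategory.braiding_tensor_right_hom]; monoidal

theorem actL_actR_assoc_inv (X : C) {Y : C} (b : A ⊗ Y ⟶ Y) (Z : C) :
    actR X (actL b Z) ≫ (α_ X Y Z).inv = A ◁ (α_ X Y Z).inv ≫ actL (actR X b) Z := by
  rw [Iso.comp_inv_eq, Category.assoc, actL_actR_assoc, ← whiskerLeft_comp_assoc]; simp

theorem actL_actL_assoc_inv {X : C} (a : A ⊗ X ⟶ X) (Y Z : C) :
    actL a (Y ⊗ Z) ≫ (α_ X Y Z).inv = A ◁ (α_ X Y Z).inv ≫ actL (actL a Y) Z := by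
  rw [Iso.comp_inv_eq, Category.assoc, actL_actL_assoc, ← whiskerLeft_comp_assoc]; simp

theorem actR_actR_assoc_inv (X Y : C) {Z : C} (c : A ⊗ Z ⟶ Z) :
    actR X (actR Y c) ≫ (α_ X Y Z).inv = A ◁ (α_ X Y Z).inv ≫ actR (X ⊗ Y) c := by
  rw [Iso.comp_inv_eq, Category.assoc, actR_actR_assoc, ← whiskerLeft_comp_assoc]; simp

theorem actL_mul [MonObj A] {X : C} (a : A ⊗ X ⟶ X)
    (ha : μ[A] ▷ X ≫ a = (α_ A A X).hom ≫ A ◁ a ≫ a) (Y : C) :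
    μ[A] ▷ (X ⊗ Y) ≫ actL a Y = (α_ A A (X ⊗ Y)).hom ≫ A ◁ actL a Y ≫ actL a Y := by
  calc _ = 𝟙 _ ⊗≫ (μ[A] ▷ X ≫ a) ▷ Y := by simp only [actL]; monoidal
    _ = _ := by rw [ha]; simp only [actL]; monoidal

theorem actL_one [MonObj A] {X : C} (a : A ⊗ X ⟶ X)
    (ha : η[A] ▷ X ≫ a = (λ_ X).hom) (Y : C) :
    η[A] ▷ (X ⊗ Y) ≫ actL a Y = (λ_ (X ⊗ Y)).hom := by
  calc _ = 𝟙 _ ⊗≫ (η[A] ▷ X ≫ a) ▷ Y := by simp only [actL]; monoidal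
    _ = _ := by rw [ha]; monoidal

theorem actR_actL {X Y : C} (a : A ⊗ X ⟶ X) (b : A ⊗ Y ⟶ Y) :
    A ◁ actR X b ≫ actL a Y =
      (α_ A A (X ⊗ Y)).inv ≫ (β_ A A).inv ▷ (X ⊗ Y) ≫ (α_ A A (X ⊗ Y)).hom ≫
        A ◁ actL a Y ≫ actR X b := by
  symm
  calc _ = 𝟙 _ ⊗≫ (β_ A A).inv ▷ X ▷ Y ⊗≫ (A ◁ a ≫ (β_ A X).hom) ▷ Y ⊗≫ X ◁ b := by
        simp only [actL, actR]; monoidal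
    _ = 𝟙 _ ⊗≫ ((β_ A A).inv ≫ (β_ A A).hom) ▷ X ▷ Y ⊗≫ A ◁ (β_ A X).hom ▷ Y ⊗≫
          (a ▷ (A ⊗ Y) ≫ X ◁ b) := by
        rw [BraidedCategory.braiding_naturality_right, BraidedCategory.braiding_tensor_right_hom]
        monoidal
    _ = _ := by
        rw [Iso.inv_hom_id, ← whisker_exchange]; simp only [actL, actR]; monoidal

theorem actL_braiding {X : C} (a : A ⊗ X ⟶ X) (Y : C) :
    actL a Y ≫ (β_ X Y).hom = A ◁ (β_ X Y).hom ≫ actR Y a := by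
  calc _ = 𝟙 _ ⊗≫ (a ▷ Y ≫ (β_ X Y).hom) := by simp only [actL]; monoidal
    _ = _ := by
      rw [BraidedCategory.braiding_naturality_left, BraidedCategory.braiding_tensor_left_hom]
      simp only [actR]; monoidal

/-- The double braiding of `A` with the left factor. -/
def twistL (A X Y : C) : A ⊗ (X ⊗ Y) ⟶ A ⊗ (X ⊗ Y) :=
  (α_ A X Y).inv ≫ ((β_ A X).hom ≫ (β_ X A).hom) ▷ Y ≫ (α_ A X Y).hom

theorem actR_braiding (X : C) {Y : C} (b : A ⊗ Y ⟶ Y) :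
    actR X b ≫ (β_ X Y).hom = twistL A X Y ≫ A ◁ (β_ X Y).hom ≫ actL b X := by
  calc _ = 𝟙 _ ⊗≫ (β_ A X).hom ▷ Y ⊗≫ (X ◁ b ≫ (β_ X Y).hom) := by simp only [actR]; monoidal
    _ = _ := by
      rw [BraidedCategory.braiding_naturality_right, BraidedCategory.braiding_tensor_right_hom]
      simp only [actL, twistL]; monoidal

instance (A X Y : C) : IsIso (twistL A X Y) := by
  unfold twistL; infer_instance

theorem twistL_actL {X : C} (a : A ⊗ X ⟶ X) (ha : (β_ A X).hom ≫ (β_ X A).hom ≫ a = a) (Y : C) :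
    twistL A X Y ≫ actL a Y = actL a Y := by
  calc _ = 𝟙 _ ⊗≫ ((β_ A X).hom ≫ (β_ X A).hom ≫ a) ▷ Y := by simp only [actL, twistL]; monoidal
    _ = _ := by rw [ha]; simp only [actL]; monoidal

end PreActions

end LocalModules

namespace LocalModule

/-- A module object from an explicit action. -/
abbrev modOf {C : Type u} [Category.{v} C] [MonoidalCategory C] {A : C} [MonObj A] {X : C}
    (a : A ⊗ X ⟶ X) (h1 : η[A] ▷ X ≫ a = (λ_ X).hom)
    (h2 : μ[A] ▷ X ≫ a = (α_ A A X).hom ≫ A ◁ a ≫ a) : ModObj A X where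
  smul := a
  one_smul := h1
  mul_smul := h2

variable {C : Type u} [Category.{v} C] [MonoidalCategory C] [BraidedCategory C]
  [HasCoequalizers C] [∀ X : C, PreservesColimitsOfShape WalkingParallelPair (tensorLeft X)]
  {A : C} [MonObj A]

/-- The relative tensor product `M ⊗_A N`: the coequalizer of the two actions of `A` on the
tensor product of the underlying objects. -/
def relObj (M N : LocalModule A) : C :=
  coequalizer (actL (act A M.X) N.X) (actR M.X (act A N.X))

/-- The projection `M ⊗ N ⟶ M ⊗_A N`. -/
def π (M N : LocalModule A) : M.X ⊗ N.X ⟶ relObj M N := coequalizer.π _ _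

theorem π_condition (M N : LocalModule A) :
    actL (act A M.X) N.X ≫ π M N = actR M.X (act A N.X) ≫ π M N :=
  coequalizer.condition _ _

theorem π_condition_assoc : type_of% (reassoc_of% @π_condition) := @(reassoc_of% @π_condition)

theorem regEpi_rel (M N : LocalModule A) : RegEpi (π M N) := regEpi_π _ _

instance (M N : LocalModule A) : Epi (π M N) := (regEpi_rel M N).epi
instance (M N : LocalModule A) (Z : C) : Epi (Z ◁ π M N) := ((regEpi_rel M N).whiskerLeft Z).epi
instance (M N : LocalModule A) (Z : C) : Epi (π M N ▷ Z) := ((regEpi_rel M N).whiskerRight Z).epi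
instance (M N : LocalModule A) (Z W : C) : Epi (W ◁ π M N ▷ Z) :=
  (((regEpi_rel M N).whiskerRight Z).whiskerLeft W).epi
instance (M N : LocalModule A) (Z W : C) : Epi (W ◁ Z ◁ π M N) :=
  (((regEpi_rel M N).whiskerLeft Z).whiskerLeft W).epi
instance (M N : LocalModule A) (Z W : C) : Epi (π M N ▷ Z ▷ W) :=
  (((regEpi_rel M N).whiskerRight Z).whiskerRight W).epi
instance (M N : LocalModule A) (Z W : C) : Epi ((Z ◁ π M N) ▷ W) :=
  (((regEpi_rel M N).whiskerLeft Z).whiskerRight W).epi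

variable [IsCommMonObj A]

theorem inv_braiding_mul : (β_ A A).inv ≫ μ[A] = μ[A] := by
  rw [Iso.inv_comp_eq, IsCommMonObj.mul_comm]

/-- The action of `A` on `M ⊗_A N`. -/
def relAct (M N : LocalModule A) : A ⊗ relObj M N ⟶ relObj M N :=
  descLeft _ _ A (actL (act A M.X) N.X ≫ π M N) <| by
    rw [← Category.assoc (A ◁ actR _ _), actR_actL]
    simp only [Category.assoc]
    rw [← π_condition]
    have h := actL_mul (act A M.X) (mul_act A M.X) N.X
    rw [← Iso.inv_comp_eq] at h
    rw [← reassoc_of% h, Iso.hom_inv_id_assoc, ← comp_whiskerRight_assoc, inv_braiding_mul]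

theorem π_relAct (M N : LocalModule A) :
    A ◁ π M N ≫ relAct M N = actL (act A M.X) N.X ≫ π M N := π_descLeft _ _ _ _ _

theorem π_relAct_assoc : type_of% (reassoc_of% @π_relAct) := @(reassoc_of% @π_relAct)

theorem π_relAct' (M N : LocalModule A) :
    A ◁ π M N ≫ relAct M N = actR M.X (act A N.X) ≫ π M N := by rw [π_relAct, π_condition]

theorem π_relAct'_assoc : type_of% (reassoc_of% @π_relAct') := @(reassoc_of% @π_relAct')

theorem relAct_one (M N : LocalModule A) :
    η[A] ▷ relObj M N ≫ relAct M N = (λ_ (relObj M N)).hom := by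
  rw [← cancel_epi (𝟙_ C ◁ π M N), whisker_exchange_assoc, π_relAct, ← Category.assoc,
    actL_one _ (one_act A M.X)]
  simp

theorem relAct_mul (M N : LocalModule A) :
    μ[A] ▷ relObj M N ≫ relAct M N =
      (α_ A A (relObj M N)).hom ≫ A ◁ relAct M N ≫ relAct M N := by
  rw [← cancel_epi ((A ⊗ A) ◁ π M N), whisker_exchange_assoc, π_relAct, ← Category.assoc,
    actL_mul _ (mul_act A M.X), associator_naturality_right_assoc, ← whiskerLeft_comp_assoc,
    π_relAct]
  simp [π_relAct]

theorem relAct_loc (M N : LocalModule A) :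
    (β_ A (relObj M N)).hom ≫ (β_ (relObj M N) A).hom ≫ relAct M N = relAct M N := by
  rw [← cancel_epi (A ◁ π M N), BraidedCategory.braiding_naturality_right_assoc,
    BraidedCategory.braiding_naturality_left_assoc, π_relAct]
  have hM : (β_ M.X A).hom ≫ act A M.X = (β_ A M.X).inv ≫ act A M.X := by
    rw [Iso.eq_inv_comp, M.loc]
  calc _ = 𝟙 _ ⊗≫ (β_ A M.X).hom ▷ N.X ⊗≫ M.X ◁ ((β_ A N.X).hom ≫ (β_ N.X A).hom) ⊗≫
          ((β_ M.X A).hom ≫ act A M.X) ▷ N.X ⊗≫ π M N := by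
        simp only [BraidedCategory.braiding_tensor_left_hom,
          BraidedCategory.braiding_tensor_right_hom, actL]
        monoidal
    _ = 𝟙 _ ⊗≫ (β_ A M.X).hom ▷ N.X ⊗≫ M.X ◁ ((β_ A N.X).hom ≫ (β_ N.X A).hom) ⊗≫
          (β_ A M.X).inv ▷ N.X ⊗≫ (actL (act A M.X) N.X ≫ π M N) := by
        rw [hM, actL]; monoidal
    _ = 𝟙 _ ⊗≫ (β_ A M.X).hom ▷ N.X ⊗≫ M.X ◁ ((β_ A N.X).hom ≫ (β_ N.X A).hom) ⊗≫
          ((β_ A M.X).inv ≫ (β_ A M.X).hom) ▷ N.X ⊗≫ M.X ◁ act A N.X ⊗≫ π M N := by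
        rw [π_condition, actR]; monoidal
    _ = 𝟙 _ ⊗≫ (β_ A M.X).hom ▷ N.X ⊗≫
          M.X ◁ ((β_ A N.X).hom ≫ (β_ N.X A).hom ≫ act A N.X) ⊗≫ π M N := by
        rw [Iso.inv_hom_id]; monoidal
    _ = actR M.X (act A N.X) ≫ π M N := by rw [N.loc, actR]; monoidal
    _ = _ := (π_condition M N).symm

/-- The relative tensor product of two local modules, as a local module. -/
def tens (M N : LocalModule A) : LocalModule A :=
  letI := modOf (relAct M N) (relAct_one M N) (relAct_mul M N)
  { X := relObj M N
    loc := relAct_loc M N }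

theorem tens_act (M N : LocalModule A) : act A (tens M N).X = relAct M N := rfl

/-- The projection, with target the underlying object of `tens M N`. -/
def proj (M N : LocalModule A) : M.X ⊗ N.X ⟶ (tens M N).X := π M N

theorem regEpi_proj (M N : LocalModule A) : RegEpi (proj M N) := regEpi_π _ _

instance (M N : LocalModule A) : Epi (proj M N) := (regEpi_proj M N).epi
instance (M N : LocalModule A) (Z : C) : Epi (Z ◁ proj M N) :=
  ((regEpi_proj M N).whiskerLeft Z).epi
instance (M N : LocalModule A) (Z : C) : Epi (proj M N ▷ Z) :=
  ((regEpi_proj M N).whiskerRight Z).epi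
instance (M N : LocalModule A) (Z W : C) : Epi (W ◁ proj M N ▷ Z) :=
  (((regEpi_proj M N).whiskerRight Z).whiskerLeft W).epi
instance (M N : LocalModule A) (Z W : C) : Epi (W ◁ Z ◁ proj M N) :=
  (((regEpi_proj M N).whiskerLeft Z).whiskerLeft W).epi
instance (M N : LocalModule A) (Z W : C) : Epi (proj M N ▷ Z ▷ W) :=
  (((regEpi_proj M N).whiskerRight Z).whiskerRight W).epi
instance (M N : LocalModule A) (Z W : C) : Epi ((Z ◁ proj M N) ▷ W) :=
  (((regEpi_proj M N).whiskerLeft Z).whiskerRight W).epi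

theorem proj_act (M N : LocalModule A) :
    A ◁ proj M N ≫ act A (tens M N).X = actL (act A M.X) N.X ≫ proj M N := π_relAct M N

theorem proj_act_assoc : type_of% (reassoc_of% @proj_act) := @(reassoc_of% @proj_act)

theorem proj_act' (M N : LocalModule A) :
    A ◁ proj M N ≫ act A (tens M N).X = actR M.X (act A N.X) ≫ proj M N := π_relAct' M N

theorem proj_act'_assoc : type_of% (reassoc_of% @proj_act') := @(reassoc_of% @proj_act')

theorem proj_condition (M N : LocalModule A) :
    actL (act A M.X) N.X ≫ proj M N = actR M.X (act A N.X) ≫ proj M N :=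
  π_condition M N

theorem proj_condition_assoc : type_of% (reassoc_of% @proj_condition) := @(reassoc_of% @proj_condition)

/-- The morphism of `C` induced by a balanced morphism. -/
def tensDescHom {M N : LocalModule A} {T : C} (k : M.X ⊗ N.X ⟶ T)
    (h : actL (act A M.X) N.X ≫ k = actR M.X (act A N.X) ≫ k) : (tens M N).X ⟶ T :=
  coequalizer.desc k h

theorem proj_tensDescHom {M N : LocalModule A} {T : C} (k : M.X ⊗ N.X ⟶ T)
    (h : actL (act A M.X) N.X ≫ k = actR M.X (act A N.X) ≫ k) :
    proj M N ≫ tensDescHom k h = k := coequalizer.π_desc _ _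

theorem proj_tensDescHom_assoc : type_of% (reassoc_of% @proj_tensDescHom) := @(reassoc_of% @proj_tensDescHom)

/-- The universal property of the relative tensor product: bilinear maps out of `M ⊗ N` descend to
morphisms of local modules. -/
def tensDesc {M N P : LocalModule A} (k : M.X ⊗ N.X ⟶ P.X)
    (h₁ : actL (act A M.X) N.X ≫ k = A ◁ k ≫ act A P.X)
    (h₂ : actR M.X (act A N.X) ≫ k = A ◁ k ≫ act A P.X) : tens M N ⟶ P :=
  Hom.mk (M := tens M N) (tensDescHom k (h₁.trans h₂.symm)) <| by
    rw [← cancel_epi (A ◁ proj M N), proj_act_assoc, proj_tensDescHom,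
      ← whiskerLeft_comp_assoc, proj_tensDescHom]
    exact h₁

@[simp] theorem proj_tensDesc {M N P : LocalModule A} (k : M.X ⊗ N.X ⟶ P.X)
    (h₁ : actL (act A M.X) N.X ≫ k = A ◁ k ≫ act A P.X)
    (h₂ : actR M.X (act A N.X) ≫ k = A ◁ k ≫ act A P.X) :
    proj M N ≫ (tensDesc k h₁ h₂).hom = k := proj_tensDescHom _ _

@[simp] theorem proj_tensDesc_assoc : type_of% (reassoc_of% @proj_tensDesc) := @(reassoc_of% @proj_tensDesc)

theorem tens_hom_ext {M N P : LocalModule A} {f g : tens M N ⟶ P}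
    (h : proj M N ≫ f.hom = proj M N ≫ g.hom) : f = g :=
  hom_ext ((cancel_epi _).1 h)

/-- The relative tensor product of morphisms. -/
def tensMap {M M' N N' : LocalModule A} (f : M ⟶ M') (g : N ⟶ N') : tens M N ⟶ tens M' N' :=
  tensDesc ((f.hom ⊗ₘ g.hom) ≫ proj M' N')
    (by rw [← Category.assoc, actL_nat _ _ f.lin, Category.assoc, whiskerLeft_comp,
          Category.assoc, proj_act])
    (by rw [← Category.assoc, actR_nat _ _ g.lin, Category.assoc, whiskerLeft_comp,
          Category.assoc, proj_act'])

@[simp] theorem proj_tensMap {M M' N N' : LocalModule A} (f : M ⟶ M') (g : N ⟶ N') :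
    proj M N ≫ (tensMap f g).hom = (f.hom ⊗ₘ g.hom) ≫ proj M' N' := proj_tensDesc _ _ _

@[simp] theorem proj_tensMap_assoc : type_of% (reassoc_of% @proj_tensMap) := @(reassoc_of% @proj_tensMap)

theorem descL_cond {X V W T : C} {f g : A ⊗ V ⟶ W} {k : X ⊗ W ⟶ T}
    (h : (α_ A X V).inv ≫ (β_ A X).hom ▷ V ≫ (α_ X A V).hom ≫ X ◁ f ≫ k =
      (α_ A X V).inv ≫ (β_ A X).hom ▷ V ≫ (α_ X A V).hom ≫ X ◁ g ≫ k) :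
    X ◁ f ≫ k = X ◁ g ≫ k := by
  rw [← cancel_epi ((α_ A X V).inv ≫ (β_ A X).hom ▷ V ≫ (α_ X A V).hom)]
  simpa using h

/-- The action on three factors, pushed to the relative tensor products. -/
theorem tri₁ (M N P : LocalModule A) :
    actL (act A M.X) (N.X ⊗ P.X) ≫ M.X ◁ proj N P ≫ proj M (tens N P) =
      A ◁ (M.X ◁ proj N P ≫ proj M (tens N P)) ≫ act A (tens M (tens N P)).X := by
  have h := actL_nat (a := act A M.X) (a' := act A M.X) (𝟙 M.X) (proj N P) (by simp)
  rw [MonoidalCategory.id_tensorHom] at h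
  rw [reassoc_of% h, whiskerLeft_comp_assoc, proj_act]

theorem tri₂ (M N P : LocalModule A) :
    actR M.X (actL (act A N.X) P.X) ≫ M.X ◁ proj N P ≫ proj M (tens N P) =
      A ◁ (M.X ◁ proj N P ≫ proj M (tens N P)) ≫ act A (tens M (tens N P)).X := by
  have h := actR_nat (b := actL (act A N.X) P.X) (b' := act A (tens N P).X) (𝟙 M.X) (proj N P)
    (proj_act N P).symm
  rw [MonoidalCategory.id_tensorHom] at h
  rw [reassoc_of% h, whiskerLeft_comp_assoc, proj_act']

theorem tri₃ (M N P : LocalModule A) :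
    actR M.X (actR N.X (act A P.X)) ≫ M.X ◁ proj N P ≫ proj M (tens N P) =
      A ◁ (M.X ◁ proj N P ≫ proj M (tens N P)) ≫ act A (tens M (tens N P)).X := by
  have h := actR_nat (b := actR N.X (act A P.X)) (b' := act A (tens N P).X) (𝟙 M.X) (proj N P)
    (proj_act' N P).symm
  rw [MonoidalCategory.id_tensorHom] at h
  rw [reassoc_of% h, whiskerLeft_comp_assoc, proj_act']

theorem tri₁' (M N P : LocalModule A) :
    actL (actL (act A M.X) N.X) P.X ≫ proj M N ▷ P.X ≫ proj (tens M N) P =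
      A ◁ (proj M N ▷ P.X ≫ proj (tens M N) P) ≫ act A (tens (tens M N) P).X := by
  have h := actL_nat (a := actL (act A M.X) N.X) (a' := act A (tens M N).X) (proj M N) (𝟙 P.X)
    (proj_act M N).symm
  rw [MonoidalCategory.tensorHom_id] at h
  rw [reassoc_of% h, whiskerLeft_comp_assoc, proj_act]

theorem tri₂' (M N P : LocalModule A) :
    actL (actR M.X (act A N.X)) P.X ≫ proj M N ▷ P.X ≫ proj (tens M N) P =
      A ◁ (proj M N ▷ P.X ≫ proj (tens M N) P) ≫ act A (tens (tens M N) P).X := by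
  have h := actL_nat (a := actR M.X (act A N.X)) (a' := act A (tens M N).X) (proj M N) (𝟙 P.X)
    (proj_act' M N).symm
  rw [MonoidalCategory.tensorHom_id] at h
  rw [reassoc_of% h, whiskerLeft_comp_assoc, proj_act]

theorem tri₃' (M N P : LocalModule A) :
    actR (M.X ⊗ N.X) (act A P.X) ≫ proj M N ▷ P.X ≫ proj (tens M N) P =
      A ◁ (proj M N ▷ P.X ≫ proj (tens M N) P) ≫ act A (tens (tens M N) P).X := by
  have h := actR_nat (b := act A P.X) (b' := act A P.X) (proj M N) (𝟙 P.X) (by simp)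
  rw [MonoidalCategory.tensorHom_id] at h
  rw [reassoc_of% h, whiskerLeft_comp_assoc, proj_act']

/-- The associator on the level of underlying objects, first step. -/
def assocAux (M N P : LocalModule A) : (tens M N).X ⊗ P.X ⟶ (tens M (tens N P)).X :=
  descRight _ _ P.X ((α_ _ _ _).hom ≫ M.X ◁ proj N P ≫ proj M (tens N P)) <| by
    rw [← cancel_epi (α_ _ _ _).inv, ← Category.assoc, ← Category.assoc (α_ _ _ _).inv]
    change actL (actL (act A M.X) N.X) P.X ≫ _ = actL (actR M.X (act A N.X)) P.X ≫ _
    rw [← Category.assoc, actL_actL_assoc, ← Category.assoc (actL _ _), actL_actR_assoc,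
      Category.assoc, Category.assoc, tri₁, tri₂]

theorem proj_assocAux (M N P : LocalModule A) : proj M N ▷ P.X ≫ assocAux M N P =
    (α_ _ _ _).hom ≫ M.X ◁ proj N P ≫ proj M (tens N P) := π_descRight _ _ _ _ _

theorem proj_assocAux_assoc : type_of% (reassoc_of% @proj_assocAux) := @(reassoc_of% @proj_assocAux)

/-- The associator. -/
def assocHom (M N P : LocalModule A) : tens (tens M N) P ⟶ tens M (tens N P) :=
  tensDesc (assocAux M N P)
    (by
      have h := actL_nat (a := actL (act A M.X) N.X) (a' := act A (tens M N).X) (proj M N) (𝟙 P.X)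
        (proj_act M N).symm
      rw [MonoidalCategory.tensorHom_id] at h
      rw [← cancel_epi (A ◁ proj M N ▷ P.X), ← reassoc_of% h, proj_assocAux,
        ← whiskerLeft_comp_assoc, proj_assocAux, ← Category.assoc, actL_actL_assoc, Category.assoc,
        tri₁]
      simp)
    (by
      have h := actR_nat (b := act A P.X) (b' := act A P.X) (proj M N) (𝟙 P.X) (by simp)
      rw [MonoidalCategory.tensorHom_id] at h
      rw [← cancel_epi (A ◁ proj M N ▷ P.X), ← reassoc_of% h, proj_assocAux,
        ← whiskerLeft_comp_assoc, proj_assocAux, ← Category.assoc, actR_actR_assoc, Category.assoc,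
        tri₃]
      simp)

theorem proj_assocHom (M N P : LocalModule A) :
    proj M N ▷ P.X ≫ proj (tens M N) P ≫ (assocHom M N P).hom =
      (α_ _ _ _).hom ≫ M.X ◁ proj N P ≫ proj M (tens N P) := by
  rw [assocHom, proj_tensDesc, proj_assocAux]

theorem proj_assocHom_assoc : type_of% (reassoc_of% @proj_assocHom) := @(reassoc_of% @proj_assocHom)

/-- The inverse associator on the level of underlying objects, first step. -/
def assocInvAux (M N P : LocalModule A) : M.X ⊗ (tens N P).X ⟶ (tens (tens M N) P).X :=
  descLeft _ _ M.X ((α_ _ _ _).inv ≫ proj M N ▷ P.X ≫ proj (tens M N) P) <| by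
    apply descL_cond
    rw [actR_fold, actR_fold]
    rw [← Category.assoc, actL_actR_assoc_inv, ← Category.assoc (actR _ _), actR_actR_assoc_inv,
      Category.assoc, Category.assoc, tri₂', tri₃']

theorem proj_assocInvAux (M N P : LocalModule A) : M.X ◁ proj N P ≫ assocInvAux M N P =
    (α_ _ _ _).inv ≫ proj M N ▷ P.X ≫ proj (tens M N) P := π_descLeft _ _ _ _ _

theorem proj_assocInvAux_assoc : type_of% (reassoc_of% @proj_assocInvAux) := @(reassoc_of% @proj_assocInvAux)

/-- The inverse associator. -/
def assocInv (M N P : LocalModule A) : tens M (tens N P) ⟶ tens (tens M N) P :=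
  tensDesc (assocInvAux M N P)
    (by
      have h := actL_nat (a := act A M.X) (a' := act A M.X) (𝟙 M.X) (proj N P) (by simp)
      rw [MonoidalCategory.id_tensorHom] at h
      rw [← cancel_epi (A ◁ M.X ◁ proj N P), ← reassoc_of% h, proj_assocInvAux,
        ← whiskerLeft_comp_assoc, proj_assocInvAux, ← Category.assoc, actL_actL_assoc_inv,
        Category.assoc, tri₁']
      simp)
    (by
      have h := actR_nat (b := actL (act A N.X) P.X) (b' := act A (tens N P).X) (𝟙 M.X)
        (proj N P) (proj_act N P).symm
      rw [MonoidalCategory.id_tensorHom] at h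
      rw [← cancel_epi (A ◁ M.X ◁ proj N P), ← reassoc_of% h, proj_assocInvAux,
        ← whiskerLeft_comp_assoc, proj_assocInvAux, ← Category.assoc, actL_actR_assoc_inv,
        Category.assoc, tri₂']
      simp)

theorem proj_assocInv (M N P : LocalModule A) :
    M.X ◁ proj N P ≫ proj M (tens N P) ≫ (assocInv M N P).hom =
      (α_ _ _ _).inv ≫ proj M N ▷ P.X ≫ proj (tens M N) P := by
  rw [assocInv, proj_tensDesc, proj_assocInvAux]

theorem proj_assocInv_assoc : type_of% (reassoc_of% @proj_assocInv) := @(reassoc_of% @proj_assocInv)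

/-- The associativity isomorphism of the relative tensor product. -/
def assocIso (M N P : LocalModule A) : tens (tens M N) P ≅ tens M (tens N P) where
  hom := assocHom M N P
  inv := assocInv M N P
  hom_inv_id := by
    apply tens_hom_ext
    rw [← cancel_epi (proj M N ▷ P.X), comp_hom, proj_assocHom_assoc, proj_assocInv]
    simp
  inv_hom_id := by
    apply tens_hom_ext
    rw [← cancel_epi (M.X ◁ proj N P), comp_hom, proj_assocInv_assoc, proj_assocHom]
    simp

/-- The algebra as a module over itself. -/
def unit (A : C) [MonObj A] [IsCommMonObj A] : LocalModule A :=
  letI := ModObj.regular A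
  { X := A
    loc := by
      change _ ≫ _ ≫ μ[A] = μ[A]
      simp }

theorem act_unit : act A (unit A).X = μ[A] := rfl

/-- The unit `1 ⟶ A` as a map to the tensor unit. -/
def unitη (A : C) [MonObj A] [IsCommMonObj A] : 𝟙_ C ⟶ (unit A).X := η[A]

theorem act_aux₁ (X : C) [ModObj A X] : actL μ[A] X ≫ act A X = A ◁ act A X ≫ act A X := by
  rw [actL, Category.assoc, mul_act, Iso.inv_hom_id_assoc]

theorem act_aux₂ (X : C) [ModObj A X] :
    actR A (act A X) ≫ act A X = A ◁ act A X ≫ act A X := by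
  rw [← act_aux₁, actR, actL, Category.assoc, Category.assoc, Category.assoc, Category.assoc,
    ← mul_act, ← comp_whiskerRight_assoc, IsCommMonObj.mul_comm]

theorem act_aux₃ (X : C) [ModObj A X] :
    act A X ≫ (λ_ X).inv ≫ η[A] ▷ X = (λ_ _).inv ≫ η[A] ▷ (A ⊗ X) ≫ A ◁ act A X := by
  rw [← whisker_exchange]; simp

/-- The left unit constraint. -/
def lHom (M : LocalModule A) : tens (unit A) M ⟶ M :=
  tensDesc (M := unit A) (act A M.X) (act_aux₁ M.X) (act_aux₂ M.X)

theorem proj_lHom (M : LocalModule A) : proj (unit A) M ≫ (lHom M).hom = act A M.X :=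
  proj_tensDesc _ _ _

theorem proj_lHom_assoc : type_of% (reassoc_of% @proj_lHom) := @(reassoc_of% @proj_lHom)

/-- The projection `A ⊗ M ⟶ A ⊗_A M`. -/
def projU (M : LocalModule A) : A ⊗ M.X ⟶ (tens (unit A) M).X := proj (unit A) M

theorem projU_cond (M : LocalModule A) :
    A ◁ act A M.X ≫ projU M = (α_ _ _ _).inv ≫ μ[A] ▷ M.X ≫ projU M := by
  have h : actL μ[A] M.X ≫ projU M = actR A (act A M.X) ≫ projU M := proj_condition (unit A) M
  rw [← cancel_epi ((α_ A A M.X).inv ≫ (β_ A A).hom ▷ M.X ≫ (α_ A A M.X).hom)]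
  simp only [Category.assoc, actR_fold, ← h, Iso.hom_inv_id_assoc]
  rw [← comp_whiskerRight_assoc, IsCommMonObj.mul_comm, actL, Category.assoc]

theorem act_projU (M : LocalModule A) :
    act A M.X ≫ (λ_ M.X).inv ≫ η[A] ▷ M.X ≫ projU M = projU M := by
  have h := act_aux₃ (A := A) M.X =≫ projU M
  simp only [Category.assoc] at h
  rw [h, projU_cond, associator_inv_naturality_left_assoc, ← comp_whiskerRight_assoc,
    MonObj.one_mul]
  simp

theorem projU_act (M : LocalModule A) :
    A ◁ projU M ≫ act A (tens (unit A) M).X = actL μ[A] M.X ≫ projU M := proj_act (unit A) M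

/-- The inverse of the left unit constraint. -/
def lInv (M : LocalModule A) : M ⟶ tens (unit A) M where
  hom := (λ_ M.X).inv ≫ η[A] ▷ M.X ≫ projU M
  lin := by
    rw [act_projU, whiskerLeft_comp_assoc, whiskerLeft_comp_assoc, projU_act]
    calc _ = 𝟙 _ ≫ projU M := by simp
      _ = ((ρ_ A).inv ≫ A ◁ η[A] ≫ μ[A]) ▷ M.X ≫ projU M := by rw [MonObj.mul_one]; simp
      _ = _ := by rw [actL]; monoidal

/-- The left unit isomorphism. -/
def lIso (M : LocalModule A) : tens (unit A) M ≅ M where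
  hom := lHom M
  inv := lInv M
  hom_inv_id := by
    apply tens_hom_ext
    rw [comp_hom, proj_lHom_assoc]
    exact (act_projU M).trans (Category.comp_id _).symm
  inv_hom_id := by
    ext
    have h : projU M ≫ (lHom M).hom = act A M.X := proj_lHom M
    simp [lInv, h]

/-- The braiding. -/
def bHom (M N : LocalModule A) : tens M N ⟶ tens N M :=
  tensDesc ((β_ M.X N.X).hom ≫ proj N M)
    (by rw [← Category.assoc, actL_braiding, Category.assoc, whiskerLeft_comp_assoc, proj_act'])
    (by
      rw [← Category.assoc, actR_braiding, Category.assoc, Category.assoc, proj_condition,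
        ← Category.assoc (A ◁ _), ← actL_braiding, Category.assoc, ← Category.assoc,
        twistL_actL _ M.loc, ← Category.assoc, actL_braiding, Category.assoc,
        whiskerLeft_comp_assoc, proj_act'])

@[simp] theorem proj_bHom (M N : LocalModule A) :
    proj M N ≫ (bHom M N).hom = (β_ M.X N.X).hom ≫ proj N M := proj_tensDesc _ _ _

@[simp] theorem proj_bHom_assoc : type_of% (reassoc_of% @proj_bHom) := @(reassoc_of% @proj_bHom)

/-- The inverse braiding. -/
def bInv (M N : LocalModule A) : tens N M ⟶ tens M N :=
  tensDesc ((β_ M.X N.X).inv ≫ proj M N)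
    (by
      rw [← cancel_epi (twistL A M.X N.X ≫ A ◁ (β_ M.X N.X).hom), Category.assoc, Category.assoc]
      have h := actR_braiding M.X (act A N.X)
      rw [← reassoc_of% h, Iso.hom_inv_id_assoc, ← whiskerLeft_comp_assoc, Iso.hom_inv_id_assoc,
        proj_act, ← Category.assoc, twistL_actL _ M.loc, proj_condition])
    (by
      rw [← cancel_epi (A ◁ (β_ M.X N.X).hom)]
      have h := actL_braiding (act A M.X) N.X
      rw [← reassoc_of% h, Iso.hom_inv_id_assoc, ← whiskerLeft_comp_assoc, Iso.hom_inv_id_assoc,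
        proj_act])

@[simp] theorem proj_bInv (M N : LocalModule A) :
    proj N M ≫ (bInv M N).hom = (β_ M.X N.X).inv ≫ proj M N := proj_tensDesc _ _ _

@[simp] theorem proj_bInv_assoc : type_of% (reassoc_of% @proj_bInv) := @(reassoc_of% @proj_bInv)

/-- The braiding isomorphism. -/
def bIso (M N : LocalModule A) : tens M N ≅ tens N M where
  hom := bHom M N
  inv := bInv M N
  hom_inv_id := by apply tens_hom_ext; simp
  inv_hom_id := by apply tens_hom_ext; simp

instance : MonoidalCategoryStruct (LocalModule A) where
  tensorObj := tens
  whiskerLeft M _ _ f := tensMap (𝟙 M) f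
  whiskerRight f N := tensMap f (𝟙 N)
  tensorHom := tensMap
  tensorUnit := unit A
  associator := assocIso
  leftUnitor := lIso
  rightUnitor M := bIso M (unit A) ≪≫ lIso M

/-- The canonical projection from the tensor product of the underlying objects to the relative
tensor product. -/
def pr (M N : LocalModule A) : M.X ⊗ N.X ⟶ (M ⊗ N).X := proj M N

/-- The unit morphism of the algebra, as a morphism to the tensor unit. -/
def un (A : C) [MonObj A] [IsCommMonObj A] : 𝟙_ C ⟶ (𝟙_ (LocalModule A)).X := η[A]

theorem regEpi_pr (M N : LocalModule A) : RegEpi (pr M N) := regEpi_π _ _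

instance (M N : LocalModule A) : Epi (pr M N) := (regEpi_pr M N).epi
instance (M N : LocalModule A) (Z : C) : Epi (Z ◁ pr M N) :=
  ((regEpi_pr M N).whiskerLeft Z).epi
instance (M N : LocalModule A) (Z : C) : Epi (pr M N ▷ Z) :=
  ((regEpi_pr M N).whiskerRight Z).epi
instance (M N : LocalModule A) (Z W : C) : Epi (W ◁ pr M N ▷ Z) :=
  (((regEpi_pr M N).whiskerRight Z).whiskerLeft W).epi
instance (M N : LocalModule A) (Z W : C) : Epi (W ◁ Z ◁ pr M N) :=
  (((regEpi_pr M N).whiskerLeft Z).whiskerLeft W).epi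
instance (M N : LocalModule A) (Z W : C) : Epi (pr M N ▷ Z ▷ W) :=
  (((regEpi_pr M N).whiskerRight Z).whiskerRight W).epi
instance (M N : LocalModule A) (Z W : C) : Epi ((Z ◁ pr M N) ▷ W) :=
  (((regEpi_pr M N).whiskerLeft Z).whiskerRight W).epi

theorem pr_ext {M N P : LocalModule A} {f g : M ⊗ N ⟶ P}
    (h : pr M N ≫ f.hom = pr M N ≫ g.hom) : f = g := tens_hom_ext h

theorem pr_act (M N : LocalModule A) :
    A ◁ pr M N ≫ act A (M ⊗ N).X = actL (act A M.X) N.X ≫ pr M N := π_relAct M N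

theorem pr_act_assoc : type_of% (reassoc_of% @pr_act) := @(reassoc_of% @pr_act)

theorem pr_act' (M N : LocalModule A) :
    A ◁ pr M N ≫ act A (M ⊗ N).X = actR M.X (act A N.X) ≫ pr M N := π_relAct' M N

theorem pr_act'_assoc : type_of% (reassoc_of% @pr_act') := @(reassoc_of% @pr_act')

theorem pr_condition (M N : LocalModule A) :
    actL (act A M.X) N.X ≫ pr M N = actR M.X (act A N.X) ≫ pr M N :=
  π_condition M N

theorem pr_condition_assoc : type_of% (reassoc_of% @pr_condition) := @(reassoc_of% @pr_condition)

/-- Bilinear morphisms descend to the relative tensor product. -/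
def desc {M N P : LocalModule A} (k : M.X ⊗ N.X ⟶ P.X)
    (h₁ : actL (act A M.X) N.X ≫ k = A ◁ k ≫ act A P.X)
    (h₂ : actR M.X (act A N.X) ≫ k = A ◁ k ≫ act A P.X) : M ⊗ N ⟶ P := tensDesc k h₁ h₂

@[simp] theorem pr_desc {M N P : LocalModule A} (k : M.X ⊗ N.X ⟶ P.X)
    (h₁ : actL (act A M.X) N.X ≫ k = A ◁ k ≫ act A P.X)
    (h₂ : actR M.X (act A N.X) ≫ k = A ◁ k ≫ act A P.X) :
    pr M N ≫ (desc k h₁ h₂).hom = k := proj_tensDesc k h₁ h₂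

@[simp] theorem pr_desc_assoc : type_of% (reassoc_of% @pr_desc) := @(reassoc_of% @pr_desc)

@[simp] theorem pr_tensor {M M' N N' : LocalModule A} (f : M ⟶ M') (g : N ⟶ N') :
    pr M N ≫ (f ⊗ₘ g).hom = (f.hom ⊗ₘ g.hom) ≫ pr M' N' := proj_tensMap f g

@[simp] theorem pr_tensor_assoc : type_of% (reassoc_of% @pr_tensor) := @(reassoc_of% @pr_tensor)

@[simp] theorem pr_whiskerLeft (M : LocalModule A) {N N' : LocalModule A} (g : N ⟶ N') :
    pr M N ≫ (M ◁ g).hom = M.X ◁ g.hom ≫ pr M N' :=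
  (proj_tensMap (𝟙 M) g).trans (by simp; rfl)

@[simp] theorem pr_whiskerLeft_assoc : type_of% (reassoc_of% @pr_whiskerLeft) := @(reassoc_of% @pr_whiskerLeft)

@[simp] theorem pr_whiskerRight {M M' : LocalModule A} (f : M ⟶ M') (N : LocalModule A) :
    pr M N ≫ (f ▷ N).hom = f.hom ▷ N.X ≫ pr M' N :=
  (proj_tensMap f (𝟙 N)).trans (by simp; rfl)

@[simp] theorem pr_whiskerRight_assoc : type_of% (reassoc_of% @pr_whiskerRight) := @(reassoc_of% @pr_whiskerRight)

theorem pr_associator (M N P : LocalModule A) :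
    pr M N ▷ P.X ≫ pr (M ⊗ N) P ≫ (α_ M N P).hom.hom =
      (α_ M.X N.X P.X).hom ≫ M.X ◁ pr N P ≫ pr M (N ⊗ P) := proj_assocHom M N P

theorem pr_associator_assoc : type_of% (reassoc_of% @pr_associator) := @(reassoc_of% @pr_associator)

theorem pr_associator_inv (M N P : LocalModule A) :
    M.X ◁ pr N P ≫ pr M (N ⊗ P) ≫ (α_ M N P).inv.hom =
      (α_ M.X N.X P.X).inv ≫ pr M N ▷ P.X ≫ pr (M ⊗ N) P := proj_assocInv M N P

theorem pr_associator_inv_assoc : type_of% (reassoc_of% @pr_associator_inv) := @(reassoc_of% @pr_associator_inv)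

theorem pr_leftUnitor (M : LocalModule A) :
    un A ▷ M.X ≫ pr (𝟙_ _) M ≫ (λ_ M).hom.hom = (λ_ M.X).hom := by
  have h : pr (𝟙_ _) M ≫ (λ_ M).hom.hom = act A M.X := proj_lHom M
  rw [h]; exact one_act A M.X

theorem pr_leftUnitor_assoc : type_of% (reassoc_of% @pr_leftUnitor) := @(reassoc_of% @pr_leftUnitor)

theorem pr_rightUnitor (M : LocalModule A) :
    M.X ◁ un A ≫ pr M (𝟙_ _) ≫ (ρ_ M).hom.hom = (ρ_ M.X).hom := by
  have h : pr (𝟙_ _) M ≫ (λ_ M).hom.hom = act A M.X := proj_lHom M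
  have h' : pr M (𝟙_ _) ≫ (ρ_ M).hom.hom =
      (β_ M.X (𝟙_ (LocalModule A)).X).hom ≫ pr (𝟙_ _) M ≫ (λ_ M).hom.hom :=
    proj_bHom_assoc M (unit A) _
  rw [h', BraidedCategory.braiding_naturality_right_assoc, pr_leftUnitor]
  simp

theorem pr_rightUnitor_assoc : type_of% (reassoc_of% @pr_rightUnitor) := @(reassoc_of% @pr_rightUnitor)

instance (M : LocalModule A) : Epi (un A ▷ M.X ≫ pr (𝟙_ _) M) := by
  have h : un A ▷ M.X ≫ pr (𝟙_ _) M = (λ_ M.X).hom ≫ (λ_ M).inv.hom := by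
    rw [← pr_leftUnitor M]
    simp [← comp_hom]
  have : IsIso (λ_ M).inv.hom := inferInstanceAs (IsIso ((forget A).map (λ_ M).inv))
  rw [h]; infer_instance

end LocalModule

namespace LocalModule

variable {C : Type u} [Category.{v} C] [MonoidalCategory C] [BraidedCategory C]
  [HasCoequalizers C] [∀ X : C, PreservesColimitsOfShape WalkingParallelPair (tensorLeft X)]
  {A : C} [MonObj A] [IsCommMonObj A]

instance (M : LocalModule A) : IsIso (M.X ◁ un A ≫ pr M (𝟙_ _)) := by
  have h : M.X ◁ un A ≫ pr M (𝟙_ _) = (ρ_ M.X).hom ≫ (ρ_ M).inv.hom := by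
    rw [← pr_rightUnitor M]
    simp [← comp_hom]
  have : IsIso (ρ_ M).inv.hom := inferInstanceAs (IsIso ((forget A).map (ρ_ M).inv))
  rw [h]; infer_instance

theorem assoc_nat {M N P M' N' P' : LocalModule A} (f : M ⟶ M') (g : N ⟶ N') (h : P ⟶ P') :
    ((f ⊗ₘ g) ⊗ₘ h) ≫ (α_ M' N' P').hom = (α_ M N P).hom ≫ (f ⊗ₘ (g ⊗ₘ h)) := by
  apply pr_ext
  rw [← cancel_epi (pr M N ▷ P.X)]
  calc _ = (pr M N ≫ (f ⊗ₘ g).hom) ▷ P.X ≫ (M' ⊗ N').X ◁ h.hom ≫ pr (M' ⊗ N') P' ≫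
        (α_ M' N' P').hom.hom := by
        rw [comp_hom, pr_tensor_assoc, MonoidalCategory.tensorHom_def (f ⊗ₘ g).hom,
          comp_whiskerRight]
        simp only [Category.assoc]
    _ = (f.hom ⊗ₘ g.hom) ▷ P.X ≫ (M'.X ⊗ N'.X) ◁ h.hom ≫ pr M' N' ▷ P'.X ≫ pr (M' ⊗ N') P' ≫
        (α_ M' N' P').hom.hom := by
        rw [pr_tensor, comp_whiskerRight_assoc, ← whisker_exchange_assoc]
    _ = ((f.hom ⊗ₘ g.hom) ⊗ₘ h.hom) ≫ (α_ M'.X N'.X P'.X).hom ≫ M'.X ◁ pr N' P' ≫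
        pr M' (N' ⊗ P') := by
        rw [pr_associator, MonoidalCategory.tensorHom_def _ h.hom, Category.assoc]
    _ = (α_ M.X N.X P.X).hom ≫ (f.hom ⊗ₘ ((g.hom ⊗ₘ h.hom) ≫ pr N' P')) ≫ pr M' (N' ⊗ P') := by
        simp [MonoidalCategory.tensorHom_def]
    _ = (α_ M.X N.X P.X).hom ≫ (f.hom ⊗ₘ (pr N P ≫ (g ⊗ₘ h).hom)) ≫ pr M' (N' ⊗ P') := by
        rw [pr_tensor]
    _ = (α_ M.X N.X P.X).hom ≫ M.X ◁ pr N P ≫ (f.hom ⊗ₘ (g ⊗ₘ h).hom) ≫ pr M' (N' ⊗ P') := by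
        rw [MonoidalCategory.tensorHom_def' f.hom, whiskerLeft_comp,
          MonoidalCategory.tensorHom_def' f.hom]
        simp only [Category.assoc]
    _ = _ := by rw [← pr_tensor, comp_hom, pr_associator_assoc]

instance : MonoidalCategory (LocalModule A) where
  tensorHom_def f g := by
    apply pr_ext; simp [MonoidalCategory.tensorHom_def]
  id_tensorHom_id M N := by apply pr_ext; simp
  tensorHom_comp_tensorHom f g f' g' := by apply pr_ext; simp
  whiskerLeft_id M N := by apply pr_ext; simp
  id_whiskerRight M N := by apply pr_ext; simp
  associator_naturality f g h := assoc_nat f g h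
  leftUnitor_naturality {M N} f := by
    apply pr_ext
    change projU M ≫ ((𝟙_ (LocalModule A)) ◁ f ≫ (λ_ N).hom).hom = projU M ≫ _
    have h : ∀ P : LocalModule A, projU P ≫ (λ_ P).hom.hom = act A P.X := proj_lHom
    have h' : projU M ≫ ((𝟙_ (LocalModule A)) ◁ f).hom = A ◁ f.hom ≫ projU N :=
      pr_whiskerLeft (𝟙_ _) f
    simp [reassoc_of% h, reassoc_of% h', h, f.lin]
  rightUnitor_naturality {M N} f := by
    apply hom_ext
    rw [← cancel_epi (M.X ◁ un A ≫ pr M (𝟙_ _))]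
    simp only [comp_hom, Category.assoc, pr_whiskerRight_assoc, pr_rightUnitor_assoc]
    rw [whisker_exchange_assoc, pr_rightUnitor]
    simp
  triangle M N := by
    apply pr_ext
    rw [← cancel_epi ((M.X ◁ un A ≫ pr M (𝟙_ _)) ▷ N.X)]
    have h := pr_rightUnitor M
    have h' := pr_leftUnitor N
    simp only [comp_hom, pr_whiskerRight, comp_whiskerRight, Category.assoc, pr_associator_assoc,
      pr_whiskerLeft]
    rw [← whiskerLeft_comp_assoc, ← comp_whiskerRight_assoc (pr _ _), ← comp_whiskerRight_assoc, h,
      associator_naturality_middle_assoc, ← whiskerLeft_comp_assoc, h']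
    simp
  pentagon M N P Q := by
    apply pr_ext
    rw [← cancel_epi (pr (M ⊗ N) P ▷ Q.X), ← cancel_epi (pr M N ▷ P.X ▷ Q.X)]
    calc _ = (pr M N ▷ P.X ≫ pr (M ⊗ N) P ≫ (α_ M N P).hom.hom) ▷ Q.X ≫
            pr (M ⊗ (N ⊗ P)) Q ≫ (α_ M (N ⊗ P) Q).hom.hom ≫ (M ◁ (α_ N P Q).hom).hom := by
          simp
      _ = (α_ M.X N.X P.X).hom ▷ Q.X ≫ (M.X ◁ pr N P) ▷ Q.X ≫ (α_ _ _ _).hom ≫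
            M.X ◁ (pr (N ⊗ P) Q ≫ (α_ N P Q).hom.hom) ≫ pr M (N ⊗ (P ⊗ Q)) := by
          rw [pr_associator, comp_whiskerRight, comp_whiskerRight, Category.assoc, Category.assoc,
            pr_associator_assoc, pr_whiskerLeft, whiskerLeft_comp_assoc]
      _ = (α_ M.X N.X P.X).hom ▷ Q.X ≫ (α_ _ _ _).hom ≫
            M.X ◁ (pr N P ▷ Q.X ≫ pr (N ⊗ P) Q ≫ (α_ N P Q).hom.hom) ≫ pr M (N ⊗ (P ⊗ Q)) := by
          simp
      _ = (α_ M.X N.X P.X).hom ▷ Q.X ≫ (α_ _ _ _).hom ≫ M.X ◁ (α_ N.X P.X Q.X).hom ≫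
            M.X ◁ N.X ◁ pr P Q ≫ M.X ◁ pr N (P ⊗ Q) ≫ pr M (N ⊗ (P ⊗ Q)) := by
          rw [pr_associator]; simp
      _ = (α_ (M.X ⊗ N.X) P.X Q.X).hom ≫ (M.X ⊗ N.X) ◁ pr P Q ≫ (α_ _ _ _).hom ≫
            M.X ◁ pr N (P ⊗ Q) ≫ pr M (N ⊗ (P ⊗ Q)) := by simp
      _ = (α_ (M.X ⊗ N.X) P.X Q.X).hom ≫ ((M.X ⊗ N.X) ◁ pr P Q ≫ pr M N ▷ (P ⊗ Q).X) ≫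
            pr (M ⊗ N) (P ⊗ Q) ≫ (α_ M N (P ⊗ Q)).hom.hom := by
          rw [← pr_associator, Category.assoc]
      _ = _ := by
          rw [whisker_exchange]
          simp only [comp_hom, pr_associator_assoc, Category.assoc]
          rw [associator_naturality_left_assoc]

/-- The braiding isomorphism, with source and target in terms of the tensor product. -/
def bIso' (M N : LocalModule A) : M ⊗ N ≅ N ⊗ M := bIso M N

theorem pr_bIso' (M N : LocalModule A) :
    pr M N ≫ (bIso' M N).hom.hom = (β_ M.X N.X).hom ≫ pr N M := proj_bHom M N

theorem pr_bIso'_assoc : type_of% (reassoc_of% @pr_bIso') := @(reassoc_of% @pr_bIso')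

instance : BraidedCategory (LocalModule A) where
  braiding := bIso'
  braiding_naturality_right M N P f := by
    apply pr_ext
    simp [pr_bIso', pr_bIso'_assoc]
  braiding_naturality_left f P := by
    apply pr_ext
    simp [pr_bIso', pr_bIso'_assoc]
  hexagon_forward M N P := by
    apply pr_ext
    rw [← cancel_epi (pr M N ▷ P.X)]
    simp only [comp_hom, pr_associator_assoc, pr_bIso'_assoc, pr_whiskerLeft, pr_whiskerRight_assoc]
    rw [BraidedCategory.braiding_naturality_right_assoc, pr_associator,
      ← comp_whiskerRight_assoc (pr M N), pr_bIso', comp_whiskerRight_assoc, pr_associator_assoc,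
      pr_whiskerLeft, ← whiskerLeft_comp_assoc, pr_bIso']
    simp
  hexagon_reverse M N P := by
    apply pr_ext
    rw [← cancel_epi (M.X ◁ pr N P)]
    simp only [comp_hom, pr_associator_inv_assoc, pr_bIso'_assoc, pr_whiskerRight,
      pr_whiskerLeft_assoc]
    rw [BraidedCategory.braiding_naturality_left_assoc, pr_associator_inv,
      ← whiskerLeft_comp_assoc M.X (pr N P), pr_bIso', whiskerLeft_comp_assoc,
      pr_associator_inv_assoc, pr_whiskerRight, ← comp_whiskerRight_assoc, pr_bIso']
    simp

theorem pr_braiding (M N : LocalModule A) :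
    pr M N ≫ (β_ M N).hom.hom = (β_ M.X N.X).hom ≫ pr N M := proj_bHom M N

theorem pr_braiding_assoc : type_of% (reassoc_of% @pr_braiding) := @(reassoc_of% @pr_braiding)

end LocalModule

/-! ### Yetter-Drinfeld modules over a Hopf algebra in a braided monoidal category -/

section YDAux

variable {C : Type u} [Category.{v} C] [MonoidalCategory C] [BraidedCategory C]
  {N : C} [HopfObj N]

/-- The diagonal action of `N` on `X ⊗ Y`, through the comultiplication and the braiding. -/
def tAct {X Y : C} (a : N ⊗ X ⟶ X) (b : N ⊗ Y ⟶ Y) : N ⊗ (X ⊗ Y) ⟶ X ⊗ Y :=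
  Δ[N] ▷ (X ⊗ Y) ≫ tensorμ N N X Y ≫ (a ⊗ₘ b)

/-- The codiagonal coaction of `N` on `X ⊗ Y`, through the multiplication and the braiding. -/
def tCo {X Y : C} (d : X ⟶ N ⊗ X) (e : Y ⟶ N ⊗ Y) : X ⊗ Y ⟶ N ⊗ (X ⊗ Y) :=
  (d ⊗ₘ e) ≫ tensorμ N X N Y ≫ μ[N] ▷ (X ⊗ Y)

/-- The morphism `x ⊗ y ↦ x₍₋₁₎ y ⊗ x₍₀₎`. -/
def half {X Y : C} (d : X ⟶ N ⊗ X) (b : N ⊗ Y ⟶ Y) : X ⊗ Y ⟶ Y ⊗ X :=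
  d ▷ Y ≫ (α_ N X Y).hom ≫ N ◁ (β_ X Y).hom ≫ (α_ N Y X).inv ≫ b ▷ X

/-- Associativity and unitality of an action. -/
structure IsAct {X : C} (a : N ⊗ X ⟶ X) : Prop where
  one : η[N] ▷ X ≫ a = (λ_ X).hom
  mul : μ[N] ▷ X ≫ a = (α_ N N X).hom ≫ N ◁ a ≫ a

/-- Coassociativity and counitality of a coaction. -/
structure IsCoact {X : C} (d : X ⟶ N ⊗ X) : Prop where
  counit : d ≫ ε[N] ▷ X = (λ_ X).inv
  comul : d ≫ Δ[N] ▷ X = d ≫ N ◁ d ≫ (α_ N N X).inv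

theorem tAct_isAct {X Y : C} {a : N ⊗ X ⟶ X} {b : N ⊗ Y ⟶ Y} (ha : IsAct a) (hb : IsAct b) :
    IsAct (tAct a b) where
  one := by
    rw [tAct, ← comp_whiskerRight_assoc, Bimon.one_comul, comp_whiskerRight_assoc,
      tensorμ_natural_left_assoc, MonoidalCategory.tensorHom_comp_tensorHom, ha.one, hb.one,
      ← tensor_left_unitality]
  mul := by
    have h := tensor_associativity N N N N X Y
    calc _ = (μ[N] ≫ Δ[N]) ▷ (X ⊗ Y) ≫ tensorμ N N X Y ≫ (a ⊗ₘ b) := by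
          rw [tAct, comp_whiskerRight_assoc]
      _ = (Δ[N] ⊗ₘ Δ[N]) ▷ (X ⊗ Y) ≫ tensorμ N N N N ▷ (X ⊗ Y) ≫
            tensorμ (N ⊗ N) (N ⊗ N) X Y ≫ ((μ[N] ▷ X ≫ a) ⊗ₘ (μ[N] ▷ Y ≫ b)) := by
          rw [BimonObj.mul_comul, comp_whiskerRight_assoc, comp_whiskerRight_assoc,
            tensorμ_natural_left_assoc, MonoidalCategory.tensorHom_comp_tensorHom]
      _ = (Δ[N] ⊗ₘ Δ[N]) ▷ (X ⊗ Y) ≫ (α_ _ _ _).hom ≫ (N ⊗ N) ◁ tensorμ N N X Y ≫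
            tensorμ N N (N ⊗ X) (N ⊗ Y) ≫ (N ◁ a ⊗ₘ N ◁ b) ≫ (a ⊗ₘ b) := by
          rw [ha.mul, hb.mul, ← MonoidalCategory.tensorHom_comp_tensorHom, reassoc_of% h,
            ← MonoidalCategory.tensorHom_comp_tensorHom]
      _ = (Δ[N] ⊗ₘ Δ[N]) ▷ (X ⊗ Y) ≫ (α_ _ _ _).hom ≫
            (N ⊗ N) ◁ (tensorμ N N X Y ≫ (a ⊗ₘ b)) ≫ tensorμ N N X Y ≫ (a ⊗ₘ b) := by
          rw [← tensorμ_natural_right_assoc, whiskerLeft_comp_assoc]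
      _ = (α_ _ _ _).hom ≫ (N ◁ Δ[N] ▷ (X ⊗ Y)) ≫ Δ[N] ▷ _ ≫
            (N ⊗ N) ◁ (tensorμ N N X Y ≫ (a ⊗ₘ b)) ≫ tensorμ N N X Y ≫ (a ⊗ₘ b) := by
          rw [MonoidalCategory.tensorHom_def', comp_whiskerRight_assoc,
            associator_naturality_left_assoc, associator_naturality_middle_assoc]
      _ = _ := by
          rw [← whisker_exchange_assoc]; simp only [tAct, whiskerLeft_comp, Category.assoc]

theorem tCo_isCoact {X Y : C} {d : X ⟶ N ⊗ X} {e : Y ⟶ N ⊗ Y} (hd : IsCoact d) (he : IsCoact e) :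
    IsCoact (tCo d e) where
  counit := by
    have h := tensorμ_natural ε[N] (𝟙 X) ε[N] (𝟙 Y)
    have h2 := leftUnitor_monoidal X Y
    rw [MonoidalCategory.id_tensorHom_id] at h
    simp only [MonoidalCategory.tensorHom_id] at h
    calc _ = (d ⊗ₘ e) ≫ tensorμ N X N Y ≫ (μ[N] ≫ ε[N]) ▷ (X ⊗ Y) := by
          rw [tCo]; simp only [comp_whiskerRight, Category.assoc]
      _ = (d ⊗ₘ e) ≫ ((ε[N] ▷ X) ⊗ₘ (ε[N] ▷ Y)) ≫ tensorμ _ _ _ _ ≫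
            (λ_ (𝟙_ C)).hom ▷ (X ⊗ Y) := by
          rw [Bimon.mul_counit, comp_whiskerRight, reassoc_of% h]
      _ = _ := by
          rw [MonoidalCategory.tensorHom_comp_tensorHom_assoc, hd.counit, he.counit,
            ← cancel_mono (λ_ (X ⊗ Y)).hom]
          simp only [Category.assoc]
          rw [← h2, MonoidalCategory.tensorHom_comp_tensorHom]
          simp
  comul := by
    have h := associator_monoidal N N X N N Y
    have h1 := tensorμ_natural Δ[N] (𝟙 X) Δ[N] (𝟙 Y)
    have h2 := tensorμ_natural (𝟙 N) d (𝟙 N) e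
    rw [MonoidalCategory.id_tensorHom_id] at h1 h2
    simp only [MonoidalCategory.tensorHom_id, MonoidalCategory.id_tensorHom] at h1 h2
    rw [← cancel_mono (α_ _ _ _).hom]
    calc _ = (d ⊗ₘ e) ≫ tensorμ N X N Y ≫ (μ[N] ≫ Δ[N]) ▷ (X ⊗ Y) ≫ (α_ _ _ _).hom := by
          rw [tCo]; simp only [comp_whiskerRight, Category.assoc]
      _ = ((d ≫ Δ[N] ▷ X) ⊗ₘ (e ≫ Δ[N] ▷ Y)) ≫ tensorμ (N ⊗ N) X (N ⊗ N) Y ≫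
            tensorμ N N N N ▷ (X ⊗ Y) ≫ (α_ _ _ _).hom ≫ (μ[N] ⊗ₘ (μ[N] ▷ (X ⊗ Y))) := by
          rw [BimonObj.mul_comul, ← MonoidalCategory.tensorHom_comp_tensorHom_assoc,
            reassoc_of% h1, comp_whiskerRight_assoc, comp_whiskerRight_assoc,
            ← MonoidalCategory.tensorHom_id (μ[N]), ← associator_naturality,
            MonoidalCategory.tensorHom_id (_ ⊗ₘ _)]
      _ = ((d ≫ N ◁ d) ⊗ₘ (e ≫ N ◁ e)) ≫ tensorμ N (N ⊗ X) N (N ⊗ Y) ≫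
            (N ⊗ N) ◁ tensorμ N X N Y ≫ (μ[N] ⊗ₘ (μ[N] ▷ (X ⊗ Y))) := by
          rw [hd.comul, he.comul, reassoc_of% h, MonoidalCategory.tensorHom_comp_tensorHom_assoc]
          simp only [Category.assoc, Iso.inv_hom_id, Category.comp_id]
      _ = (d ⊗ₘ e) ≫ tensorμ N X N Y ≫ (N ⊗ N) ◁ (d ⊗ₘ e) ≫
            (N ⊗ N) ◁ tensorμ N X N Y ≫ (N ⊗ N) ◁ μ[N] ▷ (X ⊗ Y) ≫ μ[N] ▷ _ := by
          rw [← MonoidalCategory.tensorHom_comp_tensorHom_assoc, reassoc_of% h2,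
            MonoidalCategory.tensorHom_def' μ[N]]
      _ = _ := by
          rw [whisker_exchange, whisker_exchange_assoc, whisker_exchange_assoc]
          simp only [tCo, whiskerLeft_comp, Category.assoc, Iso.inv_hom_id, Category.comp_id]

theorem tAct_nat {X Y X' Y' : C} {a : N ⊗ X ⟶ X} {b : N ⊗ Y ⟶ Y} {a' : N ⊗ X' ⟶ X'}
    {b' : N ⊗ Y' ⟶ Y'} (f : X ⟶ X') (g : Y ⟶ Y') (hf : a ≫ f = N ◁ f ≫ a')
    (hg : b ≫ g = N ◁ g ≫ b') : tAct a b ≫ (f ⊗ₘ g) = N ◁ (f ⊗ₘ g) ≫ tAct a' b' := by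
  rw [tAct, tAct, whisker_exchange_assoc, tensorμ_natural_right_assoc,
    MonoidalCategory.tensorHom_comp_tensorHom, ← hf, ← hg]
  simp only [Category.assoc, MonoidalCategory.tensorHom_comp_tensorHom]

theorem tCo_nat {X Y X' Y' : C} {d : X ⟶ N ⊗ X} {e : Y ⟶ N ⊗ Y} {d' : X' ⟶ N ⊗ X'}
    {e' : Y' ⟶ N ⊗ Y'} (f : X ⟶ X') (g : Y ⟶ Y') (hf : d ≫ N ◁ f = f ≫ d')
    (hg : e ≫ N ◁ g = g ≫ e') : tCo d e ≫ N ◁ (f ⊗ₘ g) = (f ⊗ₘ g) ≫ tCo d' e' := by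
  have h := tensorμ_natural (𝟙 N) f (𝟙 N) g
  rw [MonoidalCategory.id_tensorHom_id, MonoidalCategory.id_tensorHom,
    MonoidalCategory.id_tensorHom, MonoidalCategory.id_tensorHom] at h
  rw [tCo, tCo, MonoidalCategory.tensorHom_comp_tensorHom_assoc, ← hf, ← hg,
    ← MonoidalCategory.tensorHom_comp_tensorHom_assoc, reassoc_of% h, whisker_exchange]
  simp only [Category.assoc]

theorem tAct_assoc {X Y Z : C} (a : N ⊗ X ⟶ X) (b : N ⊗ Y ⟶ Y) (c : N ⊗ Z ⟶ Z) :
    tAct (tAct a b) c ≫ (α_ X Y Z).hom = N ◁ (α_ X Y Z).hom ≫ tAct a (tAct b c) := by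
  have h := associator_monoidal N N N X Y Z
  calc _ = (Δ[N] ≫ Δ[N] ▷ N) ▷ ((X ⊗ Y) ⊗ Z) ≫ tensorμ (N ⊗ N) N (X ⊗ Y) Z ≫
        (tensorμ N N X Y ▷ (N ⊗ Z)) ≫ (α_ _ _ _).hom ≫ (a ⊗ₘ (b ⊗ₘ c)) := by
        have h1 := tensorμ_natural_left Δ[N] (𝟙 N) (X ⊗ Y) Z
        rw [MonoidalCategory.tensorHom_id] at h1
        rw [← associator_naturality, comp_whiskerRight_assoc, reassoc_of% h1]
        simp only [tAct, MonoidalCategory.tensorHom_def, comp_whiskerRight, Category.assoc, MonoidalCategory.id_whiskerRight, MonoidalCategory.whiskerLeft_id,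
          Category.id_comp]
    _ = (Δ[N] ≫ N ◁ Δ[N]) ▷ ((X ⊗ Y) ⊗ Z) ≫ (N ⊗ (N ⊗ N)) ◁ (α_ X Y Z).hom ≫
          tensorμ N (N ⊗ N) X (Y ⊗ Z) ≫ (N ⊗ X) ◁ tensorμ N N Y Z ≫ (a ⊗ₘ (b ⊗ₘ c)) := by
        rw [reassoc_of% h, MonoidalCategory.tensorHom_def (α_ N N N).hom, Category.assoc,
          ← comp_whiskerRight_assoc, Category.assoc, ← ComonObj.comul_assoc]
    _ = _ := by
        have h1 := tensorμ_natural_left (𝟙 N) Δ[N] X (Y ⊗ Z)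
        rw [MonoidalCategory.id_tensorHom] at h1
        rw [← whisker_exchange_assoc, comp_whiskerRight_assoc, reassoc_of% h1]
        simp only [tAct, MonoidalCategory.tensorHom_def', whiskerLeft_comp, Category.assoc,
          MonoidalCategory.id_whiskerRight, Category.comp_id]

theorem tCo_assoc {X Y Z : C} (a : X ⟶ N ⊗ X) (b : Y ⟶ N ⊗ Y) (c : Z ⟶ N ⊗ Z) :
    tCo (tCo a b) c ≫ N ◁ (α_ X Y Z).hom = (α_ X Y Z).hom ≫ tCo a (tCo b c) := by
  have h := tensor_associativity N X N Y N Z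
  calc _ = ((a ⊗ₘ b) ⊗ₘ c) ≫ (tensorμ N X N Y ▷ (N ⊗ Z)) ≫ tensorμ (N ⊗ N) (X ⊗ Y) N Z ≫
        (μ[N] ▷ N ≫ μ[N]) ▷ ((X ⊗ Y) ⊗ Z) ≫ N ◁ (α_ X Y Z).hom := by
        have h1 := tensorμ_natural_left μ[N] (𝟙 (X ⊗ Y)) N Z
        rw [MonoidalCategory.tensorHom_id, MonoidalCategory.id_whiskerRight,
          MonoidalCategory.tensorHom_id] at h1
        rw [comp_whiskerRight_assoc, ← reassoc_of% h1]
        simp only [tCo, MonoidalCategory.tensorHom_def', comp_whiskerRight, Category.assoc]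
    _ = ((a ⊗ₘ b) ⊗ₘ c) ≫ (α_ _ _ _).hom ≫ (N ⊗ X) ◁ tensorμ N Y N Z ≫
          tensorμ N X (N ⊗ N) (Y ⊗ Z) ≫ (N ◁ μ[N] ≫ μ[N]) ▷ (X ⊗ (Y ⊗ Z)) := by
        rw [← whisker_exchange, ← reassoc_of% h, MonObj.mul_assoc,
          MonoidalCategory.tensorHom_def' (α_ N N N).hom, comp_whiskerRight (α_ N N N).hom]
        simp only [Category.assoc]
    _ = _ := by
        have h1 := tensorμ_natural_right N X μ[N] (𝟙 (Y ⊗ Z))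
        rw [MonoidalCategory.tensorHom_id, MonoidalCategory.whiskerLeft_id,
          MonoidalCategory.tensorHom_id] at h1
        rw [comp_whiskerRight, ← reassoc_of% h1, associator_naturality_assoc]
        simp only [tCo, MonoidalCategory.tensorHom_def, whiskerLeft_comp, Category.assoc]

/-- The trivial action. -/
def trAct (X : C) : N ⊗ X ⟶ X := ε[N] ▷ X ≫ (λ_ X).hom

/-- The trivial coaction. -/
def trCo (X : C) : X ⟶ N ⊗ X := (λ_ X).inv ≫ η[N] ▷ X

theorem trAct_isAct (X : C) : IsAct (trAct X : N ⊗ X ⟶ X) where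
  one := by rw [trAct, ← comp_whiskerRight_assoc, BimonObj.one_counit]; simp
  mul := by
    calc _ = (μ[N] ≫ ε[N]) ▷ X ≫ (λ_ X).hom := by rw [trAct, comp_whiskerRight_assoc]
      _ = 𝟙 _ ⊗≫ (ε[N] ▷ N ≫ (𝟙_ C) ◁ ε[N]) ▷ X ⊗≫ 𝟙 _ := by
        rw [Bimon.mul_counit, MonoidalCategory.tensorHom_def]; monoidal
      _ = _ := by rw [← whisker_exchange, trAct]; monoidal

theorem trCo_isCoact (X : C) : IsCoact (trCo X : X ⟶ N ⊗ X) where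
  counit := by
    rw [trCo, Category.assoc, ← comp_whiskerRight, BimonObj.one_counit]; simp
  comul := by
    calc _ = (λ_ X).inv ≫ (η[N] ≫ Δ[N]) ▷ X := by rw [trCo, comp_whiskerRight, Category.assoc]
      _ = 𝟙 _ ⊗≫ (η[N] ▷ (𝟙_ C) ≫ N ◁ η[N]) ▷ X := by
        rw [Bimon.one_comul, MonoidalCategory.tensorHom_def]; monoidal
      _ = _ := by rw [trCo]; monoidal

theorem tAct_trAct_right {X : C} (a : N ⊗ X ⟶ X) (Y : C) : tAct a (trAct Y) = actL a Y := by
  calc _ = 𝟙 _ ⊗≫ Δ[N] ▷ (X ⊗ Y) ⊗≫ N ◁ (β_ N X).hom ▷ Y ⊗≫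
        (a ▷ (N ⊗ Y) ≫ X ◁ ε[N] ▷ Y) ⊗≫ 𝟙 _ := by
        simp only [tAct, tensorμ, trAct, MonoidalCategory.tensorHom_def]; monoidal
    _ = 𝟙 _ ⊗≫ Δ[N] ▷ (X ⊗ Y) ⊗≫ N ◁ ((β_ N X).hom ≫ X ◁ ε[N]) ▷ Y ⊗≫ a ▷ Y := by
        rw [← whisker_exchange]; monoidal
    _ = 𝟙 _ ⊗≫ (Δ[N] ≫ N ◁ ε[N]) ▷ (X ⊗ Y) ⊗≫ a ▷ Y := by
        rw [← BraidedCategory.braiding_naturality_left, braiding_tensorUnit_left]; monoidal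
    _ = _ := by rw [ComonObj.comul_counit, actL]; monoidal

theorem tAct_trAct_left (X : C) {Y : C} (b : N ⊗ Y ⟶ Y) : tAct (trAct X) b = actR X b := by
  calc _ = 𝟙 _ ⊗≫ (Δ[N] ▷ (X ⊗ Y)) ⊗≫ (N ◁ (β_ N X).hom ▷ Y ≫
        ε[N] ▷ ((X ⊗ N) ⊗ Y)) ⊗≫ X ◁ b := by
        simp only [tAct, tensorμ, trAct, MonoidalCategory.tensorHom_def]; monoidal
    _ = 𝟙 _ ⊗≫ (Δ[N] ≫ ε[N] ▷ N) ▷ (X ⊗ Y) ⊗≫ (β_ N X).hom ▷ Y ⊗≫ X ◁ b := by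
        rw [whisker_exchange]; monoidal
    _ = _ := by rw [ComonObj.counit_comul, actR]; monoidal

theorem tCo_trCo_right {X : C} (d : X ⟶ N ⊗ X) (Y : C) :
    tCo d (trCo Y) = d ▷ Y ≫ (α_ N X Y).hom := by
  calc _ = 𝟙 _ ⊗≫ d ▷ Y ⊗≫ N ◁ (X ◁ η[N] ≫ (β_ X N).hom) ▷ Y ⊗≫ μ[N] ▷ X ▷ Y ⊗≫ 𝟙 _ := by
        simp only [tCo, tensorμ, trCo, MonoidalCategory.tensorHom_def]; monoidal
    _ = 𝟙 _ ⊗≫ d ▷ Y ⊗≫ (N ◁ η[N] ≫ μ[N]) ▷ X ▷ Y ⊗≫ 𝟙 _ := by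
        rw [BraidedCategory.braiding_naturality_right, braiding_tensorUnit_right]; monoidal
    _ = _ := by rw [MonObj.mul_one]; monoidal

theorem tCo_trCo_left (X : C) {Y : C} (e : Y ⟶ N ⊗ Y) :
    tCo (trCo X) e = X ◁ e ≫ (α_ X N Y).inv ≫ (β_ X N).hom ▷ Y ≫ (α_ N X Y).hom := by
  calc _ = 𝟙 _ ⊗≫ X ◁ e ⊗≫ (η[N] ▷ (X ⊗ N ⊗ Y) ≫ N ◁ (𝟙 (X ⊗ N ⊗ Y) ⊗≫
        (β_ X N).hom ▷ Y ⊗≫ 𝟙 (N ⊗ X ⊗ Y))) ⊗≫ μ[N] ▷ X ▷ Y ⊗≫ 𝟙 (N ⊗ X ⊗ Y) := by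
        simp only [tCo, tensorμ, trCo, MonoidalCategory.tensorHom_def']; monoidal
    _ = 𝟙 _ ⊗≫ X ◁ e ⊗≫ (β_ X N).hom ▷ Y ⊗≫ (η[N] ▷ N ≫ μ[N]) ▷ X ▷ Y ⊗≫ 𝟙 _ := by
        rw [← whisker_exchange]; monoidal
    _ = _ := by rw [MonObj.one_mul]; monoidal

theorem lam_lin {X : C} (a : N ⊗ X ⟶ X) :
    tAct (trAct (𝟙_ C)) a ≫ (λ_ X).hom = N ◁ (λ_ X).hom ≫ a := by
  rw [tAct_trAct_left, actR, braiding_tensorUnit_right]; monoidal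

theorem rho_lin {X : C} (a : N ⊗ X ⟶ X) :
    tAct a (trAct (𝟙_ C)) ≫ (ρ_ X).hom = N ◁ (ρ_ X).hom ≫ a := by
  rw [tAct_trAct_right, actL]; monoidal

theorem lam_colin {X : C} (d : X ⟶ N ⊗ X) :
    tCo (trCo (𝟙_ C)) d ≫ N ◁ (λ_ X).hom = (λ_ X).hom ≫ d := by
  rw [tCo_trCo_left, braiding_tensorUnit_left]; monoidal

theorem rho_colin {X : C} (d : X ⟶ N ⊗ X) :
    tCo d (trCo (𝟙_ C)) ≫ N ◁ (ρ_ X).hom = (ρ_ X).hom ≫ d := by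
  rw [tCo_trCo_right]; monoidal

theorem half_natL {X X' Y : C} {d : X ⟶ N ⊗ X} {d' : X' ⟶ N ⊗ X'} (b : N ⊗ Y ⟶ Y) (f : X ⟶ X')
    (hf : d ≫ N ◁ f = f ≫ d') : half d b ≫ Y ◁ f = f ▷ Y ≫ half d' b := by
  symm
  calc _ = (f ≫ d') ▷ Y ≫ (α_ N X' Y).hom ≫ N ◁ (β_ X' Y).hom ≫ (α_ N Y X').inv ≫ b ▷ X' := by
        simp only [half, comp_whiskerRight, Category.assoc]
    _ = 𝟙 _ ⊗≫ d ▷ Y ⊗≫ N ◁ (f ▷ Y ≫ (β_ X' Y).hom) ⊗≫ b ▷ X' := by rw [← hf]; monoidal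
    _ = 𝟙 _ ⊗≫ d ▷ Y ⊗≫ N ◁ (β_ X Y).hom ⊗≫ ((N ⊗ Y) ◁ f ≫ b ▷ X') := by
        rw [BraidedCategory.braiding_naturality_left]; monoidal
    _ = _ := by rw [whisker_exchange, half]; monoidal

theorem half_natR {X Y Y' : C} (d : X ⟶ N ⊗ X) {b : N ⊗ Y ⟶ Y} {b' : N ⊗ Y' ⟶ Y'} (g : Y ⟶ Y')
    (hg : b ≫ g = N ◁ g ≫ b') : half d b ≫ g ▷ X = X ◁ g ≫ half d b' := by
  calc _ = 𝟙 _ ⊗≫ d ▷ Y ⊗≫ N ◁ (β_ X Y).hom ⊗≫ (b ≫ g) ▷ X := by rw [half]; monoidal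
    _ = 𝟙 _ ⊗≫ d ▷ Y ⊗≫ N ◁ ((β_ X Y).hom ≫ g ▷ X) ⊗≫ b' ▷ X := by rw [hg]; monoidal
    _ = 𝟙 _ ⊗≫ (d ▷ Y ≫ (N ⊗ X) ◁ g) ⊗≫ N ◁ (β_ X Y').hom ⊗≫ b' ▷ X := by
        rw [← BraidedCategory.braiding_naturality_right]; monoidal
    _ = _ := by rw [← whisker_exchange, half]; monoidal

theorem half_tAct {X Y Z : C} {d : X ⟶ N ⊗ X} (hd : IsCoact d) (b : N ⊗ Y ⟶ Y) (c : N ⊗ Z ⟶ Z) :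
    half d (tAct b c) = (α_ X Y Z).inv ≫ half d b ▷ Z ≫ (α_ Y X Z).hom ≫ Y ◁ half d c ≫
      (α_ Y Z X).inv := by
  calc _ = 𝟙 _ ⊗≫ d ▷ (Y ⊗ Z) ⊗≫ (N ◁ (β_ X (Y ⊗ Z)).hom ≫ Δ[N] ▷ ((Y ⊗ Z) ⊗ X)) ⊗≫
        N ◁ (β_ N Y).hom ▷ Z ▷ X ⊗≫ b ▷ (N ⊗ Z) ▷ X ⊗≫ Y ◁ c ▷ X ⊗≫ 𝟙 _ := by
        simp only [half, tAct, tensorμ, MonoidalCategory.tensorHom_def]; monoidal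
    _ = 𝟙 _ ⊗≫ (d ≫ Δ[N] ▷ X) ▷ (Y ⊗ Z) ⊗≫ N ◁ N ◁ (β_ X Y).hom ▷ Z ⊗≫
        N ◁ (N ◁ (Y ◁ (β_ X Z).hom) ⊗≫ (β_ N Y).hom ▷ (Z ⊗ X)) ⊗≫ b ▷ (N ⊗ Z) ▷ X ⊗≫
          Y ◁ c ▷ X ⊗≫ 𝟙 _ := by
        rw [whisker_exchange, BraidedCategory.braiding_tensor_right_hom]; monoidal
    _ = 𝟙 _ ⊗≫ d ▷ (Y ⊗ Z) ⊗≫ N ◁ d ▷ (Y ⊗ Z) ⊗≫ N ◁ N ◁ (β_ X Y).hom ▷ Z ⊗≫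
        N ◁ ((N ⊗ Y) ◁ (β_ X Z).hom ≫ (β_ N Y).hom ▷ (Z ⊗ X)) ⊗≫ b ▷ (N ⊗ Z) ▷ X ⊗≫
          Y ◁ c ▷ X ⊗≫ 𝟙 _ := by
        rw [hd.comul]; monoidal
    _ = 𝟙 _ ⊗≫ d ▷ (Y ⊗ Z) ⊗≫ N ◁ (d ▷ Y ⊗≫ N ◁ (β_ X Y).hom ⊗≫ (β_ N Y).hom ▷ X) ▷ Z ⊗≫
        ((N ⊗ Y) ◁ (N ◁ (β_ X Z).hom) ≫ b ▷ (N ⊗ (Z ⊗ X))) ⊗≫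
          Y ◁ c ▷ X ⊗≫ 𝟙 _ := by
        rw [whisker_exchange]; monoidal
    _ = 𝟙 _ ⊗≫ d ▷ (Y ⊗ Z) ⊗≫ N ◁ (d ▷ Y ≫ (β_ (N ⊗ X) Y).hom) ▷ Z ⊗≫
        b ▷ (N ⊗ (X ⊗ Z)) ⊗≫ Y ◁ N ◁ (β_ X Z).hom ⊗≫ Y ◁ c ▷ X ⊗≫ 𝟙 _ := by
        rw [whisker_exchange, BraidedCategory.braiding_tensor_left_hom]; monoidal
    _ = 𝟙 _ ⊗≫ d ▷ (Y ⊗ Z) ⊗≫ N ◁ (β_ X Y).hom ▷ Z ⊗≫ ((N ⊗ Y) ◁ (d ▷ Z) ≫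
        b ▷ ((N ⊗ X) ⊗ Z)) ⊗≫ Y ◁ N ◁ (β_ X Z).hom ⊗≫ Y ◁ c ▷ X ⊗≫ 𝟙 _ := by
        rw [BraidedCategory.braiding_naturality_left]; monoidal
    _ = _ := by
        rw [whisker_exchange]; simp only [half]; monoidal

theorem half_tCo {X Y Z : C} (d : X ⟶ N ⊗ X) (e : Y ⟶ N ⊗ Y) {c : N ⊗ Z ⟶ Z} (hc : IsAct c) :
    half (tCo d e) c = (α_ X Y Z).hom ≫ X ◁ half e c ≫ (α_ X Z Y).inv ≫ half d c ▷ Y ≫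
      (α_ Z X Y).hom := by
  calc _ = 𝟙 _ ⊗≫ (d ▷ Y ≫ (N ⊗ X) ◁ e) ▷ Z ⊗≫ N ◁ (β_ X N).hom ▷ Y ▷ Z ⊗≫
        (μ[N] ▷ ((X ⊗ Y) ⊗ Z) ≫ N ◁ (β_ (X ⊗ Y) Z).hom) ⊗≫ c ▷ (X ⊗ Y) := by
        simp only [half, tCo, tensorμ, MonoidalCategory.tensorHom_def]; monoidal
    _ = 𝟙 _ ⊗≫ X ◁ e ▷ Z ⊗≫ d ▷ (N ⊗ Y ⊗ Z) ⊗≫ N ◁ ((β_ X N).hom ▷ (Y ⊗ Z) ≫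
        (N ⊗ X) ◁ (β_ Y Z).hom) ⊗≫ N ◁ N ◁ (β_ X Z).hom ▷ Y ⊗≫ (μ[N] ▷ Z ≫ c) ▷ X ▷ Y ⊗≫
          𝟙 _ := by
        rw [← whisker_exchange, ← whisker_exchange, BraidedCategory.braiding_tensor_left_hom]
        monoidal
    _ = 𝟙 _ ⊗≫ X ◁ e ▷ Z ⊗≫ (d ▷ (N ⊗ Y ⊗ Z) ≫ (N ⊗ X) ◁ N ◁ (β_ Y Z).hom) ⊗≫
        N ◁ ((β_ X N).hom ▷ Z ⊗≫ N ◁ (β_ X Z).hom ⊗≫ c ▷ X) ▷ Y ⊗≫ c ▷ X ▷ Y ⊗≫ 𝟙 _ := by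
        rw [hc.mul, ← whisker_exchange]; monoidal
    _ = 𝟙 _ ⊗≫ X ◁ e ▷ Z ⊗≫ X ◁ N ◁ (β_ Y Z).hom ⊗≫ d ▷ (N ⊗ Z ⊗ Y) ⊗≫
        N ◁ ((β_ X (N ⊗ Z)).hom ≫ c ▷ X) ▷ Y ⊗≫ c ▷ X ▷ Y ⊗≫ 𝟙 _ := by
        rw [← whisker_exchange, BraidedCategory.braiding_tensor_right_hom]; monoidal
    _ = 𝟙 _ ⊗≫ X ◁ e ▷ Z ⊗≫ X ◁ N ◁ (β_ Y Z).hom ⊗≫ (d ▷ (N ⊗ Z) ≫ (N ⊗ X) ◁ c) ▷ Y ⊗≫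
        N ◁ (β_ X Z).hom ▷ Y ⊗≫ c ▷ X ▷ Y ⊗≫ 𝟙 _ := by
        rw [← BraidedCategory.braiding_naturality_right]; monoidal
    _ = _ := by
        rw [← whisker_exchange]; simp only [half]; monoidal

/-- The compatibility condition of a Yetter-Drinfeld module between action and coaction. -/
def Compat {X : C} (a : N ⊗ X ⟶ X) (d : X ⟶ N ⊗ X) : Prop :=
  (Δ[N] ⊗ₘ d) ≫ tensorμ N N N X ≫ (μ[N] ⊗ₘ a) =
    Δ[N] ▷ X ≫ (α_ N N X).hom ≫ N ◁ (β_ N X).hom ≫ (α_ N X N).inv ≫ a ▷ N ≫ d ▷ N ≫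
      (α_ N X N).hom ≫ N ◁ (β_ X N).hom ≫ (α_ N N X).inv ≫ μ[N] ▷ X

theorem half_lin₁ {X Y : C} (a : N ⊗ X ⟶ X) (d : X ⟶ N ⊗ X) {b : N ⊗ Y ⟶ Y} (hb : IsAct b) :
    N ◁ half d b ≫ tAct b a = (α_ N X Y).inv ≫
      ((Δ[N] ⊗ₘ d) ≫ tensorμ N N N X ≫ (μ[N] ⊗ₘ a)) ▷ Y ≫ (α_ N X Y).hom ≫ N ◁ (β_ X Y).hom ≫
        (α_ N Y X).inv ≫ b ▷ X := by
  symm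
  calc _ = 𝟙 _ ⊗≫ N ◁ d ▷ Y ⊗≫ (Δ[N] ▷ N ⊗≫ N ◁ (β_ N N).hom ⊗≫ μ[N] ▷ N) ▷ (X ⊗ Y) ⊗≫
        N ◁ (a ▷ Y ≫ (β_ X Y).hom) ⊗≫ b ▷ X := by
        rw [MonoidalCategory.tensorHom_def', MonoidalCategory.tensorHom_def μ[N], tensorμ]; monoidal
    _ = 𝟙 _ ⊗≫ N ◁ d ▷ Y ⊗≫ ((Δ[N] ▷ N ⊗≫ N ◁ (β_ N N).hom ⊗≫ μ[N] ▷ N) ▷ (X ⊗ Y) ≫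
        (N ⊗ N) ◁ (β_ X Y).hom) ⊗≫ N ◁ (β_ N Y).hom ▷ X ⊗≫ ((N ⊗ Y) ◁ a ≫ b ▷ X) := by
        rw [BraidedCategory.braiding_naturality_left, BraidedCategory.braiding_tensor_left_hom]
        monoidal
    _ = 𝟙 _ ⊗≫ N ◁ (d ▷ Y ⊗≫ N ◁ (β_ X Y).hom) ⊗≫ (Δ[N] ▷ N ⊗≫ N ◁ (β_ N N).hom) ▷ Y ▷ X ⊗≫
        (μ[N] ▷ (N ⊗ Y) ≫ N ◁ (β_ N Y).hom) ▷ X ⊗≫ b ▷ N ▷ X ⊗≫ Y ◁ a := by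
        rw [← whisker_exchange, whisker_exchange b a]; monoidal
    _ = 𝟙 _ ⊗≫ N ◁ (d ▷ Y ⊗≫ N ◁ (β_ X Y).hom) ⊗≫ (Δ[N] ▷ N ⊗≫ N ◁ (β_ N N).hom) ▷ Y ▷ X ⊗≫
        N ◁ N ◁ (β_ N Y).hom ▷ X ⊗≫ (μ[N] ▷ Y ≫ b) ▷ N ▷ X ⊗≫ Y ◁ a := by
        rw [← whisker_exchange]; monoidal
    _ = 𝟙 _ ⊗≫ N ◁ (d ▷ Y ⊗≫ N ◁ (β_ X Y).hom) ⊗≫ Δ[N] ▷ N ▷ Y ▷ X ⊗≫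
        N ◁ ((β_ N (N ⊗ Y)).hom ≫ b ▷ N) ▷ X ⊗≫ b ▷ N ▷ X ⊗≫ Y ◁ a := by
        rw [hb.mul, BraidedCategory.braiding_tensor_right_hom]; monoidal
    _ = 𝟙 _ ⊗≫ N ◁ (d ▷ Y ⊗≫ N ◁ (β_ X Y).hom) ⊗≫ (Δ[N] ▷ (N ⊗ Y) ≫ (N ⊗ N) ◁ b) ▷ X ⊗≫
        N ◁ (β_ N Y).hom ▷ X ⊗≫ b ▷ N ▷ X ⊗≫ Y ◁ a := by
        rw [← BraidedCategory.braiding_naturality_right]; monoidal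
    _ = _ := by
        rw [← whisker_exchange]
        simp only [half, tAct, tensorμ, MonoidalCategory.tensorHom_def]; monoidal

theorem half_lin₂ {X Y : C} (a : N ⊗ X ⟶ X) (d : X ⟶ N ⊗ X) {b : N ⊗ Y ⟶ Y} (hb : IsAct b) :
    tAct a b ≫ half d b = (α_ N X Y).inv ≫
      (Δ[N] ▷ X ≫ (α_ N N X).hom ≫ N ◁ (β_ N X).hom ≫ (α_ N X N).inv ≫ a ▷ N ≫ d ▷ N ≫
      (α_ N X N).hom ≫ N ◁ (β_ X N).hom ≫ (α_ N N X).inv ≫ μ[N] ▷ X) ▷ Y ≫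
        (α_ N X Y).hom ≫ N ◁ (β_ X Y).hom ≫ (α_ N Y X).inv ≫ b ▷ X := by
  calc _ = 𝟙 _ ⊗≫ (Δ[N] ▷ X ⊗≫ N ◁ (β_ N X).hom ⊗≫ a ▷ N) ▷ Y ⊗≫
        (X ◁ b ≫ d ▷ Y) ⊗≫ N ◁ (β_ X Y).hom ⊗≫ b ▷ X := by
        simp only [half, tAct, tensorμ, MonoidalCategory.tensorHom_def]; monoidal
    _ = 𝟙 _ ⊗≫ (Δ[N] ▷ X ⊗≫ N ◁ (β_ N X).hom ⊗≫ a ▷ N ⊗≫ d ▷ N) ▷ Y ⊗≫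
        N ◁ (X ◁ b ≫ (β_ X Y).hom) ⊗≫ b ▷ X := by
        rw [whisker_exchange]; monoidal
    _ = 𝟙 _ ⊗≫ (Δ[N] ▷ X ⊗≫ N ◁ (β_ N X).hom ⊗≫ a ▷ N ⊗≫ d ▷ N ⊗≫ N ◁ (β_ X N).hom) ▷ Y ⊗≫
        N ◁ N ◁ (β_ X Y).hom ⊗≫ ((α_ N N Y).hom ≫ N ◁ b ≫ b) ▷ X := by
        rw [BraidedCategory.braiding_naturality_right, BraidedCategory.braiding_tensor_right_hom]
        monoidal
    _ = 𝟙 _ ⊗≫ (Δ[N] ▷ X ⊗≫ N ◁ (β_ N X).hom ⊗≫ a ▷ N ⊗≫ d ▷ N ⊗≫ N ◁ (β_ X N).hom) ▷ Y ⊗≫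
        ((N ⊗ N) ◁ (β_ X Y).hom ≫ μ[N] ▷ (Y ⊗ X)) ⊗≫ b ▷ X := by
        rw [← hb.mul]; monoidal
    _ = _ := by rw [whisker_exchange]; monoidal

/-- The half-braiding with a module is linear. -/
theorem Compat.half_lin {X Y : C} {a : N ⊗ X ⟶ X} {d : X ⟶ N ⊗ X} (h : Compat a d)
    {b : N ⊗ Y ⟶ Y} (hb : IsAct b) : tAct a b ≫ half d b = N ◁ half d b ≫ tAct b a := by
  rw [half_lin₁ a d hb, half_lin₂ a d hb, h]

theorem mul_isAct : IsAct μ[N] where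
  one := MonObj.one_mul N
  mul := MonObj.mul_assoc N

theorem coact_of_half {X : C} (d : X ⟶ N ⊗ X) :
    d = (ρ_ X).inv ≫ X ◁ η[N] ≫ half d μ[N] := by
  symm
  calc _ = 𝟙 _ ⊗≫ (X ◁ η[N] ≫ d ▷ N) ⊗≫ N ◁ (β_ X N).hom ⊗≫ μ[N] ▷ X := by
        rw [half]; monoidal
    _ = 𝟙 _ ⊗≫ d ⊗≫ N ◁ (X ◁ η[N] ≫ (β_ X N).hom) ⊗≫ μ[N] ▷ X := by
        rw [whisker_exchange]; monoidal
    _ = 𝟙 _ ⊗≫ d ⊗≫ (N ◁ η[N] ≫ μ[N]) ▷ X := by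
        rw [BraidedCategory.braiding_naturality_right, braiding_tensorUnit_right]; monoidal
    _ = _ := by rw [MonObj.mul_one]; monoidal

theorem compat_of_half {X : C} {a : N ⊗ X ⟶ X} {d : X ⟶ N ⊗ X}
    (h : tAct a μ[N] ≫ half d μ[N] = N ◁ half d μ[N] ≫ tAct μ[N] a) : Compat a d := by
  rw [half_lin₁ a d mul_isAct, half_lin₂ a d mul_isAct] at h
  have key : ∀ K : N ⊗ X ⟶ N ⊗ X, N ◁ ((ρ_ X).inv ≫ X ◁ η[N]) ≫ (α_ N X N).inv ≫ K ▷ N ≫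
      (α_ N X N).hom ≫ N ◁ (β_ X N).hom ≫ (α_ N N X).inv ≫ μ[N] ▷ X = K := by
    intro K
    calc _ = 𝟙 _ ⊗≫ ((N ⊗ X) ◁ η[N] ≫ K ▷ N) ⊗≫ N ◁ (β_ X N).hom ⊗≫ μ[N] ▷ X := by monoidal
      _ = 𝟙 _ ⊗≫ K ⊗≫ N ◁ (X ◁ η[N] ≫ (β_ X N).hom) ⊗≫ μ[N] ▷ X := by
          rw [whisker_exchange]; monoidal
      _ = 𝟙 _ ⊗≫ K ⊗≫ (N ◁ η[N] ≫ μ[N]) ▷ X := by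
          rw [BraidedCategory.braiding_naturality_right, braiding_tensorUnit_right]; monoidal
      _ = _ := by rw [MonObj.mul_one]; monoidal
  have h' := congrArg (N ◁ ((ρ_ X).inv ≫ X ◁ η[N]) ≫ ·) h
  simp only [key] at h'
  exact h'.symm

theorem compat_tensor {X Y : C} {a : N ⊗ X ⟶ X} {d : X ⟶ N ⊗ X} (h : Compat a d)
    {b : N ⊗ Y ⟶ Y} {e : Y ⟶ N ⊗ Y} (h' : Compat b e) : Compat (tAct a b) (tCo d e) := by
  apply compat_of_half
  have h1 := h.half_lin mul_isAct
  have h2 := h'.half_lin mul_isAct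
  have e1 := tAct_nat (a := a) (a' := a) (𝟙 X) (half e μ[N]) (by simp) h2
  have e2 := tAct_nat (b := b) (b' := b) (half d μ[N]) (𝟙 Y) h1 (by simp)
  rw [MonoidalCategory.id_tensorHom] at e1
  rw [MonoidalCategory.tensorHom_id] at e2
  have e3 : tAct a (tAct μ[N] b) ≫ (α_ X N Y).inv = N ◁ (α_ X N Y).inv ≫ tAct (tAct a μ[N]) b := by
    rw [Iso.comp_inv_eq, Category.assoc, tAct_assoc, ← whiskerLeft_comp_assoc]; simp
  rw [half_tCo d e mul_isAct, reassoc_of% (tAct_assoc a b μ[N]), reassoc_of% e1, reassoc_of% e3,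
    reassoc_of% e2, tAct_assoc]
  simp only [whiskerLeft_comp, Category.assoc]

/-- The half-braiding of Yetter-Drinfeld modules is colinear. -/
theorem half_colin {X Y : C} {d : X ⟶ N ⊗ X} (hd : IsCoact d)
    {b : N ⊗ Y ⟶ Y} {e : Y ⟶ N ⊗ Y} (h' : Compat b e) :
    tCo d e ≫ N ◁ half d b = half d b ≫ tCo e d := by
  have h1 := half_natR d (half e μ[N]) (h'.half_lin mul_isAct)
  rw [half_tAct hd, half_tAct hd] at h1
  have h2 : half (tCo d e) μ[N] ≫ N ◁ half d b = half d b ▷ N ≫ half (tCo e d) μ[N] := by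
    rw [half_tCo d e mul_isAct, half_tCo e d mul_isAct]
    have h3 := (α_ X Y N).hom ≫= h1 =≫ (α_ N Y X).hom
    simp only [Category.assoc, Iso.hom_inv_id_assoc, Iso.inv_hom_id, Category.comp_id] at h3 ⊢
    exact h3.symm
  rw [coact_of_half (tCo d e), coact_of_half (tCo e d), Category.assoc, Category.assoc, h2]
  rw [whisker_exchange_assoc, rightUnitor_inv_naturality_assoc]

end YDAux

section HalfInv

variable {C : Type u} [Category.{v} C] [MonoidalCategory C] [BraidedCategory C]
  {N : C} [HopfObj N]

/-- The morphism `y ⊗ x ↦ f(x₍₋₁₎) y ⊗ x₍₀₎`, with the inverse braiding. -/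
def tw {X Y : C} (d : X ⟶ N ⊗ X) (b : N ⊗ Y ⟶ Y) (f : N ⟶ N) : Y ⊗ X ⟶ Y ⊗ X :=
  Y ◁ (d ≫ f ▷ X) ≫ (α_ Y N X).inv ≫ ((β_ N Y).inv ≫ b) ▷ X

theorem half_eq_tw {X Y : C} (d : X ⟶ N ⊗ X) (b : N ⊗ Y ⟶ Y) :
    half d b = (β_ X Y).hom ≫ tw d b (𝟙 N) := by
  symm
  calc _ = 𝟙 _ ⊗≫ ((β_ X Y).hom ≫ Y ◁ d) ⊗≫ ((β_ N Y).inv ≫ b) ▷ X := by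
        rw [tw, id_whiskerRight]; monoidal
    _ = 𝟙 _ ⊗≫ d ▷ Y ⊗≫ N ◁ (β_ X Y).hom ⊗≫ ((β_ N Y).hom ≫ (β_ N Y).inv) ▷ X ⊗≫ b ▷ X := by
        rw [← BraidedCategory.braiding_naturality_left, BraidedCategory.braiding_tensor_left_hom]
        monoidal
    _ = _ := by rw [Iso.hom_inv_id, half]; monoidal

theorem tw_comp {X Y : C} {d : X ⟶ N ⊗ X} (hd : IsCoact d) {b : N ⊗ Y ⟶ Y} (hb : IsAct b)
    (f g : N ⟶ N) : tw d b f ≫ tw d b g =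
      tw d b (Δ[N] ≫ (f ⊗ₘ g) ≫ (β_ N N).inv ≫ μ[N]) := by
  have hr : ((β_ N Y).inv ≫ b) ▷ N ≫ (β_ N Y).inv ≫ b =
      (α_ Y N N).hom ≫ Y ◁ ((β_ N N).inv ≫ μ[N]) ≫ (β_ N Y).inv ≫ b := by
    calc _ = 𝟙 _ ⊗≫ (β_ N Y).inv ▷ N ⊗≫ (b ▷ N ≫ (β_ N Y).inv) ⊗≫ b := by monoidal
      _ = 𝟙 _ ⊗≫ (β_ N Y).inv ▷ N ⊗≫ N ◁ (β_ N Y).inv ⊗≫ (β_ N N).inv ▷ Y ⊗≫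
            ((α_ N N Y).hom ≫ N ◁ b ≫ b) := by
          rw [BraidedCategory.braiding_inv_naturality_left,
            BraidedCategory.braiding_tensor_right_inv]; monoidal
      _ = 𝟙 _ ⊗≫ ((β_ (N ⊗ N) Y).inv ≫ (β_ N N).inv ▷ Y) ⊗≫ (μ[N] ▷ Y ≫ b) := by
          rw [← hb.mul, BraidedCategory.braiding_tensor_left_inv]; monoidal
      _ = 𝟙 _ ⊗≫ Y ◁ (β_ N N).inv ⊗≫ ((β_ (N ⊗ N) Y).inv ≫ μ[N] ▷ Y) ⊗≫ b := by
          rw [← BraidedCategory.braiding_inv_naturality_right]; monoidal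
      _ = _ := by rw [← BraidedCategory.braiding_inv_naturality_right]; monoidal
  calc _ = 𝟙 _ ⊗≫ Y ◁ (d ≫ f ▷ X) ⊗≫ (((β_ N Y).inv ≫ b) ▷ X ≫ Y ◁ (d ≫ g ▷ X)) ⊗≫
        ((β_ N Y).inv ≫ b) ▷ X := by simp only [tw]; monoidal
    _ = 𝟙 _ ⊗≫ Y ◁ d ⊗≫ Y ◁ (f ▷ X ≫ N ◁ d) ⊗≫ Y ◁ N ◁ g ▷ X ⊗≫
        (((β_ N Y).inv ≫ b) ▷ N ≫ (β_ N Y).inv ≫ b) ▷ X := by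
        rw [← whisker_exchange]; monoidal
    _ = 𝟙 _ ⊗≫ Y ◁ (d ≫ N ◁ d ≫ (α_ N N X).inv) ⊗≫ Y ◁ f ▷ N ▷ X ⊗≫ Y ◁ N ◁ g ▷ X ⊗≫
        (((β_ N Y).inv ≫ b) ▷ N ≫ (β_ N Y).inv ≫ b) ▷ X := by
        rw [← whisker_exchange]; monoidal
    _ = _ := by
        rw [← hd.comul, hr, tw, MonoidalCategory.tensorHom_def]; monoidal

theorem tw_one {X Y : C} {d : X ⟶ N ⊗ X} (hd : IsCoact d) {b : N ⊗ Y ⟶ Y} (hb : IsAct b) :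
    tw d b (ε[N] ≫ η[N]) = 𝟙 _ := by
  calc _ = 𝟙 _ ⊗≫ Y ◁ (d ≫ ε[N] ▷ X) ⊗≫ (Y ◁ η[N] ≫ (β_ N Y).inv) ▷ X ⊗≫ b ▷ X := by
        rw [tw]; monoidal
    _ = 𝟙 _ ⊗≫ (η[N] ▷ Y ≫ b) ▷ X := by
        rw [hd.counit, BraidedCategory.braiding_inv_naturality_right, braiding_inv_tensorUnit_left]
        monoidal
    _ = _ := by rw [hb.one]; monoidal

variable [IsIso 𝒮[N]]

theorem inv_antipode_aux (f g : N ⟶ N) : (f ⊗ₘ g) ≫ (β_ N N).inv ≫ μ[N] ≫ 𝒮[N] =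
    ((f ≫ 𝒮[N]) ⊗ₘ (g ≫ 𝒮[N])) ≫ μ[N] := by
  rw [HopfObj.mul_antipode, ← BraidedCategory.braiding_inv_naturality_assoc, Iso.inv_hom_id_assoc,
    MonoidalCategory.tensorHom_comp_tensorHom_assoc]

theorem antipode_inv_right : Δ[N] ≫ (𝟙 N ⊗ₘ inv 𝒮[N]) ≫ (β_ N N).inv ≫ μ[N] = ε[N] ≫ η[N] := by
  rw [← cancel_mono 𝒮[N]]
  simp only [Category.assoc]
  rw [inv_antipode_aux, HopfObj.one_antipode]
  simp

theorem antipode_inv_left : Δ[N] ≫ (inv 𝒮[N] ⊗ₘ 𝟙 N) ≫ (β_ N N).inv ≫ μ[N] = ε[N] ≫ η[N] := by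
  rw [← cancel_mono 𝒮[N]]
  simp only [Category.assoc]
  rw [inv_antipode_aux, HopfObj.one_antipode]
  simp

/-- The braiding of Yetter-Drinfeld modules, on underlying objects. -/
def halfIso {X Y : C} {d : X ⟶ N ⊗ X} (hd : IsCoact d) {b : N ⊗ Y ⟶ Y} (hb : IsAct b) :
    X ⊗ Y ≅ Y ⊗ X where
  hom := half d b
  inv := tw d b (inv 𝒮[N]) ≫ (β_ X Y).inv
  hom_inv_id := by
    rw [half_eq_tw, Category.assoc, reassoc_of% (tw_comp hd hb), antipode_inv_right, tw_one hd hb]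
    simp
  inv_hom_id := by
    rw [half_eq_tw, Category.assoc, Iso.inv_hom_id_assoc, tw_comp hd hb, antipode_inv_left,
      tw_one hd hb]

end HalfInv

/-- A Yetter-Drinfeld module over a Hopf algebra `N` in a braided monoidal category: an object
with an action and a coaction of `N` that satisfy the Yetter-Drinfeld condition. -/
structure YD {C : Type u} [Category.{v} C] [MonoidalCategory C] [BraidedCategory C]
    (N : C) [HopfObj N] where
  /-- the underlying object -/
  X : C
  /-- the action -/
  a : N ⊗ X ⟶ X
  /-- the coaction -/
  d : X ⟶ N ⊗ X
  isAct : IsAct a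
  isCoact : IsCoact d
  compat : Compat a d

namespace YD

variable {C : Type u} [Category.{v} C] [MonoidalCategory C] [BraidedCategory C]
  {N : C} [HopfObj N]

/-- Morphisms of Yetter-Drinfeld modules are the linear and colinear morphisms. -/
@[ext]
structure Hom (V W : YD N) where
  /-- the underlying morphism -/
  hom : V.X ⟶ W.X
  lin : V.a ≫ hom = N ◁ hom ≫ W.a
  colin : V.d ≫ N ◁ hom = hom ≫ W.d

theorem Hom.lin_assoc : type_of% (reassoc_of% @Hom.lin) := @(reassoc_of% @Hom.lin)

theorem Hom.colin_assoc : type_of% (reassoc_of% @Hom.colin) := @(reassoc_of% @Hom.colin)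

instance : Category (YD N) where
  Hom V W := Hom V W
  id V := ⟨𝟙 V.X, by simp, by simp⟩
  comp f g := ⟨f.hom ≫ g.hom, by rw [f.lin_assoc, g.lin, whiskerLeft_comp, Category.assoc],
    by rw [whiskerLeft_comp, f.colin_assoc, g.colin, Category.assoc]⟩

@[simp] theorem id_hom (V : YD N) : Hom.hom (𝟙 V) = 𝟙 V.X := rfl

@[simp] theorem comp_hom {V W U : YD N} (f : V ⟶ W) (g : W ⟶ U) :
    (f ≫ g).hom = f.hom ≫ g.hom := rfl

@[ext] theorem hom_ext {V W : YD N} {f g : V ⟶ W} (h : f.hom = g.hom) : f = g :=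
  Hom.ext h

/-- The functor that forgets action and coaction. -/
@[simps] def forget (N : C) [HopfObj N] : YD N ⥤ C where
  obj V := V.X
  map f := f.hom

instance : (forget N).Faithful where
  map_injective h := hom_ext h

/-- An isomorphism of underlying objects that is linear and colinear. -/
@[simps] def isoMk {V W : YD N} (e : V.X ≅ W.X) (h₁ : V.a ≫ e.hom = N ◁ e.hom ≫ W.a)
    (h₂ : V.d ≫ N ◁ e.hom = e.hom ≫ W.d) : V ≅ W where
  hom := ⟨e.hom, h₁, h₂⟩
  inv := ⟨e.inv, by rw [Iso.comp_inv_eq, Category.assoc, h₁, ← whiskerLeft_comp_assoc]; simp,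
    by rw [← cancel_epi e.hom, ← reassoc_of% h₂, ← whiskerLeft_comp]; simp⟩
  hom_inv_id := by ext; exact e.hom_inv_id
  inv_hom_id := by ext; exact e.inv_hom_id

/-- The tensor product of Yetter-Drinfeld modules: the tensor product of the underlying objects
with the diagonal action and the codiagonal coaction. -/
@[simps] def tens (V W : YD N) : YD N where
  X := V.X ⊗ W.X
  a := tAct V.a W.a
  d := tCo V.d W.d
  isAct := tAct_isAct V.isAct W.isAct
  isCoact := tCo_isCoact V.isCoact W.isCoact
  compat := compat_tensor V.compat W.compat

/-- The tensor product of morphisms. -/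
@[simps] def tensMap {V V' W W' : YD N} (f : V ⟶ V') (g : W ⟶ W') : tens V W ⟶ tens V' W' where
  hom := f.hom ⊗ₘ g.hom
  lin := tAct_nat _ _ f.lin g.lin
  colin := tCo_nat _ _ f.colin g.colin

theorem compat_triv (X : C) (h : (β_ X N).hom ≫ (β_ N X).hom = 𝟙 (X ⊗ N)) :
    Compat (trAct X : N ⊗ X ⟶ X) (trCo X) := by
  apply compat_of_half
  have h1 : half (trCo X) μ[N] = (β_ X N).hom := by
    calc _ = 𝟙 _ ⊗≫ (η[N] ▷ (X ⊗ N) ≫ N ◁ (β_ X N).hom) ⊗≫ μ[N] ▷ X := by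
          rw [half, trCo]; monoidal
      _ = 𝟙 _ ⊗≫ (β_ X N).hom ⊗≫ (η[N] ▷ N ≫ μ[N]) ▷ X := by
          rw [← whisker_exchange]; monoidal
      _ = _ := by rw [MonObj.one_mul]; monoidal
  have h2 : (β_ N X).hom ≫ (β_ X N).hom = 𝟙 (N ⊗ X) := by
    rw [← cancel_epi (β_ X N).hom, reassoc_of% h, Category.comp_id]
  rw [h1, tAct_trAct_left, tAct_trAct_right, actR_braiding, twistL, h2]
  simp

/-- An object with trivial double braiding with `N`, equipped with the trivial action (through the
counit) and the trivial coaction (through the unit). -/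
@[simps] def triv (N : C) [HopfObj N] (X : C) (h : (β_ X N).hom ≫ (β_ N X).hom = 𝟙 (X ⊗ N)) :
    YD N where
  X := X
  a := trAct X
  d := trCo X
  isAct := trAct_isAct X
  isCoact := trCo_isCoact X
  compat := compat_triv X h

instance : MonoidalCategoryStruct (YD N) where
  tensorObj := tens
  whiskerLeft V _ _ f := tensMap (𝟙 V) f
  whiskerRight f W := tensMap f (𝟙 W)
  tensorHom := tensMap
  tensorUnit := triv N (𝟙_ C) (by simp)
  associator V W U := isoMk (α_ V.X W.X U.X) (tAct_assoc _ _ _) (tCo_assoc _ _ _)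
  leftUnitor V := isoMk (λ_ V.X) (lam_lin _) (lam_colin _)
  rightUnitor V := isoMk (ρ_ V.X) (rho_lin _) (rho_colin _)

@[simp] theorem tensor_X (V W : YD N) : (V ⊗ W).X = V.X ⊗ W.X := rfl

@[simp] theorem tensor_a (V W : YD N) : (V ⊗ W).a = tAct V.a W.a := rfl

@[simp] theorem tensor_d (V W : YD N) : (V ⊗ W).d = tCo V.d W.d := rfl

@[simp] theorem unit_X : (𝟙_ (YD N)).X = 𝟙_ C := rfl

@[simp] theorem unit_a : (𝟙_ (YD N)).a = trAct (𝟙_ C) := rfl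

@[simp] theorem unit_d : (𝟙_ (YD N)).d = trCo (𝟙_ C) := rfl

@[simp] theorem tensorHom_hom {V V' W W' : YD N} (f : V ⟶ V') (g : W ⟶ W') :
    (f ⊗ₘ g).hom = f.hom ⊗ₘ g.hom := rfl

@[simp] theorem whiskerLeft_hom (V : YD N) {W W' : YD N} (g : W ⟶ W') :
    (V ◁ g).hom = V.X ◁ g.hom := MonoidalCategory.id_tensorHom _ _

@[simp] theorem whiskerRight_hom {V V' : YD N} (f : V ⟶ V') (W : YD N) :
    (f ▷ W).hom = f.hom ▷ W.X := MonoidalCategory.tensorHom_id _ _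

@[simp] theorem associator_hom (V W U : YD N) : (α_ V W U).hom.hom = (α_ V.X W.X U.X).hom := rfl

@[simp] theorem associator_inv (V W U : YD N) : (α_ V W U).inv.hom = (α_ V.X W.X U.X).inv := rfl

@[simp] theorem leftUnitor_hom (V : YD N) : (λ_ V).hom.hom = (λ_ V.X).hom := rfl

@[simp] theorem leftUnitor_inv (V : YD N) : (λ_ V).inv.hom = (λ_ V.X).inv := rfl

@[simp] theorem rightUnitor_hom (V : YD N) : (ρ_ V).hom.hom = (ρ_ V.X).hom := rfl

@[simp] theorem rightUnitor_inv (V : YD N) : (ρ_ V).inv.hom = (ρ_ V.X).inv := rfl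

instance : MonoidalCategory (YD N) where
  tensorHom_def f g := by ext; simp [MonoidalCategory.tensorHom_def]
  id_tensorHom_id V W := by ext; simp
  tensorHom_comp_tensorHom f g f' g' := by ext; simp
  whiskerLeft_id V W := by ext; simp
  id_whiskerRight V W := by ext; simp
  associator_naturality f g h := by ext; simp
  leftUnitor_naturality f := by ext; simp
  rightUnitor_naturality f := by ext; simp
  triangle V W := by ext; simp
  pentagon V W U Z := by ext; simp

variable [IsIso 𝒮[N]]

/-- The braiding isomorphism of Yetter-Drinfeld modules. -/
def bIso (V W : YD N) : V ⊗ W ≅ W ⊗ V :=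
  isoMk (V := V ⊗ W) (W := W ⊗ V) (halfIso V.isCoact W.isAct) (V.compat.half_lin W.isAct)
    (half_colin V.isCoact W.compat)

@[simp] theorem bIso_hom_hom (V W : YD N) : (bIso V W).hom.hom = half V.d W.a := rfl

instance : BraidedCategory (YD N) where
  braiding := bIso
  braiding_naturality_right V W U f := by ext; simp [half_natR _ _ f.lin]
  braiding_naturality_left f W := by ext; simp [half_natL _ _ f.colin]
  hexagon_forward V W U := by ext; simp [half_tAct V.isCoact]
  hexagon_reverse V W U := by ext; simp [half_tCo V.d W.d U.isAct]

@[simp] theorem braiding_hom (V W : YD N) : (β_ V W).hom.hom = half V.d W.a := rfl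

end YD

namespace YD

section Coequalizers

variable {C : Type u} [Category.{v} C] [MonoidalCategory C] [BraidedCategory C]
  [HasCoequalizers C] [∀ X : C, PreservesColimitsOfShape WalkingParallelPair (tensorLeft X)]
  {N : C} [HopfObj N] {V W : YD N} (f g : V ⟶ W)

/-- The action on a coequalizer. -/
def coeqAct : N ⊗ coequalizer f.hom g.hom ⟶ coequalizer f.hom g.hom :=
  descLeft _ _ N (W.a ≫ coequalizer.π _ _) <| by
    rw [← f.lin_assoc, ← g.lin_assoc, coequalizer.condition]

theorem π_coeqAct : N ◁ coequalizer.π f.hom g.hom ≫ coeqAct f g =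
    W.a ≫ coequalizer.π f.hom g.hom := π_descLeft _ _ _ _ _

/-- The coaction on a coequalizer. -/
def coeqCo : coequalizer f.hom g.hom ⟶ N ⊗ coequalizer f.hom g.hom :=
  coequalizer.desc (W.d ≫ N ◁ coequalizer.π _ _) <| by
    rw [← f.colin_assoc, ← g.colin_assoc, ← whiskerLeft_comp, coequalizer.condition,
      whiskerLeft_comp]

theorem π_coeqCo : coequalizer.π f.hom g.hom ≫ coeqCo f g =
    W.d ≫ N ◁ coequalizer.π f.hom g.hom := coequalizer.π_desc _ _

theorem epi_wh (Z : C) : Epi (Z ◁ coequalizer.π f.hom g.hom) :=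
  ((regEpi_π f.hom g.hom).whiskerLeft Z).epi

/-- The coequalizer of two morphisms of Yetter-Drinfeld modules. -/
@[simps] def coeq : YD N where
  X := coequalizer f.hom g.hom
  a := coeqAct f g
  d := coeqCo f g
  isAct :=
    { one := by
        haveI := epi_wh f g (𝟙_ C)
        rw [← cancel_epi (𝟙_ C ◁ coequalizer.π f.hom g.hom), whisker_exchange_assoc, π_coeqAct,
          reassoc_of% W.isAct.one]
        simp
      mul := by
        haveI := epi_wh f g (N ⊗ N)
        rw [← cancel_epi ((N ⊗ N) ◁ coequalizer.π f.hom g.hom), whisker_exchange_assoc,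
          π_coeqAct, reassoc_of% W.isAct.mul, associator_naturality_right_assoc,
          ← whiskerLeft_comp_assoc, π_coeqAct, whiskerLeft_comp_assoc, π_coeqAct] }
  isCoact :=
    { counit := by
        rw [← cancel_epi (coequalizer.π f.hom g.hom), reassoc_of% π_coeqCo, whisker_exchange,
          reassoc_of% W.isCoact.counit]
        simp
      comul := by
        rw [← cancel_epi (coequalizer.π f.hom g.hom), reassoc_of% π_coeqCo, whisker_exchange,
          reassoc_of% W.isCoact.comul, reassoc_of% π_coeqCo, ← whiskerLeft_comp_assoc, π_coeqCo]
        simp }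
  compat := by
    have hp := (((regEpi_π f.hom g.hom).whiskerRight N).whiskerLeft N).epi
    apply compat_of_half
    have h1 := tAct_nat (b := μ[N]) (b' := μ[N]) (coequalizer.π f.hom g.hom) (𝟙 N)
      (π_coeqAct f g).symm (by simp)
    have h2 := tAct_nat (a := μ[N]) (a' := μ[N]) (𝟙 N) (coequalizer.π f.hom g.hom) (by simp)
      (π_coeqAct f g).symm
    have h3 := half_natL μ[N] _ (π_coeqCo f g).symm
    rw [MonoidalCategory.tensorHom_id] at h1
    rw [MonoidalCategory.id_tensorHom] at h2
    rw [← cancel_epi (N ◁ coequalizer.π f.hom g.hom ▷ N), ← reassoc_of% h1, ← h3,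
      reassoc_of% (W.compat.half_lin mul_isAct), h2, ← whiskerLeft_comp_assoc, h3,
      whiskerLeft_comp_assoc]

/-- The projection to the coequalizer. -/
@[simps] def coeqπ : W ⟶ coeq f g where
  hom := coequalizer.π f.hom g.hom
  lin := (π_coeqAct f g).symm
  colin := (π_coeqCo f g).symm

theorem coeqπ_condition : f ≫ coeqπ f g = g ≫ coeqπ f g := hom_ext (coequalizer.condition _ _)

theorem coeqDesc_lin {U : YD N} (k : W ⟶ U) (h : f.hom ≫ k.hom = g.hom ≫ k.hom) :
    coeqAct f g ≫ coequalizer.desc k.hom h = N ◁ coequalizer.desc k.hom h ≫ U.a := by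
  haveI := epi_wh f g N
  rw [← cancel_epi (N ◁ coequalizer.π f.hom g.hom), reassoc_of% π_coeqAct,
    coequalizer.π_desc, ← whiskerLeft_comp_assoc, coequalizer.π_desc, k.lin]

theorem coeqDesc_colin {U : YD N} (k : W ⟶ U) (h : f.hom ≫ k.hom = g.hom ≫ k.hom) :
    coeqCo f g ≫ N ◁ coequalizer.desc k.hom h = coequalizer.desc k.hom h ≫ U.d := by
  rw [← cancel_epi (coequalizer.π f.hom g.hom), reassoc_of% π_coeqCo,
    coequalizer.π_desc_assoc, ← whiskerLeft_comp, coequalizer.π_desc, k.colin]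

/-- Morphisms out of the coequalizer. -/
@[simps] def coeqDesc {U : YD N} (k : W ⟶ U) (h : f ≫ k = g ≫ k) : coeq f g ⟶ U where
  hom := coequalizer.desc k.hom (congrArg Hom.hom h)
  lin := coeqDesc_lin f g k (congrArg Hom.hom h)
  colin := coeqDesc_colin f g k (congrArg Hom.hom h)

/-- The universal property of the coequalizer. -/
def coeqIsColimit : IsColimit (Cofork.ofπ (coeqπ f g) (coeqπ_condition f g)) :=
  Cofork.IsColimit.mk' _ fun s => ⟨coeqDesc f g s.π s.condition, hom_ext (coequalizer.π_desc _ _),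
    fun {m} hm => hom_ext <| coequalizer.hom_ext <| by
      have h : coequalizer.π f.hom g.hom ≫ m.hom = s.π.hom := congrArg Hom.hom hm
      exact h.trans (coequalizer.π_desc _ _).symm⟩

instance : HasCoequalizers (YD N) :=
  haveI : ∀ {V W : YD N} {f g : V ⟶ W}, HasColimit (parallelPair f g) := fun {_ _ f g} =>
    ⟨⟨⟨_, coeqIsColimit f g⟩⟩⟩
  hasCoequalizers_of_hasColimit_parallelPair _

instance : PreservesColimitsOfShape WalkingParallelPair (forget N) where
  preservesColimit {K} := by
    have h : PreservesColimit (parallelPair (K.map WalkingParallelPairHom.left)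
        (K.map WalkingParallelPairHom.right)) (forget N) :=
      preservesColimit_of_preserves_colimit_cocone (coeqIsColimit _ _) <|
        (isColimitMapCoconeCoforkEquiv (forget N) _).symm (coequalizerIsCoequalizer _ _)
    exact preservesColimit_of_iso_diagram _ (diagramIsoParallelPair K).symm

instance : (forget N).ReflectsIsomorphisms where
  reflects f hf :=
    haveI : IsIso f.hom := hf
    ⟨(isoMk (asIso f.hom) f.lin f.colin).inv, (isoMk (asIso f.hom) f.lin f.colin).hom_inv_id,
      (isoMk (asIso f.hom) f.lin f.colin).inv_hom_id⟩

instance (V : YD N) : PreservesColimitsOfShape WalkingParallelPair (tensorLeft V) :=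
  haveI : ReflectsColimitsOfShape WalkingParallelPair (forget N) :=
    reflectsColimitsOfShape_of_reflectsIsomorphisms
  haveI : PreservesColimitsOfShape WalkingParallelPair (tensorLeft V ⋙ forget N) :=
    preservesColimitsOfShape_of_natIso (F := forget N ⋙ tensorLeft V.X)
      (NatIso.ofComponents (fun _ => Iso.refl _) (fun _ => by simp; exact (Category.comp_id _).trans (Category.id_comp _).symm))
  preservesColimitsOfShape_of_reflects_of_preserves (tensorLeft V) (forget N)

end Coequalizers

end YD

namespace YD

section Trivial

variable {C : Type u} [Category.{v} C] [MonoidalCategory C] [BraidedCategory C]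
  {N : C} [HopfObj N]

theorem tAct_trAct (X Y : C) : tAct (trAct X) (trAct Y) = (trAct (X ⊗ Y) : N ⊗ (X ⊗ Y) ⟶ _) := by
  rw [tAct_trAct_right, actL, trAct, trAct]; monoidal

theorem tCo_trCo (X Y : C) : tCo (trCo X) (trCo Y) = (trCo (X ⊗ Y) : X ⊗ Y ⟶ N ⊗ (X ⊗ Y)) := by
  rw [tCo_trCo_right, trCo, trCo]; monoidal

theorem trAct_nat {X Y : C} (f : X ⟶ Y) : trAct X ≫ f = N ◁ f ≫ trAct Y := by
  rw [trAct, trAct, whisker_exchange_assoc]; simp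

theorem trCo_nat {X Y : C} (f : X ⟶ Y) : trCo X ≫ N ◁ f = f ≫ trCo Y := by
  rw [trCo, trCo, Category.assoc, ← whisker_exchange]; simp

theorem half_trAct (X Y : C) : half (trCo X : X ⟶ N ⊗ X) (trAct Y) = (β_ X Y).hom := by
  calc _ = 𝟙 _ ⊗≫ (η[N] ▷ (X ⊗ Y) ≫ N ◁ (β_ X Y).hom) ⊗≫ ε[N] ▷ Y ▷ X ⊗≫ 𝟙 _ := by
        rw [half, trAct, trCo]; monoidal
    _ = 𝟙 _ ⊗≫ (β_ X Y).hom ⊗≫ (η[N] ≫ ε[N]) ▷ Y ▷ X ⊗≫ 𝟙 _ := by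
        rw [← whisker_exchange]; monoidal
    _ = _ := by rw [BimonObj.one_counit]; monoidal

variable (N) (R : C) (h : (β_ R N).hom ≫ (β_ N R).hom = 𝟙 (R ⊗ N))

/-- The algebra structure of `R` on the trivial Yetter-Drinfeld module. -/
instance [MonObj R] : MonObj (triv N R h) where
  one := ⟨η[R], trAct_nat η[R], trCo_nat η[R]⟩
  mul := ⟨μ[R], (congrArg (· ≫ μ[R]) (tAct_trAct R R)).trans (trAct_nat μ[R]),
    (congrArg (· ≫ N ◁ μ[R]) (tCo_trCo R R)).trans (trCo_nat μ[R])⟩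
  one_mul := by
    apply hom_ext
    rw [comp_hom, whiskerRight_hom]
    exact MonObj.one_mul R
  mul_one := by
    apply hom_ext
    rw [comp_hom, whiskerLeft_hom]
    exact MonObj.mul_one R
  mul_assoc := by
    apply hom_ext
    rw [comp_hom, comp_hom, comp_hom, whiskerLeft_hom, whiskerRight_hom]
    exact MonObj.mul_assoc R

instance [IsIso 𝒮[N]] [MonObj R] [IsCommMonObj R] : IsCommMonObj (triv N R h) where
  mul_comm := by
    ext
    change half (trCo R) (trAct R) ≫ μ[R] = μ[R]
    rw [half_trAct, IsCommMonObj.mul_comm]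

end Trivial

end YD

/-! ### Induction to local modules -/

/-- The objects with trivial double braiding with `R`. -/
def centralizer {C : Type u} [Category.{v} C] [MonoidalCategory C] [BraidedCategory C] (R : C) :
    ObjectProperty C :=
  fun X => (β_ R X).hom ≫ (β_ X R).hom = 𝟙 (R ⊗ X)

section Induction

variable {C : Type u} [Category.{v} C] [MonoidalCategory C] [BraidedCategory C]

instance (R : C) : (centralizer R).IsMonoidal where
  prop_unit := by simp [centralizer]
  prop_tensor X Y hX hY := by
    dsimp only [centralizer] at *
    calc _ = 𝟙 _ ⊗≫ (β_ R X).hom ▷ Y ⊗≫ X ◁ ((β_ R Y).hom ≫ (β_ Y R).hom) ⊗≫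
          (β_ X R).hom ▷ Y ⊗≫ 𝟙 _ := by
          rw [BraidedCategory.braiding_tensor_left_hom, BraidedCategory.braiding_tensor_right_hom]
          monoidal
      _ = 𝟙 _ ⊗≫ ((β_ R X).hom ≫ (β_ X R).hom) ▷ Y ⊗≫ 𝟙 _ := by rw [hY]; monoidal
      _ = _ := by rw [hX]; monoidal

namespace LocalModule

variable {R : C} [MonObj R] [IsCommMonObj R]

theorem free_loc (X : C) (hX : centralizer R X) :
    (β_ R (R ⊗ X)).hom ≫ (β_ (R ⊗ X) R).hom ≫ actL μ[R] X = actL μ[R] X := by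
  dsimp only [centralizer] at hX
  calc _ = 𝟙 _ ⊗≫ (β_ R R).hom ▷ X ⊗≫ R ◁ ((β_ R X).hom ≫ (β_ X R).hom) ⊗≫
        ((β_ R R).hom ≫ μ[R]) ▷ X := by
        rw [BraidedCategory.braiding_tensor_left_hom, BraidedCategory.braiding_tensor_right_hom,
          actL]
        monoidal
    _ = 𝟙 _ ⊗≫ (β_ R R).hom ▷ X ⊗≫ R ◁ ((β_ R X).hom ≫ (β_ X R).hom) ⊗≫ μ[R] ▷ X := by
        rw [IsCommMonObj.mul_comm]
    _ = 𝟙 _ ⊗≫ ((β_ R R).hom ≫ μ[R]) ▷ X := by rw [hX]; monoidal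
    _ = _ := by rw [IsCommMonObj.mul_comm, actL]; monoidal

/-- The free `R`-module `R ⊗ X` on an object with trivial double braiding with `R`. -/
def free (X : (centralizer R).FullSubcategory) : LocalModule R :=
  letI := modOf (actL μ[R] X.obj) (actL_one _ (MonObj.one_mul R) X.obj)
    (actL_mul _ (MonObj.mul_assoc R) X.obj)
  { X := R ⊗ X.obj
    loc := free_loc X.obj X.property }

/-- The generators of the free module. -/
def gen (X : (centralizer R).FullSubcategory) : X.obj ⟶ (free X).X :=
  (λ_ X.obj).inv ≫ η[R] ▷ X.obj

/-- `g` generates the local module `M` freely. -/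
def IsGen {U : C} {M : LocalModule R} (g : U ⟶ M.X) : Prop := IsIso (R ◁ g ≫ act R M.X)

theorem gen_act (X : (centralizer R).FullSubcategory) :
    R ◁ gen X ≫ act R (free X).X = 𝟙 (R ⊗ X.obj) := by
  change R ◁ ((λ_ X.obj).inv ≫ η[R] ▷ X.obj) ≫ actL μ[R] X.obj = 𝟙 _
  calc _ = 𝟙 _ ⊗≫ (R ◁ η[R] ≫ μ[R]) ▷ X.obj := by rw [actL]; monoidal
    _ = _ := by rw [MonObj.mul_one]; monoidal

theorem isGen_gen (X : (centralizer R).FullSubcategory) : IsGen (gen X) := by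
  rw [IsGen, gen_act]; exact IsIso.id _

theorem IsGen.ext {U : C} {M P : LocalModule R} {g : U ⟶ M.X} (hg : IsGen g) {f f' : M ⟶ P}
    (h : g ≫ f.hom = g ≫ f'.hom) : f = f' := by
  have := hg
  apply hom_ext
  dsimp only [IsGen] at this
  rw [← cancel_epi (R ◁ g ≫ act R M.X), Category.assoc, Category.assoc, f.lin, f'.lin,
    ← whiskerLeft_comp_assoc, ← whiskerLeft_comp_assoc, h]

/-- The extension of a morphism to the free module. -/
def lift {X : (centralizer R).FullSubcategory} {P : LocalModule R} (g : X.obj ⟶ P.X) :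
    free X ⟶ P where
  hom := R ◁ g ≫ act R P.X
  lin := by
    change actL μ[R] X.obj ≫ _ = _
    calc _ = 𝟙 _ ⊗≫ (μ[R] ▷ X.obj ≫ R ◁ g) ≫ act R P.X := by rw [actL]; monoidal
      _ = 𝟙 _ ⊗≫ (R ⊗ R) ◁ g ≫ μ[R] ▷ P.X ≫ act R P.X := by
          rw [← whisker_exchange]; monoidal
      _ = _ := by rw [mul_act]; simp; monoidal

theorem gen_lift {X : (centralizer R).FullSubcategory} {P : LocalModule R} (g : X.obj ⟶ P.X) :
    gen X ≫ (lift g).hom = g := by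
  change ((λ_ X.obj).inv ≫ η[R] ▷ X.obj) ≫ R ◁ g ≫ act R P.X = g
  rw [Category.assoc, ← whisker_exchange_assoc, one_act]
  simp

variable [HasCoequalizers C] [∀ X : C, PreservesColimitsOfShape WalkingParallelPair (tensorLeft X)]

/-- Morphisms out of a tensor product are determined on generators. -/
theorem gen_ext {U W : C} {M N P : LocalModule R} {u : U ⟶ M.X} {w : W ⟶ N.X} (hu : IsGen u)
    (hw : IsGen w) {f f' : M ⊗ N ⟶ P}
    (h : (u ⊗ₘ w) ≫ pr M N ≫ f.hom = (u ⊗ₘ w) ≫ pr M N ≫ f'.hom) : f = f' := by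
  apply pr_ext
  dsimp only [IsGen] at hu hw
  have e1 : ∀ k : M ⊗ N ⟶ P, (α_ R U N.X).inv ≫ (R ◁ u ≫ act R M.X) ▷ N.X ≫ pr M N ≫ k.hom =
      R ◁ (u ▷ N.X ≫ pr M N ≫ k.hom) ≫ act R P.X := by
    intro k
    calc _ = R ◁ (u ▷ N.X) ≫ actL (act R M.X) N.X ≫ pr M N ≫ k.hom := by rw [actL]; monoidal
      _ = _ := by
        rw [← pr_act_assoc, k.lin]; simp only [whiskerLeft_comp, Category.assoc]
  have e2 : ∀ k : M ⊗ N ⟶ P, ((α_ R U W).inv ≫ (β_ R U).hom ▷ W ≫ (α_ U R W).hom) ≫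
      U ◁ (R ◁ w ≫ act R N.X) ≫ u ▷ N.X ≫ pr M N ≫ k.hom =
      R ◁ ((u ⊗ₘ w) ≫ pr M N ≫ k.hom) ≫ act R P.X := by
    intro k
    have hn := actR_nat (b := act R N.X) (b' := act R N.X) u (𝟙 N.X) (by simp)
    rw [MonoidalCategory.tensorHom_id] at hn
    calc _ = (α_ R U W).inv ≫ ((β_ R U).hom ▷ W ≫ (U ⊗ R) ◁ w) ≫ (α_ _ _ _).hom ≫
          U ◁ act R N.X ≫ u ▷ N.X ≫ pr M N ≫ k.hom := by simp
      _ = R ◁ (U ◁ w) ≫ actR U (act R N.X) ≫ u ▷ N.X ≫ pr M N ≫ k.hom := by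
        rw [← whisker_exchange, actR]; monoidal
      _ = R ◁ (U ◁ w) ≫ R ◁ (u ▷ N.X) ≫ R ◁ pr M N ≫ act R (M ⊗ N).X ≫ k.hom := by
        rw [reassoc_of% hn, pr_act'_assoc]
      _ = _ := by
        rw [k.lin, MonoidalCategory.tensorHom_def']
        simp only [whiskerLeft_comp, Category.assoc]
  rw [← cancel_epi ((α_ R U N.X).inv ≫ (R ◁ u ≫ act R M.X) ▷ N.X), Category.assoc, Category.assoc,
    e1, e1]
  congr 2
  rw [← cancel_epi (((α_ R U W).inv ≫ (β_ R U).hom ▷ W ≫ (α_ U R W).hom) ≫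
      U ◁ (R ◁ w ≫ act R N.X))]
  simp only [Category.assoc] at e2 ⊢
  rw [e2, e2, h]

end LocalModule

end Induction

namespace LocalModule

section Ind

variable {C : Type u} [Category.{v} C] [MonoidalCategory C] [BraidedCategory C]
  {R : C} [MonObj R] [IsCommMonObj R]

/-- The multiplication of `R` on a tensor product of free modules. -/
def freeMul (R X Y : C) [MonObj R] : (R ⊗ X) ⊗ (R ⊗ Y) ⟶ R ⊗ (X ⊗ Y) :=
  tensorμ R X R Y ≫ μ[R] ▷ (X ⊗ Y)

theorem freeMul_left (X Y : C) : actL (actL μ[R] X) (R ⊗ Y) ≫ freeMul R X Y =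
    R ◁ freeMul R X Y ≫ actL μ[R] (X ⊗ Y) := by
  calc _ = 𝟙 _ ⊗≫ (μ[R] ▷ ((X ⊗ R) ⊗ Y) ≫ R ◁ ((β_ X R).hom ▷ Y)) ⊗≫
        μ[R] ▷ (X ⊗ Y) := by simp only [actL, freeMul, tensorμ]; monoidal
    _ = 𝟙 _ ⊗≫ R ◁ R ◁ (β_ X R).hom ▷ Y ⊗≫ (μ[R] ▷ R ≫ μ[R]) ▷ (X ⊗ Y) := by
        rw [← whisker_exchange]; monoidal
    _ = _ := by rw [MonObj.mul_assoc, actL, freeMul, tensorμ]; monoidal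

theorem freeMul_right (X Y : C) (hX : centralizer R X) :
    actR (R ⊗ X) (actL μ[R] Y) ≫ freeMul R X Y =
      R ◁ freeMul R X Y ≫ actL μ[R] (X ⊗ Y) := by
  dsimp only [centralizer] at hX
  calc _ = 𝟙 _ ⊗≫ (β_ R (R ⊗ X)).hom ▷ R ▷ Y ⊗≫ R ◁ (X ◁ μ[R] ≫ (β_ X R).hom) ▷ Y ⊗≫
        μ[R] ▷ (X ⊗ Y) := by simp only [actR, actL, freeMul, tensorμ]; monoidal
    _ = 𝟙 _ ⊗≫ (β_ R R).hom ▷ X ▷ R ▷ Y ⊗≫ R ◁ ((β_ R X).hom ≫ (β_ X R).hom) ▷ R ▷ Y ⊗≫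
        R ◁ R ◁ (β_ X R).hom ▷ Y ⊗≫ (R ◁ μ[R] ≫ μ[R]) ▷ (X ⊗ Y) := by
        rw [BraidedCategory.braiding_naturality_right, BraidedCategory.braiding_tensor_right_hom,
          BraidedCategory.braiding_tensor_right_hom]
        monoidal
    _ = 𝟙 _ ⊗≫ ((β_ R R).hom ▷ (X ⊗ R) ≫ (R ⊗ R) ◁ (β_ X R).hom) ▷ Y ⊗≫
        ((α_ R R R).inv ≫ μ[R] ▷ R ≫ μ[R]) ▷ (X ⊗ Y) := by
        rw [hX, MonObj.mul_assoc, Iso.inv_hom_id_assoc]; monoidal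
    _ = 𝟙 _ ⊗≫ R ◁ R ◁ (β_ X R).hom ▷ Y ⊗≫
        ((((β_ R R).hom ≫ μ[R]) ▷ R) ≫ μ[R]) ▷ (X ⊗ Y) := by
        rw [← whisker_exchange]; monoidal
    _ = _ := by
        rw [IsCommMonObj.mul_comm, MonObj.mul_assoc, actL, freeMul, tensorμ]; monoidal

theorem gen_freeMul (X Y : C) :
    (((λ_ X).inv ≫ η[R] ▷ X) ⊗ₘ ((λ_ Y).inv ≫ η[R] ▷ Y)) ≫ freeMul R X Y =
      (λ_ (X ⊗ Y)).inv ≫ η[R] ▷ (X ⊗ Y) := by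
  calc _ = 𝟙 _ ⊗≫ η[R] ▷ (X ⊗ Y) ⊗≫ R ◁ (X ◁ η[R] ≫ (β_ X R).hom) ▷ Y ⊗≫
        μ[R] ▷ X ▷ Y ⊗≫ 𝟙 _ := by
        simp only [freeMul, tensorμ, MonoidalCategory.tensorHom_def]; monoidal
    _ = 𝟙 _ ⊗≫ η[R] ▷ (X ⊗ Y) ⊗≫ (R ◁ η[R] ≫ μ[R]) ▷ X ▷ Y ⊗≫ 𝟙 _ := by
        rw [BraidedCategory.braiding_naturality_right, braiding_tensorUnit_right]; monoidal
    _ = _ := by rw [MonObj.mul_one]; monoidal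

variable [HasCoequalizers C] [∀ X : C, PreservesColimitsOfShape WalkingParallelPair (tensorLeft X)]

/-- The generators of a tensor product of free modules. -/
def gen₂ (X Y : (centralizer R).FullSubcategory) : (X ⊗ Y).obj ⟶ (free X ⊗ free Y).X :=
  (gen X ⊗ₘ gen Y) ≫ pr (free X) (free Y)

/-- The tensor product of free modules maps to the free module on the tensor product. -/
def freeHom (X Y : (centralizer R).FullSubcategory) : free X ⊗ free Y ⟶ free (X ⊗ Y) :=
  desc (M := free X) (N := free Y) (P := free (X ⊗ Y)) (freeMul R X.obj Y.obj)
    (freeMul_left X.obj Y.obj) (freeMul_right X.obj Y.obj X.property)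

theorem pr_freeHom (X Y : (centralizer R).FullSubcategory) :
    pr (free X) (free Y) ≫ (freeHom X Y).hom = freeMul R X.obj Y.obj :=
  pr_desc (M := free X) (N := free Y) (P := free (X ⊗ Y)) _ _ _

theorem gen₂_freeHom (X Y : (centralizer R).FullSubcategory) :
    gen₂ X Y ≫ (freeHom X Y).hom = gen (X ⊗ Y) := by
  rw [gen₂, Category.assoc]
  exact (congrArg ((gen X ⊗ₘ gen Y) ≫ ·) (pr_freeHom X Y)).trans (gen_freeMul X.obj Y.obj)

/-- Induction is strong monoidal: the tensorator. -/
def freeIso (X Y : (centralizer R).FullSubcategory) : free X ⊗ free Y ≅ free (X ⊗ Y) where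
  hom := freeHom X Y
  inv := lift (gen₂ X Y)
  hom_inv_id := by
    apply gen_ext (isGen_gen X) (isGen_gen Y)
    rw [← Category.assoc, ← Category.assoc]
    change gen₂ X Y ≫ (freeHom X Y).hom ≫ (lift (gen₂ X Y)).hom = gen₂ X Y ≫ 𝟙 _
    rw [reassoc_of% (gen₂_freeHom X Y), gen_lift, Category.comp_id]
  inv_hom_id := by
    apply (isGen_gen (X ⊗ Y)).ext
    rw [comp_hom, reassoc_of% (gen_lift (X := X ⊗ Y) (gen₂ X Y)), gen₂_freeHom, id_hom]
    exact (Category.comp_id _).symm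

theorem isGen_gen₂ (X Y : (centralizer R).FullSubcategory) : IsGen (gen₂ X Y) :=
  inferInstanceAs (IsIso ((forget R).map (freeIso X Y).inv))

/-- Induction is strong monoidal: the unit constraint. -/
def freeUnit : 𝟙_ (LocalModule R) ≅ free (𝟙_ (centralizer R).FullSubcategory) :=
  isoMk (M := 𝟙_ (LocalModule R)) (N := free (𝟙_ (centralizer R).FullSubcategory)) (ρ_ R).symm <| by
    change μ[R] ≫ (ρ_ R).inv = R ◁ (ρ_ R).inv ≫ actL μ[R] (𝟙_ C)
    rw [actL]; monoidal

theorem un_freeUnit : un R ≫ (freeUnit (R := R)).hom.hom = gen (𝟙_ _) := by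
  change η[R] ≫ (ρ_ R).inv = (λ_ (𝟙_ C)).inv ≫ η[R] ▷ 𝟙_ C
  monoidal

/-- The morphism of free modules induced by a morphism. -/
def freeMap {X Y : (centralizer R).FullSubcategory} (f : X ⟶ Y) : free X ⟶ free Y where
  hom := R ◁ f.hom
  lin := by
    change actL μ[R] X.obj ≫ _ = _ ≫ actL μ[R] Y.obj
    rw [actL, Category.assoc, ← whisker_exchange, ← associator_inv_naturality_right_assoc, actL]
    rfl

variable (R) in
/-- The induction functor `X ↦ R ⊗ X`, from the objects with trivial double braiding with `R` to
local modules. -/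
def ind : (centralizer R).FullSubcategory ⥤ LocalModule R where
  obj := free
  map := freeMap
  map_id _ := hom_ext (whiskerLeft_id _ _)
  map_comp _ _ := hom_ext (whiskerLeft_comp _ _ _)

theorem gen_map {X Y : (centralizer R).FullSubcategory} (f : X ⟶ Y) :
    gen X ≫ (freeMap f).hom = f.hom ≫ gen Y := by
  change ((λ_ X.obj).inv ≫ η[R] ▷ X.obj) ≫ R ◁ f.hom = f.hom ≫ (λ_ Y.obj).inv ≫ η[R] ▷ Y.obj
  rw [Category.assoc, ← whisker_exchange]; simp

theorem gen_gen_freeHom (X Y : (centralizer R).FullSubcategory) :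
    (gen X ⊗ₘ gen Y) ≫ pr (free X) (free Y) ≫ (freeHom X Y).hom = gen (X ⊗ Y) := by
  rw [← gen₂_freeHom, gen₂, Category.assoc]

end Ind

end LocalModule

namespace LocalModule

section IndMonoidal

variable {C : Type u} [Category.{v} C] [MonoidalCategory C] [BraidedCategory C]
  [HasCoequalizers C] [∀ X : C, PreservesColimitsOfShape WalkingParallelPair (tensorLeft X)]
  {R : C} [MonObj R] [IsCommMonObj R]

theorem gen_gen_tensor {X Y X' Y' : (centralizer R).FullSubcategory} (f : X ⟶ X') (g : Y ⟶ Y') :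
    freeHom X Y ≫ freeMap (f ⊗ₘ g) = (freeMap f ⊗ₘ freeMap g) ≫ freeHom X' Y' := by
  apply gen_ext (isGen_gen X) (isGen_gen Y)
  have h : gen (X ⊗ Y) ≫ (freeMap (f ⊗ₘ g)).hom = (f.hom ⊗ₘ g.hom) ≫ gen (X' ⊗ Y') :=
    gen_map (f ⊗ₘ g)
  calc _ = ((gen X ⊗ₘ gen Y) ≫ pr _ _ ≫ (freeHom X Y).hom) ≫ (freeMap (f ⊗ₘ g)).hom := by
        simp only [comp_hom, Category.assoc]
    _ = (f.hom ⊗ₘ g.hom) ≫ (gen X' ⊗ₘ gen Y') ≫ pr _ _ ≫ (freeHom X' Y').hom := by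
        rw [gen_gen_freeHom, gen_gen_freeHom]; exact h
    _ = _ := by
        rw [comp_hom, pr_tensor_assoc, MonoidalCategory.tensorHom_comp_tensorHom_assoc,
          MonoidalCategory.tensorHom_comp_tensorHom_assoc, gen_map, gen_map]

theorem freeMap_id (X : (centralizer R).FullSubcategory) : freeMap (𝟙 X) = 𝟙 (free X) :=
  hom_ext (whiskerLeft_id _ _)

theorem freeHom_natL {X Y : (centralizer R).FullSubcategory} (f : X ⟶ Y)
    (Z : (centralizer R).FullSubcategory) :
    freeMap f ▷ free Z ≫ freeHom Y Z = freeHom X Z ≫ freeMap (f ▷ Z) := by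
  have h := gen_gen_tensor f (𝟙 Z)
  rw [MonoidalCategory.tensorHom_id, freeMap_id, MonoidalCategory.tensorHom_id] at h
  exact h.symm

theorem freeHom_natR (Z : (centralizer R).FullSubcategory)
    {X Y : (centralizer R).FullSubcategory} (f : X ⟶ Y) :
    free Z ◁ freeMap f ≫ freeHom Z Y = freeHom Z X ≫ freeMap (Z ◁ f) := by
  have h := gen_gen_tensor (𝟙 Z) f
  rw [MonoidalCategory.id_tensorHom, freeMap_id, MonoidalCategory.id_tensorHom] at h
  exact h.symm

theorem freeHom_assoc (X Y Z : (centralizer R).FullSubcategory) :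
    freeHom X Y ▷ free Z ≫ freeHom (X ⊗ Y) Z ≫ freeMap (α_ X Y Z).hom =
      (α_ (free X) (free Y) (free Z)).hom ≫ free X ◁ freeHom Y Z ≫ freeHom X (Y ⊗ Z) := by
  apply gen_ext (isGen_gen₂ X Y) (isGen_gen Z)
  have h : gen ((X ⊗ Y) ⊗ Z) ≫ (freeMap (α_ X Y Z).hom).hom =
    (α_ X.obj Y.obj Z.obj).hom ≫ gen (X ⊗ (Y ⊗ Z)) := gen_map (α_ X Y Z).hom
  calc _ = ((gen₂ X Y ≫ (freeHom X Y).hom) ⊗ₘ gen Z) ≫ pr _ _ ≫ (freeHom (X ⊗ Y) Z).hom ≫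
          (freeMap (α_ X Y Z).hom).hom := by
        rw [comp_hom, comp_hom, pr_whiskerRight_assoc, ← MonoidalCategory.tensorHom_id,
          MonoidalCategory.tensorHom_comp_tensorHom_assoc, Category.comp_id]
    _ = (gen (X ⊗ Y) ⊗ₘ gen Z) ≫ pr _ _ ≫ (freeHom (X ⊗ Y) Z).hom ≫
          (freeMap (α_ X Y Z).hom).hom := by rw [gen₂_freeHom]
    _ = gen ((X ⊗ Y) ⊗ Z) ≫ (freeMap (α_ X Y Z).hom).hom := by
        rw [← gen_gen_freeHom (X ⊗ Y) Z]; simp only [Category.assoc]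
    _ = (α_ X.obj Y.obj Z.obj).hom ≫ gen (X ⊗ (Y ⊗ Z)) := h
    _ = (α_ X.obj Y.obj Z.obj).hom ≫ (gen X ⊗ₘ gen (Y ⊗ Z)) ≫ pr _ _ ≫
          (freeHom X (Y ⊗ Z)).hom := by rw [gen_gen_freeHom]
    _ = (α_ X.obj Y.obj Z.obj).hom ≫ (gen X ⊗ₘ (gen₂ Y Z ≫ (freeHom Y Z).hom)) ≫ pr _ _ ≫
          (freeHom X (Y ⊗ Z)).hom := by rw [gen₂_freeHom]
    _ = (α_ X.obj Y.obj Z.obj).hom ≫ (gen X ⊗ₘ (gen Y ⊗ₘ gen Z)) ≫ (free X).X ◁ pr _ _ ≫ pr _ _ ≫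
          (free X ◁ freeHom Y Z).hom ≫ (freeHom X (Y ⊗ Z)).hom := by
        rw [pr_whiskerLeft_assoc, ← MonoidalCategory.id_tensorHom,
          ← MonoidalCategory.id_tensorHom, MonoidalCategory.tensorHom_comp_tensorHom_assoc,
          MonoidalCategory.tensorHom_comp_tensorHom_assoc, Category.comp_id, Category.comp_id]
        rfl
    _ = ((gen X ⊗ₘ gen Y) ⊗ₘ gen Z) ≫ pr _ _ ▷ (free Z).X ≫ pr _ _ ≫
          (α_ (free X) (free Y) (free Z)).hom.hom ≫
          (free X ◁ freeHom Y Z).hom ≫ (freeHom X (Y ⊗ Z)).hom := by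
        rw [pr_associator_assoc, associator_naturality_assoc]
    _ = _ := by
        rw [← MonoidalCategory.tensorHom_id, MonoidalCategory.tensorHom_comp_tensorHom_assoc,
          Category.comp_id]
        rfl

theorem isGen_un : IsGen (M := 𝟙_ (LocalModule R)) (un R) := by
  have h : R ◁ un R ≫ act R (𝟙_ (LocalModule R)).X = (ρ_ R).hom := MonObj.mul_one R
  rw [IsGen, h]; exact (ρ_ R).isIso_hom

theorem freeHom_left (X : (centralizer R).FullSubcategory) :
    (λ_ (free X)).hom = freeUnit.hom ▷ free X ≫ freeHom (𝟙_ _) X ≫ freeMap (λ_ X).hom := by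
  apply gen_ext isGen_un (isGen_gen X)
  have h : gen (𝟙_ _ ⊗ X) ≫ (freeMap (λ_ X).hom).hom = (λ_ X.obj).hom ≫ gen X :=
    gen_map (λ_ X).hom
  symm
  calc _ = (un R ⊗ₘ gen X) ≫ (freeUnit (R := R)).hom.hom ▷ (free X).X ≫ pr _ _ ≫
          (freeHom (𝟙_ _) X).hom ≫ (freeMap (λ_ X).hom).hom := by
        rw [comp_hom, comp_hom, pr_whiskerRight_assoc]
    _ = (gen (𝟙_ _) ⊗ₘ gen X) ≫ pr _ _ ≫ (freeHom (𝟙_ _) X).hom ≫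
          (freeMap (λ_ X).hom).hom := by
        rw [← un_freeUnit, ← MonoidalCategory.tensorHom_id,
          MonoidalCategory.tensorHom_comp_tensorHom_assoc, Category.comp_id]
    _ = gen (𝟙_ _ ⊗ X) ≫ (freeMap (λ_ X).hom).hom := by
        rw [← gen_gen_freeHom (𝟙_ _) X]; simp only [Category.assoc]
    _ = (λ_ X.obj).hom ≫ gen X := h
    _ = _ := by
        rw [MonoidalCategory.tensorHom_def', Category.assoc, pr_leftUnitor, leftUnitor_naturality]

theorem freeHom_right (X : (centralizer R).FullSubcategory) :
    (ρ_ (free X)).hom = free X ◁ freeUnit.hom ≫ freeHom X (𝟙_ _) ≫ freeMap (ρ_ X).hom := by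
  apply gen_ext (isGen_gen X) isGen_un
  have h : gen (X ⊗ 𝟙_ _) ≫ (freeMap (ρ_ X).hom).hom = (ρ_ X.obj).hom ≫ gen X :=
    gen_map (ρ_ X).hom
  symm
  calc _ = (gen X ⊗ₘ un R) ≫ (free X).X ◁ (freeUnit (R := R)).hom.hom ≫ pr _ _ ≫
          (freeHom X (𝟙_ _)).hom ≫ (freeMap (ρ_ X).hom).hom := by
        rw [comp_hom, comp_hom, pr_whiskerLeft_assoc]
    _ = (gen X ⊗ₘ gen (𝟙_ _)) ≫ pr _ _ ≫ (freeHom X (𝟙_ _)).hom ≫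
          (freeMap (ρ_ X).hom).hom := by
        rw [← un_freeUnit, ← MonoidalCategory.id_tensorHom,
          MonoidalCategory.tensorHom_comp_tensorHom_assoc, Category.comp_id]
    _ = gen (X ⊗ 𝟙_ _) ≫ (freeMap (ρ_ X).hom).hom := by
        rw [← gen_gen_freeHom X (𝟙_ _)]; simp only [Category.assoc]
    _ = (ρ_ X.obj).hom ≫ gen X := h
    _ = _ := by
        rw [MonoidalCategory.tensorHom_def, Category.assoc, pr_rightUnitor, rightUnitor_naturality]

theorem freeHom_braided (X Y : (centralizer R).FullSubcategory) :
    freeHom X Y ≫ freeMap (β_ X Y).hom = (β_ (free X) (free Y)).hom ≫ freeHom Y X := by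
  apply gen_ext (isGen_gen X) (isGen_gen Y)
  have h : gen (X ⊗ Y) ≫ (freeMap (β_ X Y).hom).hom = (β_ X.obj Y.obj).hom ≫ gen (Y ⊗ X) :=
    gen_map (β_ X Y).hom
  calc _ = ((gen X ⊗ₘ gen Y) ≫ pr _ _ ≫ (freeHom X Y).hom) ≫ (freeMap (β_ X Y).hom).hom := by
        simp only [comp_hom, Category.assoc]
    _ = (β_ X.obj Y.obj).hom ≫ (gen Y ⊗ₘ gen X) ≫ pr _ _ ≫ (freeHom Y X).hom := by
        rw [gen_gen_freeHom, gen_gen_freeHom]; exact h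
    _ = _ := by
        rw [comp_hom, pr_braiding_assoc, BraidedCategory.braiding_naturality_assoc]

instance : (ind R).Monoidal :=
  Functor.CoreMonoidal.toMonoidal
    { εIso := freeUnit
      μIso := freeIso
      μIso_hom_natural_left := freeHom_natL
      μIso_hom_natural_right := fun Z f => freeHom_natR Z f
      associativity := freeHom_assoc
      left_unitality := freeHom_left
      right_unitality := freeHom_right }

instance : (ind R).Braided where
  braided X Y := freeHom_braided (R := R) X Y

end IndMonoidal

end LocalModule

section HopfTransport

universe v₁ u₁ v₂ u₂

variable {C : Type u₁} [Category.{v₁} C] [MonoidalCategory C] [BraidedCategory C]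
  {D : Type u₂} [Category.{v₂} D] [MonoidalCategory D] [BraidedCategory D]

/-- The image of a Hopf algebra under a braided monoidal functor is a Hopf algebra. -/
abbrev mapHopf (F : C ⥤ D) [F.Braided] (A : C) [HopfObj A] : HopfObj (F.obj A) :=
  letI := F.monObjObj A
  letI := Functor.obj.instComonObj A F
  { mul_comul := by
      change (Functor.LaxMonoidal.μ F A A ≫ F.map μ[A]) ≫ F.map Δ[A] ≫ Functor.OplaxMonoidal.δ F A A =
        ((F.map Δ[A] ≫ Functor.OplaxMonoidal.δ F A A) ⊗ₘ (F.map Δ[A] ≫ Functor.OplaxMonoidal.δ F A A)) ≫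
          tensorμ _ _ _ _ ≫ ((Functor.LaxMonoidal.μ F A A ≫ F.map μ[A]) ⊗ₘ (Functor.LaxMonoidal.μ F A A ≫ F.map μ[A]))
      have h : tensorμ (F.obj A) (F.obj A) (F.obj A) (F.obj A) ≫ (Functor.LaxMonoidal.μ F A A ⊗ₘ Functor.LaxMonoidal.μ F A A) =
          (Functor.LaxMonoidal.μ F A A ⊗ₘ Functor.LaxMonoidal.μ F A A) ≫ Functor.LaxMonoidal.μ F (A ⊗ A) (A ⊗ A) ≫ F.map (tensorμ A A A A) ≫
            Functor.OplaxMonoidal.δ F (A ⊗ A) (A ⊗ A) := by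
        rw [← tensorμ_comp_μ_tensorHom_μ_comp_μ_assoc, Functor.Monoidal.μ_δ,
          Category.comp_id]
      calc _ = Functor.LaxMonoidal.μ F A A ≫ F.map (μ[A] ≫ Δ[A]) ≫ Functor.OplaxMonoidal.δ F A A := by simp only [F.map_comp, Category.assoc]
        _ = Functor.LaxMonoidal.μ F A A ≫ F.map (Δ[A] ⊗ₘ Δ[A]) ≫ F.map (tensorμ A A A A) ≫ F.map (μ[A] ⊗ₘ μ[A]) ≫
              Functor.OplaxMonoidal.δ F A A := by
            rw [BimonObj.mul_comul, F.map_comp, F.map_comp]; simp only [Category.assoc]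
        _ = (F.map Δ[A] ⊗ₘ F.map Δ[A]) ≫ Functor.LaxMonoidal.μ F (A ⊗ A) (A ⊗ A) ≫ F.map (tensorμ A A A A) ≫
              Functor.OplaxMonoidal.δ F (A ⊗ A) (A ⊗ A) ≫ (F.map μ[A] ⊗ₘ F.map μ[A]) := by
            rw [Functor.OplaxMonoidal.δ_natural, Functor.LaxMonoidal.μ_natural_assoc]
        _ = (F.map Δ[A] ⊗ₘ F.map Δ[A]) ≫ (Functor.OplaxMonoidal.δ F A A ⊗ₘ Functor.OplaxMonoidal.δ F A A) ≫
              (Functor.LaxMonoidal.μ F A A ⊗ₘ Functor.LaxMonoidal.μ F A A) ≫ Functor.LaxMonoidal.μ F (A ⊗ A) (A ⊗ A) ≫ F.map (tensorμ A A A A) ≫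
              Functor.OplaxMonoidal.δ F (A ⊗ A) (A ⊗ A) ≫ (F.map μ[A] ⊗ₘ F.map μ[A]) := by
            rw [MonoidalCategory.tensorHom_comp_tensorHom_assoc (Functor.OplaxMonoidal.δ F A A),
              Functor.Monoidal.δ_μ, MonoidalCategory.id_tensorHom_id, Category.id_comp]
        _ = _ := by
            simp only [← MonoidalCategory.tensorHom_comp_tensorHom, Category.assoc,
              reassoc_of% h]
    one_comul := by
      change (Functor.LaxMonoidal.ε F ≫ F.map η[A]) ≫ F.map Δ[A] ≫ Functor.OplaxMonoidal.δ F A A =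
        (λ_ (𝟙_ D)).inv ≫ ((Functor.LaxMonoidal.ε F ≫ F.map η[A]) ⊗ₘ (Functor.LaxMonoidal.ε F ≫ F.map η[A]))
      calc _ = Functor.LaxMonoidal.ε F ≫ F.map (η[A] ≫ Δ[A]) ≫ Functor.OplaxMonoidal.δ F A A := by simp only [F.map_comp, Category.assoc]
        _ = Functor.LaxMonoidal.ε F ≫ F.map (λ_ (𝟙_ C)).inv ≫ Functor.OplaxMonoidal.δ F _ _ ≫ (F.map η[A] ⊗ₘ F.map η[A]) := by
            rw [Bimon.one_comul, F.map_comp, Category.assoc, Functor.OplaxMonoidal.δ_natural]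
        _ = Functor.LaxMonoidal.ε F ≫ (λ_ _).inv ≫ Functor.LaxMonoidal.ε F ▷ _ ≫
              (F.map η[A] ⊗ₘ F.map η[A]) := by
            rw [← Functor.LaxMonoidal.left_unitality_inv_assoc, Functor.Monoidal.μ_δ_assoc]
        _ = _ := by
            rw [leftUnitor_inv_naturality_assoc, ← MonoidalCategory.tensorHom_def'_assoc,
              MonoidalCategory.tensorHom_comp_tensorHom]
    mul_counit := by
      change (Functor.LaxMonoidal.μ F A A ≫ F.map μ[A]) ≫ F.map ε[A] ≫ Functor.OplaxMonoidal.η F = _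
      rw [Comon.tensorObj_counit]
      change _ = ((F.map ε[A] ≫ Functor.OplaxMonoidal.η F) ⊗ₘ
        (F.map ε[A] ≫ Functor.OplaxMonoidal.η F)) ≫ (λ_ (𝟙_ D)).hom
      calc _ = Functor.LaxMonoidal.μ F A A ≫ F.map (μ[A] ≫ ε[A]) ≫ Functor.OplaxMonoidal.η F := by simp only [F.map_comp, Category.assoc]
        _ = (F.map ε[A] ⊗ₘ F.map ε[A]) ≫ Functor.LaxMonoidal.μ F _ _ ≫ F.map (λ_ (𝟙_ C)).hom ≫
              Functor.OplaxMonoidal.η F := by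
            rw [Bimon.mul_counit, F.map_comp, Category.assoc, Functor.LaxMonoidal.μ_natural_assoc]
        _ = (F.map ε[A] ⊗ₘ F.map ε[A]) ≫ Functor.OplaxMonoidal.η F ▷ _ ≫ (λ_ _).hom ≫
              Functor.OplaxMonoidal.η F := by
            rw [Functor.LaxMonoidal.left_unitality, Category.assoc, Category.assoc,
              ← comp_whiskerRight_assoc, Functor.Monoidal.η_ε, id_whiskerRight, Category.id_comp]
        _ = _ := by
            rw [← leftUnitor_naturality, ← MonoidalCategory.tensorHom_def_assoc,
              MonoidalCategory.tensorHom_comp_tensorHom_assoc]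
    one_counit := by
      change (Functor.LaxMonoidal.ε F ≫ F.map η[A]) ≫ F.map ε[A] ≫ Functor.OplaxMonoidal.η F = _
      rw [Category.assoc, ← F.map_comp_assoc, BimonObj.one_counit]
      simp
    antipode := F.map 𝒮[A]
    antipode_left := by
      change (F.map Δ[A] ≫ Functor.OplaxMonoidal.δ F A A) ≫ F.map 𝒮[A] ▷ F.obj A ≫ (Functor.LaxMonoidal.μ F A A ≫ F.map μ[A]) =
        (F.map ε[A] ≫ Functor.OplaxMonoidal.η F) ≫ (Functor.LaxMonoidal.ε F ≫ F.map η[A])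
      rw [Category.assoc, Functor.LaxMonoidal.μ_natural_left_assoc, Functor.Monoidal.δ_μ_assoc,
        ← F.map_comp, ← F.map_comp, HopfObj.antipode_left, Category.assoc,
        Functor.Monoidal.η_ε_assoc, F.map_comp]
    antipode_right := by
      change (F.map Δ[A] ≫ Functor.OplaxMonoidal.δ F A A) ≫ F.obj A ◁ F.map 𝒮[A] ≫ (Functor.LaxMonoidal.μ F A A ≫ F.map μ[A]) =
        (F.map ε[A] ≫ Functor.OplaxMonoidal.η F) ≫ (Functor.LaxMonoidal.ε F ≫ F.map η[A])
      rw [Category.assoc, Functor.LaxMonoidal.μ_natural_right_assoc, Functor.Monoidal.δ_μ_assoc,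
        ← F.map_comp, ← F.map_comp, HopfObj.antipode_right, Category.assoc,
        Functor.Monoidal.η_ε_assoc, F.map_comp] }

end HopfTransport

section InducedHopf

variable {C : Type u} [Category.{v} C] [MonoidalCategory C] [BraidedCategory C] (R N : C)
  (h : (β_ R N).hom ≫ (β_ N R).hom = 𝟙 (R ⊗ N))

/-- `N` as an object of the full subcategory of objects with trivial double braiding with `R`. -/
def inCentralizer : (centralizer R).FullSubcategory := ⟨N, h⟩

/-- The Hopf algebra structure of `N`, in the full subcategory. -/
instance [HopfObj N] : HopfObj (inCentralizer R N h) where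
  one := ObjectProperty.homMk η[N]
  mul := ObjectProperty.homMk μ[N]
  one_mul := by ext; exact MonObj.one_mul N
  mul_one := by ext; exact MonObj.mul_one N
  mul_assoc := by ext; exact MonObj.mul_assoc N
  counit := ObjectProperty.homMk ε[N]
  comul := ObjectProperty.homMk Δ[N]
  counit_comul := by ext; exact ComonObj.counit_comul N
  comul_counit := by ext; exact ComonObj.comul_counit N
  comul_assoc := by ext; exact ComonObj.comul_assoc N
  mul_comul := by ext; exact BimonObj.mul_comul N
  one_comul := by ext; exact BimonObj.one_comul N
  mul_counit := by ext; exact BimonObj.mul_counit N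
  one_counit := by ext; exact BimonObj.one_counit N
  antipode := ObjectProperty.homMk 𝒮[N]
  antipode_left := by ext; exact HopfObj.antipode_left N
  antipode_right := by ext; exact HopfObj.antipode_right N

instance [HopfObj N] [IsIso 𝒮[N]] : IsIso 𝒮[inCentralizer R N h] :=
  ⟨ObjectProperty.homMk (inv 𝒮[N] : N ⟶ N), by ext; exact IsIso.hom_inv_id 𝒮[N],
    by ext; exact IsIso.inv_hom_id 𝒮[N]⟩

variable [HasCoequalizers C] [∀ X : C, PreservesColimitsOfShape WalkingParallelPair (tensorLeft X)]
  [MonObj R] [IsCommMonObj R]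

/-- The local module `R ⊗ N` induced from `N`. -/
def indLoc : LocalModule R := (LocalModule.ind R).obj (inCentralizer R N h)

/-- The induced local module is a Hopf algebra in the category of local modules, since induction
is a braided monoidal functor. -/
instance [HopfObj N] : HopfObj (indLoc R N h) := mapHopf (LocalModule.ind R) (inCentralizer R N h)

instance [HopfObj N] [IsIso 𝒮[N]] : IsIso 𝒮[indLoc R N h] :=
  inferInstanceAs (IsIso ((LocalModule.ind R).map 𝒮[inCentralizer R N h]))

end InducedHopf

end

end BraidedExtension

open BraidedExtension

/-! Let `U` be the forgetful functor from local `R`-modules to `C`, and `H = R ⊗ N` the induced Hopf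
algebra. Both sides of the equivalence describe the same data on one object of `C`: an action of `R`
that makes it a local module, and an action and a coaction of `N` that satisfy the Yetter-Drinfeld
condition and are compatible with the action of `R`.

On the side of `H`, this holds because `H` is free over `R` on `N`: the unit of `R` induces `g : N ⟶
U H`, and the resulting comparison `N ⊗ M ⟶ H ⊗_R M` is invertible (`genInclIso`). Composing with it
turns actions and coactions of `H` into `R`-linear actions and coactions of `N`. On the side of `S`,
the action of `R` is instead required to be `N`-linear and `N`-colinear. Colinearity is literally
`R`-linearity of the coaction, and since the double braiding of `R` with `N` is trivial,
`N`-linearity is equivalent to `R`-linearity of the `N`-action (`lin_iff`). Locality agrees because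
the Yetter-Drinfeld braiding with `S` is, in both directions, the braiding of `C`.

The axioms are transported in a general setting: a lax braided functor `U` and a morphism `g : N ⟶ U
H` compatible with the bialgebra structures. `U` is only lax, since its tensorator is the projection
`M ⊗ M' ⟶ M ⊗_R M'`; what replaces strength is the invertibility of the comparison. The
Yetter-Drinfeld condition is not transported as a diagram. It is equivalent to linearity of the
half-braiding with the regular module (`Compat.half_lin`, `compat_of_half`), and half-braidings are
respected by `U` (`half_resAct`).

For the monoidal structure, both tensor products are coequalizers of the same pair, one formed in
Yetter-Drinfeld modules and the other in `C`. The functor from Yetter-Drinfeld modules to `C`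
preserves coequalizers, so the two are isomorphic compatibly with the projections (`tensCompIso`).
Linearity, colinearity and the braiding follow from `tAct_resAct`, `tCo_laxIncl` and `half_resAct`;
all the coherence identities are checked after composing with epimorphic projections. -/

namespace BraidedExtension

noncomputable section

/-! ### Restriction of actions and coactions along a lax braided functor -/

section LaxTransport

universe v₁ u₁ v₂ u₂

local notation "lμ" => Functor.LaxMonoidal.μ
local notation "lε" => Functor.LaxMonoidal.ε

variable {C : Type u₁} [Category.{v₁} C] [MonoidalCategory C] [BraidedCategory C]
  {D : Type u₂} [Category.{v₂} D] [MonoidalCategory D] [BraidedCategory D]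
  (U : D ⥤ C) [U.LaxBraided] {N : C} [HopfObj N] {H : D} [HopfObj H] (g : N ⟶ U.obj H)

/-- Compatibility of a morphism `g : N ⟶ U H` with the bialgebra structures of `N` and `H`, for a
lax braided functor `U`. -/
structure LaxBialgHom : Prop where
  one : η[N] ≫ g = lε U ≫ U.map η[H]
  mul : μ[N] ≫ g = (g ⊗ₘ g) ≫ lμ U H H ≫ U.map μ[H]
  counit : g ≫ U.map ε[H] = ε[N] ≫ lε U
  comul : g ≫ U.map Δ[H] = Δ[N] ≫ (g ⊗ₘ g) ≫ lμ U H H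

/-- The comparison morphism `N ⊗ U X ⟶ U (H ⊗ X)` induced by `g : N ⟶ U H`. -/
def laxIncl (X : D) : N ⊗ U.obj X ⟶ U.obj (H ⊗ X) := g ▷ U.obj X ≫ lμ U H X

/-- The restriction along `g : N ⟶ U H` of an action of `H` on `X`. -/
def resAct {X : D} (a : H ⊗ X ⟶ X) : N ⊗ U.obj X ⟶ U.obj X := laxIncl U g X ≫ U.map a

theorem laxIncl_nat {X Y : D} (f : X ⟶ Y) :
    laxIncl U g X ≫ U.map (H ◁ f) = N ◁ U.map f ≫ laxIncl U g Y := by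
  rw [laxIncl, Category.assoc, ← Functor.LaxMonoidal.μ_natural_right, laxIncl,
    whisker_exchange_assoc]

/-- Interchange puts `g` in front, leaving only tensorators of `U` behind it. In this form the
coherence of `U` with `tensorμ` applies. -/
theorem tensor_laxIncl (X Y : D) :
    N ◁ lμ U X Y ≫ laxIncl U g (X ⊗ Y) =
      g ▷ (U.obj X ⊗ U.obj Y) ≫ U.obj H ◁ lμ U X Y ≫ lμ U H (X ⊗ Y) := by
  rw [laxIncl, whisker_exchange_assoc]

/-- Associativity of the tensorator, with `g` inserted in both copies of `N`. It also makes the left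
side invertible whenever all comparisons `laxIncl` are, although its two factors need not be. -/
theorem laxIncl_assoc (X : D) :
    ((g ⊗ₘ g) ≫ lμ U H H) ▷ U.obj X ≫ lμ U (H ⊗ H) X =
      (α_ N N (U.obj X)).hom ≫ N ◁ laxIncl U g X ≫ laxIncl U g (H ⊗ X) ≫
        U.map (α_ H H X).inv := by
  rw [← cancel_mono (U.map (α_ H H X).hom)]
  simp only [Category.assoc, ← U.map_comp, Iso.inv_hom_id, U.map_id, Category.comp_id,
    comp_whiskerRight, Functor.LaxMonoidal.associativity]
  simp only [laxIncl, MonoidalCategory.tensorHom_def, comp_whiskerRight, whiskerLeft_comp,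
    Category.assoc, whisker_exchange_assoc]
  simp

/-- `lε U` itself need not be invertible (for local modules it is the unit of `R`), but left
unitality makes this composite invertible. This is enough to cancel it in the unit and counit laws.
-/
theorem unit_tensor_eq (X : D) :
    lε U ▷ U.obj X ≫ lμ U (𝟙_ D) X = (λ_ (U.obj X)).hom ≫ U.map (λ_ X).inv := by
  rw [Functor.LaxMonoidal.left_unitality, Category.assoc, Category.assoc, ← U.map_comp]
  simp

instance (X : D) : IsIso (lε U ▷ U.obj X ≫ lμ U (𝟙_ D) X) := by
  rw [unit_tensor_eq]; infer_instance

variable {U g}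

/-- This and the next two lemmas write the composites in the action axioms over `N` as a morphism
independent of `a`, followed by `U` of the corresponding composite over `H`. Axioms over `H` thus
give axioms over `N`, and conversely once that morphism is epi and `U` is faithful. -/
theorem one_resAct (hg : LaxBialgHom U g) {X : D} (a : H ⊗ X ⟶ X) :
    η[N] ▷ U.obj X ≫ resAct U g a =
      (lε U ▷ U.obj X ≫ lμ U (𝟙_ D) X) ≫ U.map (η[H] ▷ X ≫ a) := by
  rw [resAct, laxIncl, Category.assoc, ← comp_whiskerRight_assoc, hg.one, comp_whiskerRight]
  simp

theorem mul_resAct (hg : LaxBialgHom U g) {X : D} (a : H ⊗ X ⟶ X) :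
    μ[N] ▷ U.obj X ≫ resAct U g a =
      (((g ⊗ₘ g) ≫ lμ U H H) ▷ U.obj X ≫ lμ U (H ⊗ H) X) ≫ U.map (μ[H] ▷ X ≫ a) := by
  rw [resAct, laxIncl, Category.assoc, ← comp_whiskerRight_assoc, hg.mul]
  simp

theorem resAct_resAct {X : D} (a : H ⊗ X ⟶ X) :
    (α_ N N (U.obj X)).hom ≫ N ◁ resAct U g a ≫ resAct U g a =
      (((g ⊗ₘ g) ≫ lμ U H H) ▷ U.obj X ≫ lμ U (H ⊗ H) X) ≫
        U.map ((α_ H H X).hom ≫ H ◁ a ≫ a) := by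
  rw [laxIncl_assoc]
  simp only [Category.assoc, ← U.map_comp, Iso.inv_hom_id_assoc]
  rw [U.map_comp, reassoc_of% (laxIncl_nat U g a)]
  simp only [resAct, whiskerLeft_comp, Category.assoc]

theorem resAct_isAct (hg : LaxBialgHom U g) {X : D} {a : H ⊗ X ⟶ X} (ha : IsAct a) :
    IsAct (resAct U g a) where
  one := by rw [one_resAct hg, ha.one, unit_tensor_eq, Category.assoc, ← U.map_comp]; simp
  mul := by rw [mul_resAct hg, ha.mul, resAct_resAct]

theorem isAct_of_resAct (hg : LaxBialgHom U g) [U.Faithful] [∀ X : D, IsIso (laxIncl U g X)]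
    {X : D} {a : H ⊗ X ⟶ X} (ha : IsAct (resAct U g a)) : IsAct a where
  one := by
    apply U.map_injective
    rw [← cancel_epi (lε U ▷ U.obj X ≫ lμ U (𝟙_ D) X), ← one_resAct hg, ha.one, unit_tensor_eq,
      Category.assoc, ← U.map_comp]
    simp
  mul := by
    apply U.map_injective
    -- By `laxIncl_assoc` this is a composite of associators and comparisons, all invertible.
    have : IsIso (((g ⊗ₘ g) ≫ lμ U H H) ▷ U.obj X ≫ lμ U (H ⊗ H) X) := by
      rw [laxIncl_assoc]; infer_instance
    rw [← cancel_epi (((g ⊗ₘ g) ≫ lμ U H H) ▷ U.obj X ≫ lμ U (H ⊗ H) X), ← mul_resAct hg, ha.mul,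
      resAct_resAct]

/-! ### Coactions, tensor products and the Yetter-Drinfeld condition along a lax braided functor. -/

section Coaction

variable {X Y : D} {d : U.obj X ⟶ N ⊗ U.obj X} {d' : X ⟶ H ⊗ X}
  {e : U.obj Y ⟶ N ⊗ U.obj Y} {e' : Y ⟶ H ⊗ Y}

/-- A coaction cannot be restricted along `g` without inverting the comparison, so `d` and `d'` are
kept as separate data linked by `hd`. This lemma and the next two express `U` of each side of a
coaction law for `d'` through the same side for `d`. -/
theorem map_counit (hg : LaxBialgHom U g) (hd : d ≫ laxIncl U g X = U.map d') :
    U.map (d' ≫ ε[H] ▷ X) = d ≫ ε[N] ▷ U.obj X ≫ lε U ▷ U.obj X ≫ lμ U (𝟙_ D) X := by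
  rw [U.map_comp, ← hd, laxIncl, Category.assoc, Category.assoc,
    ← Functor.LaxMonoidal.μ_natural_left, ← comp_whiskerRight_assoc, hg.counit,
    comp_whiskerRight_assoc]

theorem map_comul (hg : LaxBialgHom U g) (hd : d ≫ laxIncl U g X = U.map d') :
    U.map (d' ≫ Δ[H] ▷ X) =
      (d ≫ Δ[N] ▷ U.obj X) ≫ ((g ⊗ₘ g) ≫ lμ U H H) ▷ U.obj X ≫ lμ U (H ⊗ H) X := by
  rw [U.map_comp, ← hd, laxIncl, Category.assoc, Category.assoc,
    ← Functor.LaxMonoidal.μ_natural_left, ← comp_whiskerRight_assoc, hg.comul,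
    comp_whiskerRight_assoc, Category.assoc]

theorem map_coact_coact (hd : d ≫ laxIncl U g X = U.map d') :
    U.map (d' ≫ H ◁ d' ≫ (α_ H H X).inv) =
      (d ≫ N ◁ d ≫ (α_ N N (U.obj X)).inv) ≫
        ((g ⊗ₘ g) ≫ lμ U H H) ▷ U.obj X ≫ lμ U (H ⊗ H) X := by
  rw [laxIncl_assoc, U.map_comp, U.map_comp, ← hd, Category.assoc,
    reassoc_of% (laxIncl_nat U g d'), ← hd]
  simp

/-- In this direction the two-fold comparison has to be cancelled on the right, hence the
invertibility assumption; in the other direction faithfulness of `U` suffices. -/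
theorem isCoact_of_map (hg : LaxBialgHom U g) [∀ X : D, IsIso (laxIncl U g X)]
    (hd : d ≫ laxIncl U g X = U.map d') (h : IsCoact d') : IsCoact d where
  counit := by
    rw [← cancel_mono (lε U ▷ U.obj X ≫ lμ U (𝟙_ D) X), Category.assoc, ← map_counit hg hd,
      h.counit, unit_tensor_eq, Iso.inv_hom_id_assoc]
  comul := by
    have : IsIso (((g ⊗ₘ g) ≫ lμ U H H) ▷ U.obj X ≫ lμ U (H ⊗ H) X) := by
      rw [laxIncl_assoc]; infer_instance
    rw [← cancel_mono (((g ⊗ₘ g) ≫ lμ U H H) ▷ U.obj X ≫ lμ U (H ⊗ H) X), ← map_comul hg hd,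
      ← map_coact_coact hd, h.comul]

theorem map_isCoact (hg : LaxBialgHom U g) [U.Faithful]
    (hd : d ≫ laxIncl U g X = U.map d') (h : IsCoact d) : IsCoact d' where
  counit := by
    apply U.map_injective
    rw [map_counit hg hd, reassoc_of% h.counit, unit_tensor_eq, Iso.inv_hom_id_assoc]
  comul := by
    apply U.map_injective
    rw [map_comul hg hd, map_coact_coact hd, h.comul]

/-- The tensorator of `U` is `N`-linear for the diagonal actions. Comultiplicativity of `g` splits
`g` into `g ⊗ g`, which passes through `tensorμ` by naturality (`h1`); a lax braided functor
commutes with `tensorμ` (`h`). -/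
theorem tAct_resAct (hg : LaxBialgHom U g) (a : H ⊗ X ⟶ X) (b : H ⊗ Y ⟶ Y) :
    tAct (resAct U g a) (resAct U g b) ≫ lμ U X Y = N ◁ lμ U X Y ≫ resAct U g (tAct a b) := by
  have h := tensorμ_comp_μ_tensorHom_μ_comp_μ U H H X Y
  have h1 := tensorμ_natural_left g g (U.obj X) (U.obj Y)
  symm
  calc _ = (g ≫ U.map Δ[H]) ▷ (U.obj X ⊗ U.obj Y) ≫ U.obj (H ⊗ H) ◁ lμ U X Y ≫
        lμ U (H ⊗ H) (X ⊗ Y) ≫ U.map (tensorμ H H X Y) ≫ U.map (a ⊗ₘ b) := by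
        rw [resAct, tAct, reassoc_of% (tensor_laxIncl U g X Y), U.map_comp, U.map_comp,
          ← Functor.LaxMonoidal.μ_natural_left_assoc, whisker_exchange_assoc,
          comp_whiskerRight_assoc]
    _ = Δ[N] ▷ (U.obj X ⊗ U.obj Y) ≫ (g ⊗ₘ g) ▷ _ ≫ (lμ U H H ⊗ₘ lμ U X Y) ≫
        lμ U (H ⊗ H) (X ⊗ Y) ≫ U.map (tensorμ H H X Y) ≫ U.map (a ⊗ₘ b) := by
        rw [hg.comul, MonoidalCategory.tensorHom_def (lμ U H H)]
        simp only [comp_whiskerRight, Category.assoc]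
    _ = Δ[N] ▷ (U.obj X ⊗ U.obj Y) ≫ tensorμ N N (U.obj X) (U.obj Y) ≫
        (g ▷ U.obj X ⊗ₘ g ▷ U.obj Y) ≫ (lμ U H X ⊗ₘ lμ U H Y) ≫
        (U.map a ⊗ₘ U.map b) ≫ lμ U X Y := by
        rw [← reassoc_of% h, reassoc_of% h1, Functor.LaxMonoidal.μ_natural]
    _ = _ := by
        simp only [MonoidalCategory.tensorHom_comp_tensorHom_assoc, tAct, resAct, laxIncl,
          Category.assoc]

/-- The dual of `tAct_resAct`: the tensorator is compatible with codiagonal coactions, with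
multiplicativity of `g` in place of comultiplicativity. -/
theorem tCo_laxIncl (hg : LaxBialgHom U g) (hd : d ≫ laxIncl U g X = U.map d')
    (he : e ≫ laxIncl U g Y = U.map e') :
    tCo d e ≫ N ◁ lμ U X Y ≫ laxIncl U g (X ⊗ Y) = lμ U X Y ≫ U.map (tCo d' e') := by
  have h := tensorμ_comp_μ_tensorHom_μ_comp_μ U H X H Y
  have h1 := tensorμ_natural g (𝟙 (U.obj X)) g (𝟙 (U.obj Y))
  rw [MonoidalCategory.id_tensorHom_id] at h1
  simp only [MonoidalCategory.tensorHom_id] at h1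
  calc _ = (d ⊗ₘ e) ≫ tensorμ _ _ _ _ ≫ (μ[N] ≫ g) ▷ (U.obj X ⊗ U.obj Y) ≫
        U.obj H ◁ lμ U X Y ≫ lμ U H (X ⊗ Y) := by
        rw [tensor_laxIncl, tCo]; simp only [comp_whiskerRight, Category.assoc]
    _ = (d ⊗ₘ e) ≫ tensorμ _ _ _ _ ≫ (g ⊗ₘ g) ▷ (U.obj X ⊗ U.obj Y) ≫
        (lμ U H H ⊗ₘ lμ U X Y) ≫ lμ U (H ⊗ H) (X ⊗ Y) ≫ U.map (μ[H] ▷ (X ⊗ Y)) := by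
        rw [hg.mul, MonoidalCategory.tensorHom_def (lμ U H H)]
        simp only [comp_whiskerRight, Category.assoc, ← Functor.LaxMonoidal.μ_natural_left,
          whisker_exchange_assoc]
    _ = ((d ≫ g ▷ _ ≫ lμ U H X) ⊗ₘ (e ≫ g ▷ _ ≫ lμ U H Y)) ≫ lμ U (H ⊗ X) (H ⊗ Y) ≫
        U.map (tensorμ H X H Y) ≫ U.map (μ[H] ▷ (X ⊗ Y)) := by
        rw [← reassoc_of% h1, reassoc_of% h]
        simp only [MonoidalCategory.tensorHom_comp_tensorHom_assoc]
    _ = _ := by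
        have hd' : d ≫ g ▷ _ ≫ lμ U H X = U.map d' := hd
        have he' : e ≫ g ▷ _ ≫ lμ U H Y = U.map e' := he
        rw [hd', he', Functor.LaxMonoidal.μ_natural_assoc, tCo, U.map_comp, U.map_comp]

/-- A half-braiding coacts, braids and acts, and the tensorator passes through each of the three.
This carries both the Yetter-Drinfeld condition and, later, the braiding of the comparison functor.
-/
theorem half_resAct (hd : d ≫ laxIncl U g X = U.map d') (b : H ⊗ Y ⟶ Y) :
    half d (resAct U g b) ≫ lμ U Y X = lμ U X Y ≫ U.map (half d' b) := by
  have hd' : d ≫ g ▷ _ ≫ lμ U H X = U.map d' := hd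
  calc _ = 𝟙 _ ⊗≫ d ▷ U.obj Y ⊗≫ (N ◁ (β_ (U.obj X) (U.obj Y)).hom ≫ g ▷ (U.obj Y ⊗ U.obj X)) ⊗≫
        (lμ U H Y ≫ U.map b) ▷ U.obj X ≫ lμ U Y X := by
        simp only [half, resAct, laxIncl]; monoidal
    _ = (d ≫ g ▷ _) ▷ U.obj Y ≫ (α_ _ _ _).hom ≫ U.obj H ◁ (β_ (U.obj X) (U.obj Y)).hom ≫
        (α_ _ _ _).inv ≫ lμ U H Y ▷ U.obj X ≫ lμ U (H ⊗ Y) X ≫ U.map (b ▷ X) := by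
        rw [whisker_exchange, comp_whiskerRight, Category.assoc,
          Functor.LaxMonoidal.μ_natural_left]; monoidal
    _ = (d ≫ g ▷ _) ▷ U.obj Y ≫ (α_ _ _ _).hom ≫
        U.obj H ◁ ((β_ (U.obj X) (U.obj Y)).hom ≫ lμ U Y X) ≫
        lμ U H (Y ⊗ X) ≫ U.map (α_ H Y X).inv ≫ U.map (b ▷ X) := by
        rw [whiskerLeft_comp_assoc, ← Functor.LaxMonoidal.associativity_inv_assoc]
    _ = (d ≫ g ▷ _) ▷ U.obj Y ≫ (α_ _ _ _).hom ≫ U.obj H ◁ lμ U X Y ≫ lμ U H (X ⊗ Y) ≫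
        U.map (H ◁ (β_ X Y).hom) ≫ U.map (α_ H Y X).inv ≫ U.map (b ▷ X) := by
        -- Here the braiding of `C` is exchanged for that of `D`, since `U` is lax braided.
        rw [← Functor.LaxBraided.braided, whiskerLeft_comp_assoc,
          Functor.LaxMonoidal.μ_natural_right_assoc]
    _ = (d ≫ g ▷ _ ≫ lμ U H X) ▷ U.obj Y ≫ lμ U (H ⊗ X) Y ≫ U.map (α_ H X Y).hom ≫
        U.map (H ◁ (β_ X Y).hom) ≫ U.map (α_ H Y X).inv ≫ U.map (b ▷ X) := by
        rw [← Functor.LaxMonoidal.associativity_assoc]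
        simp only [comp_whiskerRight, Category.assoc]
    _ = _ := by
        rw [hd', Functor.LaxMonoidal.μ_natural_left_assoc, half]
        simp only [U.map_comp]

/-- By `compat_of_half` it is enough that the half-braiding with the regular `N`-module is
`N`-linear. Linearity of the half-braiding with the regular `H`-module gives this with `U H` in
place of `N`, and `g` relates the two. -/
theorem compat_of_map (hg : LaxBialgHom U g) [∀ X : D, IsIso (laxIncl U g X)] {a : H ⊗ X ⟶ X}
    (hd : d ≫ laxIncl U g X = U.map d') (h : Compat a d') : Compat (resAct U g a) d := by
  apply compat_of_half
  -- `g` is `N`-linear from the regular `N`-module to the restriction of the regular `H`-module, so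
  -- diagonal actions and half-braidings are natural along it.
  have hn : μ[N] ≫ g = N ◁ g ≫ resAct U g μ[H] := by
    rw [hg.mul, resAct, laxIncl, MonoidalCategory.tensorHom_def']; simp only [Category.assoc]
  have e1 := tAct_nat (𝟙 (U.obj X)) g (by simp : resAct U g a ≫ 𝟙 _ = _ ≫ resAct U g a) hn
  have e2 := tAct_nat g (𝟙 (U.obj X)) hn (by simp : resAct U g a ≫ 𝟙 _ = _ ≫ resAct U g a)
  have e3 := half_natR d g hn
  rw [MonoidalCategory.id_tensorHom] at e1
  rw [MonoidalCategory.tensorHom_id] at e2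
  have h1 := half_resAct hd μ[H]
  have h2 := congrArg U.map (h.half_lin mul_isAct)
  rw [U.map_comp, U.map_comp] at h2
  have h3 : tAct (resAct U g a) (resAct U g μ[H]) ≫ half d (resAct U g μ[H]) ≫ lμ U H X =
      N ◁ half d (resAct U g μ[H]) ≫ tAct (resAct U g μ[H]) (resAct U g a) ≫ lμ U H X := by
    rw [h1, reassoc_of% (tAct_resAct hg a μ[H]), tAct_resAct hg, ← whiskerLeft_comp_assoc, h1,
      resAct, resAct, Category.assoc, h2, whiskerLeft_comp_assoc, reassoc_of% (laxIncl_nat U g)]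
  -- The comparison is `g` whiskered with `U X`, followed by the tensorator: composing with it
  -- replaces `N` by `U H`, where `h3` applies.
  rw [← cancel_mono (laxIncl U g X)]
  rw [laxIncl, Category.assoc, Category.assoc, reassoc_of% e3, reassoc_of% e1, h3,
    ← whiskerLeft_comp_assoc, ← e3, whiskerLeft_comp_assoc, reassoc_of% e2]

/-- For the converse, the half-braiding over `N` is tested on the `N`-module `U H`, which
`Compat.half_lin` allows. The resulting identity lives on `N ⊗ (U X ⊗ U H)`; it descends because the
tensorator stays epi after tensoring with `N`. -/
theorem map_compat (hg : LaxBialgHom U g) [U.Faithful] [∀ X : D, IsIso (laxIncl U g X)]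
    [∀ X Y : D, Epi (N ◁ lμ U X Y)] {a : H ⊗ X ⟶ X}
    (hd : d ≫ laxIncl U g X = U.map d') (h : Compat (resAct U g a) d) : Compat a d' := by
  apply compat_of_half
  apply U.map_injective
  have h1 := half_resAct hd μ[H]
  have h2 := h.half_lin (resAct_isAct hg mul_isAct)
  rw [← cancel_epi (N ◁ lμ U X H ≫ laxIncl U g (X ⊗ H)), U.map_comp, U.map_comp, Category.assoc,
    Category.assoc, reassoc_of% (laxIncl_nat U g), ← whiskerLeft_comp_assoc, ← h1]
  have h3 := tAct_resAct hg a μ[H]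
  have h4 := tAct_resAct hg μ[H] a
  -- Only the outer restriction is unfolded, to expose `U.map` of the diagonal action; the
  -- restrictions of `a` and `μ[H]` must stay folded to match `h2`.
  rw [resAct.eq_1 U g (tAct _ _)] at h3 h4
  rw [← reassoc_of% h3, whiskerLeft_comp_assoc, ← h4, ← h1, reassoc_of% h2]

end Coaction

/-- Trivial structures over `H` correspond to trivial structures over `N`. This and the next lemma
are what the unit constraint of the comparison functor needs. -/
theorem resAct_trAct (hg : LaxBialgHom U g) (X : D) :
    resAct U g (trAct X) = trAct (U.obj X) := by
  rw [resAct, laxIncl, trAct, U.map_comp, Category.assoc,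
    ← Functor.LaxMonoidal.μ_natural_left_assoc, ← comp_whiskerRight_assoc, hg.counit,
    comp_whiskerRight_assoc, ← Functor.LaxMonoidal.left_unitality, trAct]

theorem trCo_laxIncl (hg : LaxBialgHom U g) (X : D) :
    trCo (U.obj X) ≫ laxIncl U g X = U.map (trCo X) := by
  rw [laxIncl, trCo, trCo, U.map_comp, Category.assoc, ← comp_whiskerRight_assoc, hg.one,
    comp_whiskerRight_assoc, Functor.LaxMonoidal.μ_natural_left,
    Functor.LaxMonoidal.left_unitality_inv_assoc]

end LaxTransport

/-! ### The forgetful functor of local modules -/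

namespace LocalModule

section ForgetLax

variable {C : Type u} [Category.{v} C] [MonoidalCategory C] [BraidedCategory C]
  [HasCoequalizers C] [∀ X : C, PreservesColimitsOfShape WalkingParallelPair (tensorLeft X)]
  {R : C} [MonObj R]

instance : (forget R).Faithful where
  map_injective h := hom_ext h

variable [IsCommMonObj R]

/-- The forgetful functor from local modules is lax braided, with the projections to the relative
tensor products as tensorator. -/
instance : (forget R).LaxBraided where
  toLaxMonoidal := ⟨un R, pr, fun f N => (pr_whiskerRight f N).symm,
    fun M g => (pr_whiskerLeft M g).symm, pr_associator, fun M => (pr_leftUnitor M).symm,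
    fun M => (pr_rightUnitor M).symm⟩
  braided := pr_braiding

/-- The tensorator is the projection to a coequalizer, and tensoring preserves coequalizers. This is
the epimorphism assumption of `map_compat`. -/
instance (Z : C) (M P : LocalModule R) : Epi (Z ◁ Functor.LaxMonoidal.μ (forget R) M P) :=
  inferInstanceAs (Epi (Z ◁ pr M P))

end ForgetLax

/-! ### The `R`-module structure on `N ⊗ X` through the braiding. -/

section ActR

variable {C : Type u} [Category.{v} C] [MonoidalCategory C] [BraidedCategory C]
  {R : C} [MonObj R]

theorem actR_one (N X : C) [ModObj R X] :
    η[R] ▷ (N ⊗ X) ≫ actR N (act R X) = (λ_ (N ⊗ X)).hom := by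
  calc _ = 𝟙 _ ⊗≫ (η[R] ▷ N ≫ (β_ R N).hom) ▷ X ⊗≫ N ◁ act R X := by rw [actR]; monoidal
    _ = 𝟙 _ ⊗≫ N ◁ (η[R] ▷ X ≫ act R X) := by
        rw [BraidedCategory.braiding_naturality_left, braiding_tensorUnit_left]; monoidal
    _ = _ := by rw [one_act]; monoidal

/-- Two successive crossings of `R` with `N` form one crossing of `R ⊗ R`, by the hexagon, and
`μ[R]` slides through it by naturality. -/
theorem actR_mul (N X : C) [ModObj R X] :
    μ[R] ▷ (N ⊗ X) ≫ actR N (act R X) =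
      (α_ R R (N ⊗ X)).hom ≫ R ◁ actR N (act R X) ≫ actR N (act R X) := by
  symm
  calc _ = 𝟙 _ ⊗≫ R ◁ (β_ R N).hom ▷ X ⊗≫ (R ◁ (N ◁ act R X) ≫ (α_ R N X).inv ≫
        (β_ R N).hom ▷ X) ⊗≫ N ◁ act R X := by simp only [actR]; monoidal
    _ = 𝟙 _ ⊗≫ R ◁ (β_ R N).hom ▷ X ⊗≫ ((R ⊗ N) ◁ act R X ≫ (β_ R N).hom ▷ X) ⊗≫
        N ◁ act R X := by monoidal
    _ = 𝟙 _ ⊗≫ (β_ (R ⊗ R) N).hom ▷ X ⊗≫ N ◁ ((α_ R R X).hom ≫ R ◁ act R X ≫ act R X) := by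
        rw [whisker_exchange, BraidedCategory.braiding_tensor_left_hom]; monoidal
    _ = 𝟙 _ ⊗≫ ((β_ (R ⊗ R) N).hom ≫ N ◁ μ[R]) ▷ X ⊗≫ N ◁ act R X := by
        rw [← mul_act]; monoidal
    _ = _ := by rw [← BraidedCategory.braiding_naturality_left, actR]; monoidal

end ActR

/-! ### Relative tensor products with a free module. -/

section Free

variable {C : Type u} [Category.{v} C] [MonoidalCategory C] [BraidedCategory C]
  [HasCoequalizers C] [∀ X : C, PreservesColimitsOfShape WalkingParallelPair (tensorLeft X)]
  {R : C} [MonObj R] [IsCommMonObj R]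

/-- Up to associators this is the statement that the action `R ⊗ (N ⊗ X) ⟶ N ⊗ X` is balanced, which
holds for every module over a commutative algebra. It defines the inverse of `genIncl` on the
coequalizer. -/
theorem actR_balanced (N X : C) [ModObj R X] :
    actL (actL μ[R] N) X ≫ (α_ R N X).hom ≫ actR N (act R X) =
      actR (R ⊗ N) (act R X) ≫ (α_ R N X).hom ≫ actR N (act R X) := by
  letI := modOf (actR N (act R X)) (actR_one N X) (actR_mul N X)
  have h1 := act_aux₁ (A := R) (N ⊗ X)
  have h2 := act_aux₂ (A := R) (N ⊗ X)
  change actL μ[R] (N ⊗ X) ≫ actR N (act R X) = _ ≫ actR N (act R X) at h1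
  change actR R (actR N (act R X)) ≫ actR N (act R X) = _ ≫ actR N (act R X) at h2
  rw [reassoc_of% (actL_actL_assoc μ[R] N X), reassoc_of% (actR_actR_assoc R N (act R X)), h1, h2]

/-- The morphism `X ⊗ M ⟶ (R ⊗ X) ⊗_R M`. -/
def genIncl (X : (centralizer R).FullSubcategory) (M : LocalModule R) :
    X.obj ⊗ M.X ⟶ (free X ⊗ M).X := gen X ▷ M.X ≫ pr (free X) M

/-- On a relative tensor product `R` may act through the second factor, where `gen X` does not
interfere. Hence `genIncl` is `R`-linear for the braided action on `X ⊗ M`. -/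
theorem genIncl_act (X : (centralizer R).FullSubcategory) (M : LocalModule R) :
    R ◁ genIncl X M ≫ act R (free X ⊗ M).X = actR X.obj (act R M.X) ≫ genIncl X M := by
  have h := actR_nat (b := act R M.X) (b' := act R M.X) (gen X) (𝟙 M.X) (by simp)
  rw [MonoidalCategory.tensorHom_id] at h
  rw [genIncl, whiskerLeft_comp_assoc, pr_act', ← reassoc_of% h]

/-- Letting `R` act through the first factor instead, `gen X` generates all of `R ⊗ X`, so the whole
projection is recovered. -/
theorem genIncl_act_pr (X : (centralizer R).FullSubcategory) (M : LocalModule R) :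
    R ◁ genIncl X M ≫ act R (free X ⊗ M).X =
      (α_ R X.obj M.X).inv ≫ pr (free X) M := by
  calc _ = 𝟙 _ ⊗≫ (R ◁ gen X ≫ act R (free X).X) ▷ M.X ≫ pr (free X) M := by
        rw [genIncl, whiskerLeft_comp_assoc, pr_act, actL]; monoidal
    _ = _ := by rw [gen_act]; monoidal

/-- The inverse of `genIncl`. -/
def genInclInv (X : (centralizer R).FullSubcategory) (M : LocalModule R) :
    (free X ⊗ M).X ⟶ X.obj ⊗ M.X :=
  tensDescHom (M := free X) (N := M) ((α_ R X.obj M.X).hom ≫ actR X.obj (act R M.X))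
    (actR_balanced X.obj M.X)

theorem pr_genInclInv (X : (centralizer R).FullSubcategory) (M : LocalModule R) :
    pr (free X) M ≫ genInclInv X M = (α_ R X.obj M.X).hom ≫ actR X.obj (act R M.X) :=
  proj_tensDescHom (M := free X) (N := M) _ _

/-- The relative tensor product with the free module `R ⊗ X` is the tensor product with `X`. -/
def genInclIso (X : (centralizer R).FullSubcategory) (M : LocalModule R) :
    X.obj ⊗ M.X ≅ (free X ⊗ M).X where
  hom := genIncl X M
  inv := genInclInv X M
  hom_inv_id := by
    rw [genIncl, Category.assoc, pr_genInclInv]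
    calc _ = (λ_ (X.obj ⊗ M.X)).inv ≫ η[R] ▷ (X.obj ⊗ M.X) ≫ actR X.obj (act R M.X) := by
          rw [gen]; monoidal
      _ = _ := by rw [actR_one]; simp
  inv_hom_id := by
    rw [← cancel_epi (pr (free X) M), reassoc_of% (pr_genInclInv X M)]
    refine (Category.assoc _ _ _).trans ?_
    -- Comparing the actions through the two factors shows that `genInclInv` followed by `genIncl`
    -- fixes the projection.
    rw [← genIncl_act, genIncl_act_pr]
    exact (Iso.hom_inv_id_assoc _ _).trans (Category.comp_id _).symm

instance (X : (centralizer R).FullSubcategory) (M : LocalModule R) : IsIso (genIncl X M) :=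
  (genInclIso X M).isIso_hom

end Free

end LocalModule

/-! ### The morphism from `N` to the induced Hopf algebra. -/

section Gen

variable {C : Type u} [Category.{v} C] [MonoidalCategory C] [BraidedCategory C]
  [HasCoequalizers C] [∀ X : C, PreservesColimitsOfShape WalkingParallelPair (tensorLeft X)]
  (R N : C) [MonObj R] [IsCommMonObj R] [HopfObj N]
  (h : (β_ R N).hom ≫ (β_ N R).hom = 𝟙 (R ⊗ N))

/-- The inclusion of `N` in the induced Hopf algebra `R ⊗ N`. -/
def genN : N ⟶ (LocalModule.forget R).obj (indLoc R N h) :=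
  LocalModule.gen (inCentralizer R N h)

/-- The structure morphisms of `R ⊗ N` are those of `N` under induction, composed with the
constraints of the induction functor. `gen` is natural for the former, and the latter send
generators to generators. -/
theorem genN_bialg : LaxBialgHom (LocalModule.forget R) (genN R N h) where
  one := by
    have h1 := LocalModule.gen_map (R := R) η[inCentralizer R N h]
    have h2 := LocalModule.un_freeUnit (R := R)
    change _ = LocalModule.un R ≫ (LocalModule.freeUnit.hom.hom ≫
      (LocalModule.freeMap η[inCentralizer R N h]).hom)
    rw [reassoc_of% h2]
    exact h1.symm
  mul := by
    have h1 := LocalModule.gen_map (R := R) μ[inCentralizer R N h]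
    have h2 := LocalModule.gen_gen_freeHom (inCentralizer R N h) (inCentralizer R N h)
    change _ = (LocalModule.gen (inCentralizer R N h) ⊗ₘ LocalModule.gen (inCentralizer R N h)) ≫
      LocalModule.pr _ _ ≫ (LocalModule.freeHom _ _).hom ≫
        (LocalModule.freeMap μ[inCentralizer R N h]).hom
    rw [reassoc_of% h2]
    exact h1.symm
  counit := by
    have h1 := LocalModule.gen_map (R := R) ε[inCentralizer R N h]
    have h2 := LocalModule.un_freeUnit (R := R)
    -- The counit ends with the inverse unit constraint; writing the generator of the free module on
    -- the unit as `un R` followed by the constraint cancels it.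
    change LocalModule.gen (inCentralizer R N h) ≫
      (LocalModule.freeMap ε[inCentralizer R N h]).hom ≫ LocalModule.freeUnit.inv.hom = _
    rw [reassoc_of% h1, ← h2, Category.assoc, ← LocalModule.comp_hom, Iso.hom_inv_id]
    exact congrArg (ε[N] ≫ ·) (Category.comp_id _)
  comul := by
    have h1 := LocalModule.gen_map (R := R) Δ[inCentralizer R N h]
    have h2 := LocalModule.gen_lift
      (LocalModule.gen₂ (inCentralizer R N h) (inCentralizer R N h))
    -- The inverse tensorator of induction is by definition the linear extension of `gen₂`, so its
    -- value on generators is immediate.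
    change LocalModule.gen (inCentralizer R N h) ≫
      (LocalModule.freeMap Δ[inCentralizer R N h]).hom ≫
        (LocalModule.lift (LocalModule.gen₂ _ _)).hom = _
    rw [reassoc_of% h1, h2]
    rfl

/-- Freeness of `R ⊗ N` over `R` enters here, as the invertibility assumption of the transport
lemmas. -/
instance (M : LocalModule R) : IsIso (laxIncl (LocalModule.forget R) (genN R N h) M) :=
  inferInstanceAs (IsIso (LocalModule.genIncl (inCentralizer R N h) M))

/-- The comparison `N ⊗ M ⟶ (R ⊗ N) ⊗_R M`. -/
def incl (M : LocalModule R) : N ⊗ M.X ⟶ (indLoc R N h ⊗ M).X :=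
  laxIncl (LocalModule.forget R) (genN R N h) M

instance (M : LocalModule R) : IsIso (incl R N h M) :=
  inferInstanceAs (IsIso (laxIncl (LocalModule.forget R) (genN R N h) M))

theorem incl_act (M : LocalModule R) :
    R ◁ incl R N h M ≫ act R (indLoc R N h ⊗ M).X = actR N (act R M.X) ≫ incl R N h M :=
  LocalModule.genIncl_act (inCentralizer R N h) M

theorem incl_nat {M P : LocalModule R} (f : M ⟶ P) :
    incl R N h M ≫ (indLoc R N h ◁ f).hom = N ◁ f.hom ≫ incl R N h P :=
  laxIncl_nat (LocalModule.forget R) (genN R N h) f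

variable {R N h} in
/-- The action of `N` on a module over the induced Hopf algebra. -/
def nAct {M : LocalModule R} (a : indLoc R N h ⊗ M ⟶ M) : N ⊗ M.X ⟶ M.X :=
  incl R N h M ≫ a.hom

end Gen

/-! ### Half-braidings with trivial coaction or trivial action. -/

section HalfTrivial

variable {C : Type u} [Category.{v} C] [MonoidalCategory C] [BraidedCategory C]
  {N : C} [HopfObj N]

/-- A trivial coaction makes only the unit of `N` act. Together with the next lemma, this shows that
braiding with the trivial algebra in either order is the braiding of `C`, so locality over it is
locality over `R`. -/
theorem half_trCo (X : C) {Y : C} {b : N ⊗ Y ⟶ Y} (hb : IsAct b) :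
    half (trCo X) b = (β_ X Y).hom := by
  calc _ = 𝟙 _ ⊗≫ (η[N] ▷ (X ⊗ Y) ≫ N ◁ (β_ X Y).hom) ⊗≫ b ▷ X := by
        rw [half, trCo]; monoidal
    _ = 𝟙 _ ⊗≫ (β_ X Y).hom ⊗≫ (η[N] ▷ Y ≫ b) ▷ X := by
        rw [← whisker_exchange]; monoidal
    _ = _ := by rw [hb.one]; monoidal

theorem half_trAct_right {X : C} {d : X ⟶ N ⊗ X} (hd : IsCoact d) (Y : C) :
    half d (trAct Y) = (β_ X Y).hom := by
  calc _ = 𝟙 _ ⊗≫ d ▷ Y ⊗≫ (N ◁ (β_ X Y).hom ≫ ε[N] ▷ (Y ⊗ X)) ⊗≫ 𝟙 _ := by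
        rw [half, trAct]; monoidal
    _ = 𝟙 _ ⊗≫ (d ≫ ε[N] ▷ X) ▷ Y ⊗≫ (β_ X Y).hom := by
        rw [whisker_exchange]; monoidal
    _ = _ := by rw [hd.counit]; monoidal

end HalfTrivial

/-! ### Comparison of the two categories -/

section Comparison

variable {C : Type u} [Category.{v} C] [MonoidalCategory C] [BraidedCategory C]
  {N : C} [HopfObj N] [IsIso 𝒮[N]] {R : C} [MonObj R] [IsCommMonObj R]
  {h : (β_ R N).hom ≫ (β_ N R).hom = 𝟙 (R ⊗ N)}

/-- The action of `R` on the underlying object of a local module in Yetter-Drinfeld modules. -/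
def ract (V : LocalModule (YD.triv N R h)) : R ⊗ V.X.X ⟶ V.X.X := (act (YD.triv N R h) V.X).hom

theorem ract_one (V : LocalModule (YD.triv N R h)) :
    η[R] ▷ V.X.X ≫ ract V = (λ_ V.X.X).hom := by
  have h1 := congrArg YD.Hom.hom (one_act (YD.triv N R h) V.X)
  -- Whiskering of Yetter-Drinfeld modules is defined as tensoring with an identity, so its
  -- underlying morphism has to be rewritten before the definitional comparison.
  rw [YD.comp_hom, YD.whiskerRight_hom] at h1
  exact h1

theorem ract_mul (V : LocalModule (YD.triv N R h)) :
    μ[R] ▷ V.X.X ≫ ract V = (α_ R R V.X.X).hom ≫ R ◁ ract V ≫ ract V := by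
  have h1 := congrArg YD.Hom.hom (mul_act (YD.triv N R h) V.X)
  rw [YD.comp_hom, YD.whiskerRight_hom, YD.comp_hom, YD.comp_hom, YD.whiskerLeft_hom] at h1
  exact h1

theorem braiding_triv (V : YD N) : (β_ (YD.triv N R h) V).hom.hom = (β_ R V.X).hom :=
  half_trCo R V.isAct

theorem braiding_triv' (V : YD N) : (β_ V (YD.triv N R h)).hom.hom = (β_ V.X R).hom :=
  half_trAct_right V.isCoact R

theorem ract_loc (V : LocalModule (YD.triv N R h)) :
    (β_ R V.X.X).hom ≫ (β_ V.X.X R).hom ≫ ract V = ract V := by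
  have h1 := congrArg YD.Hom.hom V.loc
  rw [YD.comp_hom, YD.comp_hom, braiding_triv, braiding_triv'] at h1
  exact h1

/-- The local module in the ambient category underlying a local module in Yetter-Drinfeld
modules. -/
def under (V : LocalModule (YD.triv N R h)) : LocalModule R :=
  letI := LocalModule.modOf (ract V) (ract_one V) (ract_mul V)
  { X := V.X.X
    loc := ract_loc V }

/-- An action of `N` is linear over `R` if and only if the action of `R` is linear over `N`, when
`R` and `N` have trivial double braiding. -/
theorem lin_iff (h : (β_ R N).hom ≫ (β_ N R).hom = 𝟙 (R ⊗ N)) {X : C} (a : N ⊗ X ⟶ X)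
    (r : R ⊗ X ⟶ X) : actR R a ≫ r = N ◁ r ≫ a ↔ actR N r ≫ a = R ◁ a ≫ r := by
  have h' : (β_ N R).hom ≫ (β_ R N).hom = 𝟙 _ := by
    rw [← cancel_epi (β_ R N).hom, reassoc_of% h, Category.comp_id]
  -- The argument is symmetric in the two acting objects, so it is given once and used in both
  -- orders. The crossings in the two occurrences of `actR` form a double braiding, which is
  -- trivial.
  have key : ∀ {A B : C} (_ : (β_ A B).hom ≫ (β_ B A).hom = 𝟙 _) (a : B ⊗ X ⟶ X)
      (r : A ⊗ X ⟶ X), actR A a ≫ r = B ◁ r ≫ a → actR B r ≫ a = A ◁ a ≫ r := by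
    intro A B hAB a r hr
    calc _ = (α_ A B X).inv ≫ (β_ A B).hom ▷ X ≫ (α_ B A X).hom ≫ B ◁ r ≫ a := by simp [actR]
      _ = (α_ A B X).inv ≫ ((β_ A B).hom ≫ (β_ B A).hom) ▷ X ≫ (α_ A B X).hom ≫ A ◁ a ≫ r := by
        rw [← hr, actR]; simp
      _ = _ := by rw [hAB]; simp
  exact ⟨key h a r, key h' r a⟩

variable [HasCoequalizers C] [∀ X : C, PreservesColimitsOfShape WalkingParallelPair (tensorLeft X)]

/-- The action of `N`, on the underlying local module. -/
def uAct (V : LocalModule (YD.triv N R h)) : N ⊗ (under V).X ⟶ (under V).X := V.X.a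

/-- The coaction of `N`, on the underlying local module. -/
def uCo (V : LocalModule (YD.triv N R h)) : (under V).X ⟶ N ⊗ (under V).X := V.X.d

/-- The action of the trivial algebra is a morphism of Yetter-Drinfeld modules, hence `N`-linear;
`lin_iff` turns this around. -/
theorem uAct_lin (V : LocalModule (YD.triv N R h)) :
    actR N (act R (under V).X) ≫ uAct V = R ◁ uAct V ≫ act R (under V).X := by
  rw [← lin_iff h, ← tAct_trAct_left]
  exact (act (YD.triv N R h) V.X).lin

/-- Unlike for the action, nothing has to be turned around: both the codiagonal coaction and `actR`
move `R` past `N` by the same braiding. -/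
theorem uCo_lin (V : LocalModule (YD.triv N R h)) :
    act R (under V).X ≫ uCo V = R ◁ uCo V ≫ actR N (act R (under V).X) := by
  have h1 : tCo (trCo R) (uCo V) ≫ N ◁ act R (under V).X = act R (under V).X ≫ uCo V :=
    (act (YD.triv N R h) V.X).colin
  rw [← h1, tCo_trCo_left, actR]
  simp only [Category.assoc]

/-- The action of the induced Hopf algebra. -/
def indAct (V : LocalModule (YD.triv N R h)) : indLoc R N h ⊗ under V ⟶ under V where
  hom := inv (incl R N h (under V)) ≫ uAct V
  lin := by
    -- `incl` is an `R`-linear isomorphism, so the claim reduces to `uAct_lin`.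
    rw [← cancel_epi (R ◁ incl R N h (under V)), ← whiskerLeft_comp_assoc,
      IsIso.hom_inv_id_assoc, reassoc_of% (incl_act R N h (under V)), IsIso.hom_inv_id_assoc,
      uAct_lin]

/-- The coaction of the induced Hopf algebra. -/
def indCo (V : LocalModule (YD.triv N R h)) : under V ⟶ indLoc R N h ⊗ under V where
  hom := uCo V ≫ incl R N h (under V)
  lin := by
    rw [whiskerLeft_comp_assoc, incl_act, reassoc_of% (uCo_lin V)]

theorem nAct_indAct (V : LocalModule (YD.triv N R h)) : nAct (indAct V) = uAct V :=
  IsIso.hom_inv_id_assoc (incl R N h (under V)) (uAct V)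

theorem resAct_indAct (V : LocalModule (YD.triv N R h)) :
    resAct (LocalModule.forget R) (genN R N h) (indAct V) = V.X.a := nAct_indAct V

theorem indCo_incl (V : LocalModule (YD.triv N R h)) :
    uCo V ≫ incl R N h (under V) = (indCo V).hom := rfl

/-- The Yetter-Drinfeld module over the induced Hopf algebra. -/
def toYD (V : LocalModule (YD.triv N R h)) : YD (indLoc R N h) where
  X := under V
  a := indAct V
  d := indCo V
  isAct := isAct_of_resAct (genN_bialg R N h) (by rw [resAct_indAct]; exact V.X.isAct)
  isCoact := map_isCoact (d := V.X.d) (genN_bialg R N h) (indCo_incl V) V.X.isCoact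
  compat := map_compat (d := V.X.d) (genN_bialg R N h) (indCo_incl V)
    (by rw [resAct_indAct]; exact V.X.compat)

/-- Linearity over `R ⊗ N` is linearity over `N`. -/
theorem lin_iff_nAct {M P : LocalModule R} (a : indLoc R N h ⊗ M ⟶ M) (b : indLoc R N h ⊗ P ⟶ P)
    (f : M ⟶ P) :
    a ≫ f = indLoc R N h ◁ f ≫ b ↔ nAct a ≫ f.hom = N ◁ f.hom ≫ nAct b := by
  rw [nAct, nAct, ← reassoc_of% (incl_nat R N h f), Category.assoc, cancel_epi]
  exact ⟨fun h => congrArg LocalModule.Hom.hom h, fun h => LocalModule.hom_ext h⟩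

/-- Colinearity over `R ⊗ N` is colinearity over `N`. -/
theorem colin_iff {M P : LocalModule R} {d' : M ⟶ indLoc R N h ⊗ M} {e' : P ⟶ indLoc R N h ⊗ P}
    {d : M.X ⟶ N ⊗ M.X} {e : P.X ⟶ N ⊗ P.X}
    (hd : d ≫ incl R N h M = d'.hom) (he : e ≫ incl R N h P = e'.hom) (f : M ⟶ P) :
    d' ≫ indLoc R N h ◁ f = f ≫ e' ↔ d ≫ N ◁ f.hom = f.hom ≫ e := by
  rw [← cancel_mono (incl R N h P), Category.assoc, Category.assoc, ← incl_nat, he,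
    reassoc_of% hd]
  exact ⟨fun h => congrArg LocalModule.Hom.hom h, fun h => LocalModule.hom_ext h⟩

/-- The `R`-linear morphism underlying a morphism of local modules. -/
def underMap {V W : LocalModule (YD.triv N R h)} (f : V ⟶ W) : under V ⟶ under W where
  hom := f.hom.hom
  lin := by
    have h1 := congrArg YD.Hom.hom f.lin
    rw [YD.comp_hom, YD.comp_hom, YD.whiskerLeft_hom] at h1
    exact h1

/-- The morphism of Yetter-Drinfeld modules over the induced Hopf algebra defined by a morphism of
local modules. -/
def toYDMap {V W : LocalModule (YD.triv N R h)} (f : V ⟶ W) : toYD V ⟶ toYD W where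
  hom := underMap f
  lin := by
    apply (lin_iff_nAct _ _ _).2
    change nAct (indAct V) ≫ _ = _ ≫ nAct (indAct W)
    rw [nAct_indAct, nAct_indAct]
    exact f.hom.lin
  colin := (colin_iff (indCo_incl V) (indCo_incl W) (underMap f)).2 f.hom.colin

variable (N R h) in
/-- The comparison functor from local modules in Yetter-Drinfeld modules to Yetter-Drinfeld modules
in local modules. -/
@[simps] def comparison : LocalModule (YD.triv N R h) ⥤ YD (indLoc R N h) where
  obj := toYD
  map := toYDMap

/-- The comparison functor leaves the underlying morphism in `C` unchanged, and on both sides that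
morphism determines everything. -/
instance : (comparison N R h).Faithful where
  map_injective hf := LocalModule.hom_ext (YD.hom_ext
    (congrArg LocalModule.Hom.hom (congrArg YD.Hom.hom hf)))

/-- A morphism of Yetter-Drinfeld modules over the induced Hopf algebra, as a morphism of
Yetter-Drinfeld modules over `N`. -/
def ofYDMap {V W : LocalModule (YD.triv N R h)} (f : toYD V ⟶ toYD W) : V ⟶ W where
  hom :=
    { hom := f.hom.hom
      lin := by
        have h1 : nAct (indAct V) ≫ f.hom.hom = _ ≫ nAct (indAct W) :=
          (lin_iff_nAct _ _ _).1 f.lin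
        rw [nAct_indAct, nAct_indAct] at h1
        exact h1
      colin := (colin_iff (indCo_incl V) (indCo_incl W) f.hom).1 f.colin }
  lin := by
    apply YD.hom_ext
    rw [YD.comp_hom, YD.comp_hom, YD.whiskerLeft_hom]
    exact f.hom.lin

instance : (comparison N R h).Full where
  map_surjective f := ⟨ofYDMap f, rfl⟩

/-- The coaction of `N` underlying a coaction of the induced Hopf algebra. -/
def resCo (P : YD (indLoc R N h)) : P.X.X ⟶ N ⊗ P.X.X := P.d.hom ≫ inv (incl R N h P.X)

theorem resCo_incl (P : YD (indLoc R N h)) : resCo P ≫ incl R N h P.X = P.d.hom := by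
  simp [resCo]

/-- The Yetter-Drinfeld module over `N` underlying one over the induced Hopf algebra. -/
def resYD (P : YD (indLoc R N h)) : YD N where
  X := P.X.X
  a := nAct P.a
  d := resCo P
  isAct := resAct_isAct (genN_bialg R N h) P.isAct
  isCoact := isCoact_of_map (genN_bialg R N h) (resCo_incl P) P.isCoact
  compat := compat_of_map (genN_bialg R N h) (resCo_incl P) P.compat

/-- The action of the trivial algebra on the restriction. -/
def resYDAct (P : YD (indLoc R N h)) : YD.triv N R h ⊗ resYD P ⟶ resYD P where
  hom := act R P.X.X
  lin := by
    change tAct (trAct R) (nAct P.a) ≫ act R P.X.X = N ◁ act R P.X.X ≫ nAct P.a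
    -- `lin_iff` reduces the claim to `R`-linearity of the restricted action, which holds because
    -- `P.a` and `incl` are `R`-linear.
    rw [tAct_trAct_left, lin_iff h, nAct, whiskerLeft_comp_assoc, ← P.a.lin,
      reassoc_of% (incl_act R N h P.X)]
  colin := by
    change tCo (trCo R) (resCo P) ≫ N ◁ act R P.X.X = act R P.X.X ≫ resCo P
    -- After composing with the invertible `incl`, this becomes `R`-linearity of the original
    -- coaction `P.d`.
    rw [tCo_trCo_left, ← cancel_mono (incl R N h P.X), Category.assoc (act R P.X.X),
      resCo_incl, P.d.lin, ← resCo_incl, whiskerLeft_comp_assoc, incl_act, actR]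
    simp only [Category.assoc]

/-- The local module in Yetter-Drinfeld modules defined by a Yetter-Drinfeld module in local
modules. -/
def ofYD (P : YD (indLoc R N h)) : LocalModule (YD.triv N R h) :=
  letI := LocalModule.modOf (resYDAct P)
    (by
      apply YD.hom_ext
      rw [YD.comp_hom, YD.whiskerRight_hom]
      exact one_act R P.X.X)
    (by
      apply YD.hom_ext
      rw [YD.comp_hom, YD.whiskerRight_hom, YD.comp_hom, YD.comp_hom, YD.whiskerLeft_hom]
      exact mul_act R P.X.X)
  { X := resYD P
    loc := by
      apply YD.hom_ext
      -- Both braidings with the trivial algebra are those of `C`, so locality of `P.X` over `R` is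
      -- what is needed.
      rw [YD.comp_hom, YD.comp_hom, braiding_triv, braiding_triv']
      exact P.X.loc }

/-- The local module underlying the restriction. -/
def underOfYD (P : YD (indLoc R N h)) : under (ofYD P) ≅ P.X :=
  LocalModule.isoMk (M := under (ofYD P)) (Iso.refl P.X.X)
    ((Category.comp_id _).trans
      ((congrArg (· ≫ act R P.X.X) (whiskerLeft_id R P.X.X)).trans (Category.id_comp _)).symm)

/-- A Yetter-Drinfeld module over the induced Hopf algebra is recovered from its restriction. -/
def toYDOfYD (P : YD (indLoc R N h)) : toYD (ofYD P) ≅ P :=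
  YD.isoMk (V := toYD (ofYD P)) (underOfYD P)
    ((lin_iff_nAct (indAct (ofYD P)) P.a (underOfYD P).hom).2 (by
      rw [nAct_indAct]
      change nAct P.a ≫ 𝟙 P.X.X = N ◁ 𝟙 P.X.X ≫ nAct P.a
      simp))
    ((colin_iff (indCo_incl _) (resCo_incl P) (underOfYD P).hom).2 (by
      change resCo P ≫ N ◁ 𝟙 P.X.X = 𝟙 P.X.X ≫ resCo P
      simp))

instance : (comparison N R h).EssSurj where
  mem_essImage P := ⟨ofYD P, ⟨toYDOfYD P⟩⟩

instance : (comparison N R h).IsEquivalence where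

end Comparison

/-! ### The comparison functor is braided monoidal. -/

section ComparisonMonoidal

variable {C : Type u} [Category.{v} C] [MonoidalCategory C] [BraidedCategory C]
  [HasCoequalizers C] [∀ X : C, PreservesColimitsOfShape WalkingParallelPair (tensorLeft X)]
  {N : C} [HopfObj N] [IsIso 𝒮[N]] {R : C} [MonObj R] [IsCommMonObj R]
  {h : (β_ R N).hom ≫ (β_ N R).hom = 𝟙 (R ⊗ N)}

/-- The projection to the relative tensor product in Yetter-Drinfeld modules, as a morphism of the
ambient category. -/
def upr (V W : LocalModule (YD.triv N R h)) :
    (under V).X ⊗ (under W).X ⟶ (under (V ⊗ W)).X := (LocalModule.pr V W).hom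

theorem actL_hom (V W : LocalModule (YD.triv N R h)) :
    (actL (act (YD.triv N R h) V.X) W.X).hom = actL (act R (under V).X) (under W).X := by
  rw [actL, YD.comp_hom, YD.whiskerRight_hom]
  rfl

/-- The right action involves the Yetter-Drinfeld braiding of the trivial algebra with `V`, which is
the braiding of `C`. With `actL_hom` this identifies the parallel pairs defining the two relative
tensor products. -/
theorem actR_hom (V W : LocalModule (YD.triv N R h)) :
    (actR V.X (act (YD.triv N R h) W.X)).hom = actR (under V).X (act R (under W).X) := by
  rw [actR, YD.comp_hom, YD.comp_hom, YD.comp_hom, YD.whiskerRight_hom, YD.whiskerLeft_hom,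
    braiding_triv]
  rfl

/-- The lemmas on `upr` are the images in `C` of the properties of `pr` in Yetter-Drinfeld modules.
They serve to test the constraints of the comparison functor on projections. -/
theorem upr_act (V W : LocalModule (YD.triv N R h)) :
    actL (act R (under V).X) (under W).X ≫ upr V W =
      R ◁ upr V W ≫ act R (under (V ⊗ W)).X := by
  have h1 := congrArg YD.Hom.hom (LocalModule.pr_act V W)
  rw [YD.comp_hom, YD.comp_hom, YD.whiskerLeft_hom, actL_hom] at h1
  exact h1.symm

theorem upr_act' (V W : LocalModule (YD.triv N R h)) :
    actR (under V).X (act R (under W).X) ≫ upr V W =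
      R ◁ upr V W ≫ act R (under (V ⊗ W)).X := by
  have h1 := congrArg YD.Hom.hom (LocalModule.pr_act' V W)
  rw [YD.comp_hom, YD.comp_hom, YD.whiskerLeft_hom, actR_hom] at h1
  exact h1.symm

theorem upr_uAct (V W : LocalModule (YD.triv N R h)) :
    tAct (uAct V) (uAct W) ≫ upr V W = N ◁ upr V W ≫ uAct (V ⊗ W) :=
  (LocalModule.pr V W).lin

theorem upr_uCo (V W : LocalModule (YD.triv N R h)) :
    tCo (uCo V) (uCo W) ≫ N ◁ upr V W = upr V W ≫ uCo (V ⊗ W) :=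
  (LocalModule.pr V W).colin

theorem upr_whiskerLeft (V : LocalModule (YD.triv N R h)) {W W' : LocalModule (YD.triv N R h)}
    (f : W ⟶ W') :
    upr V W ≫ (underMap (V ◁ f)).hom = (under V).X ◁ (underMap f).hom ≫ upr V W' := by
  have h1 := congrArg YD.Hom.hom (LocalModule.pr_whiskerLeft V f)
  rw [YD.comp_hom, YD.comp_hom, YD.whiskerLeft_hom] at h1
  exact h1

theorem upr_whiskerRight {V V' : LocalModule (YD.triv N R h)} (f : V ⟶ V')
    (W : LocalModule (YD.triv N R h)) :
    upr V W ≫ (underMap (f ▷ W)).hom = (underMap f).hom ▷ (under W).X ≫ upr V' W := by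
  have h1 := congrArg YD.Hom.hom (LocalModule.pr_whiskerRight f W)
  rw [YD.comp_hom, YD.comp_hom, YD.whiskerRight_hom] at h1
  exact h1

theorem upr_associator (V W P : LocalModule (YD.triv N R h)) :
    upr V W ▷ (under P).X ≫ upr (V ⊗ W) P ≫ (underMap (α_ V W P).hom).hom =
      (α_ (under V).X (under W).X (under P).X).hom ≫ (under V).X ◁ upr W P ≫ upr V (W ⊗ P) := by
  have h1 := congrArg YD.Hom.hom (LocalModule.pr_associator V W P)
  rw [YD.comp_hom, YD.comp_hom, YD.comp_hom, YD.comp_hom, YD.whiskerLeft_hom,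
    YD.whiskerRight_hom] at h1
  exact h1

/-- The unit of `R`, as a morphism to the object underlying the tensor unit. -/
def uun : 𝟙_ C ⟶ (under (𝟙_ (LocalModule (YD.triv N R h)))).X := η[R]

theorem upr_leftUnitor (V : LocalModule (YD.triv N R h)) :
    uun ▷ (under V).X ≫ upr (𝟙_ _) V ≫ (underMap (λ_ V).hom).hom =
      (λ_ (under V).X).hom := by
  have h1 := congrArg YD.Hom.hom (LocalModule.pr_leftUnitor V)
  rw [YD.comp_hom, YD.comp_hom, YD.whiskerRight_hom] at h1
  exact h1

theorem upr_rightUnitor (V : LocalModule (YD.triv N R h)) :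
    (under V).X ◁ uun ≫ upr V (𝟙_ _) ≫ (underMap (ρ_ V).hom).hom =
      (ρ_ (under V).X).hom := by
  have h1 := congrArg YD.Hom.hom (LocalModule.pr_rightUnitor V)
  rw [YD.comp_hom, YD.comp_hom, YD.whiskerLeft_hom] at h1
  exact h1

/-- On this side the braiding of the relative tensor product descends from the Yetter-Drinfeld
braiding, hence from a half-braiding, not from the braiding of `C`. -/
theorem upr_braiding (V W : LocalModule (YD.triv N R h)) :
    upr V W ≫ (underMap (β_ V W).hom).hom = half (uCo V) (uAct W) ≫ upr W V :=
  congrArg YD.Hom.hom (LocalModule.pr_braiding V W)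

/-- The relative tensor product of Yetter-Drinfeld modules is a coequalizer in the ambient
category. -/
def uprIsColimit (V W : LocalModule (YD.triv N R h)) :=
  isColimitCoforkMapOfIsColimit (YD.forget N) (LocalModule.pr_condition V W)
    (coequalizerIsCoequalizer _ _)

/-- The comparison of relative tensor products, as a morphism of local modules. -/
def tensComp (V W : LocalModule (YD.triv N R h)) : under V ⊗ under W ⟶ under (V ⊗ W) :=
  LocalModule.desc (upr V W) (upr_act V W) (upr_act' V W)

theorem pr_tensComp (V W : LocalModule (YD.triv N R h)) :
    LocalModule.pr (under V) (under W) ≫ (tensComp V W).hom = upr V W :=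
  LocalModule.pr_desc _ _ _

theorem pr_tensComp_assoc : type_of% (reassoc_of% @pr_tensComp) := @(reassoc_of% @pr_tensComp)

/-- The projection over `R` coequalizes the pair coming from Yetter-Drinfeld modules, so it factors
through `upr`. This factorization is the inverse of `tensComp`. -/
theorem pr_cofork (V W : LocalModule (YD.triv N R h)) :
    (YD.forget N).map (actL (act (YD.triv N R h) V.X) W.X) ≫
        LocalModule.pr (under V) (under W) =
      (YD.forget N).map (actR V.X (act (YD.triv N R h) W.X)) ≫
        LocalModule.pr (under V) (under W) := by
  rw [YD.forget_map, YD.forget_map, actL_hom, actR_hom]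
  exact LocalModule.pr_condition (under V) (under W)

/-- The inverse of `tensComp`, on underlying objects. -/
def tensCompInv (V W : LocalModule (YD.triv N R h)) :
    (under (V ⊗ W)).X ⟶ (under V ⊗ under W).X :=
  Cofork.IsColimit.desc (uprIsColimit V W) (LocalModule.pr (under V) (under W)) (pr_cofork V W)

theorem upr_tensCompInv (V W : LocalModule (YD.triv N R h)) :
    upr V W ≫ tensCompInv V W = LocalModule.pr (under V) (under W) :=
  Cofork.IsColimit.π_desc' (uprIsColimit V W) _ (pr_cofork V W)

theorem upr_ext {V W : LocalModule (YD.triv N R h)} {Z : C} {f g : (under (V ⊗ W)).X ⟶ Z}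
    (hfg : upr V W ≫ f = upr V W ≫ g) : f = g :=
  Cofork.IsColimit.hom_ext (uprIsColimit V W) hfg

/-- The comparison of relative tensor products is an isomorphism of local modules. -/
def tensCompIso (V W : LocalModule (YD.triv N R h)) : under V ⊗ under W ≅ under (V ⊗ W) :=
  LocalModule.isoMk
    { hom := (tensComp V W).hom
      inv := tensCompInv V W
      hom_inv_id := by
        rw [← cancel_epi (LocalModule.pr (under V) (under W)), pr_tensComp_assoc,
          upr_tensCompInv, Category.comp_id]
      inv_hom_id := by
        apply upr_ext
        rw [reassoc_of% (upr_tensCompInv V W), pr_tensComp, Category.comp_id] }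
    (tensComp V W).lin

/-- This is `tAct_resAct` for the forgetful functor: the diagonal action of the induced Hopf algebra
restricts to the descent of the diagonal action of `N`. -/
theorem pr_nAct_tAct (V W : LocalModule (YD.triv N R h)) :
    N ◁ LocalModule.pr (under V) (under W) ≫ nAct (tAct (indAct V) (indAct W)) =
      tAct (uAct V) (uAct W) ≫ LocalModule.pr (under V) (under W) := by
  rw [← nAct_indAct V, ← nAct_indAct W]
  exact (tAct_resAct (genN_bialg R N h) (indAct V) (indAct W)).symm

/-- The coaction of `N` on the tensor product of Yetter-Drinfeld modules in local modules. -/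
def tensCo (V W : LocalModule (YD.triv N R h)) :
    (under V ⊗ under W).X ⟶ N ⊗ (under V ⊗ under W).X :=
  (tCo (indCo V) (indCo W)).hom ≫ inv (incl R N h (under V ⊗ under W))

theorem tensCo_incl (V W : LocalModule (YD.triv N R h)) :
    tensCo V W ≫ incl R N h (under V ⊗ under W) = (tCo (indCo V) (indCo W)).hom := by
  simp [tensCo]

/-- The analogue for coactions, from `tCo_laxIncl` after composing with the invertible `incl`. -/
theorem pr_tensCo (V W : LocalModule (YD.triv N R h)) :
    LocalModule.pr (under V) (under W) ≫ tensCo V W =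
      tCo (uCo V) (uCo W) ≫ N ◁ LocalModule.pr (under V) (under W) := by
  rw [← cancel_mono (incl R N h (under V ⊗ under W)), Category.assoc, Category.assoc, tensCo_incl]
  exact (tCo_laxIncl (genN_bialg R N h) (indCo_incl V) (indCo_incl W)).symm

/-- The tensorator of the comparison functor. -/
def compMu (V W : LocalModule (YD.triv N R h)) : toYD V ⊗ toYD W ≅ toYD (V ⊗ W) :=
  YD.isoMk (V := toYD V ⊗ toYD W) (W := toYD (V ⊗ W)) (tensCompIso V W)
    ((lin_iff_nAct (tAct (indAct V) (indAct W)) (indAct (V ⊗ W)) (tensComp V W)).2 (by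
      rw [← cancel_epi (N ◁ LocalModule.pr (under V) (under W)),
        reassoc_of% (pr_nAct_tAct V W), ← whiskerLeft_comp_assoc, pr_tensComp, nAct_indAct,
        upr_uAct]))
    ((colin_iff (tensCo_incl V W) (indCo_incl (V ⊗ W)) (tensComp V W)).2 (by
      rw [← cancel_epi (LocalModule.pr (under V) (under W)), reassoc_of% (pr_tensCo V W),
        ← whiskerLeft_comp, pr_tensComp, pr_tensComp_assoc, upr_uCo]))

/-- The comparison of the tensor units, as local modules. -/
def unitComp : 𝟙_ (LocalModule R) ≅ under (𝟙_ (LocalModule (YD.triv N R h))) :=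
  LocalModule.isoMk (M := 𝟙_ (LocalModule R))
    (N := under (𝟙_ (LocalModule (YD.triv N R h)))) (Iso.refl R) (by
      change μ[R] ≫ 𝟙 R = R ◁ 𝟙 R ≫ μ[R]
      simp)

/-- The unit constraint of the comparison functor. -/
def compUnit : 𝟙_ (YD (indLoc R N h)) ≅ toYD (𝟙_ (LocalModule (YD.triv N R h))) :=
  YD.isoMk (V := 𝟙_ (YD (indLoc R N h))) (W := toYD (𝟙_ (LocalModule (YD.triv N R h)))) unitComp
    ((lin_iff_nAct (trAct (𝟙_ (LocalModule R))) (indAct (𝟙_ (LocalModule (YD.triv N R h))))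
        unitComp.hom).2 (by
      -- Both tensor units have underlying object `R`. The trivial action over the induced Hopf
      -- algebra restricts to the trivial action of `N`, so the identity of `R` is linear.
      have h1 : nAct (h := h) (trAct (𝟙_ (LocalModule R))) = _ :=
        resAct_trAct (genN_bialg R N h) (𝟙_ (LocalModule R))
      rw [h1, nAct_indAct]
      exact YD.trAct_nat (𝟙 R)))
    ((colin_iff (trCo_laxIncl (genN_bialg R N h) (𝟙_ (LocalModule R)))
      (indCo_incl (𝟙_ (LocalModule (YD.triv N R h)))) unitComp.hom).2 (YD.trCo_nat (𝟙 R)))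

/-- Common pattern of the coherence proofs: an equation of Yetter-Drinfeld morphisms is one of local
modules, and after precomposition with `pr` it becomes the corresponding property of `upr`. -/
theorem compMu_natural_left {V V' : LocalModule (YD.triv N R h)} (f : V ⟶ V')
    (W : LocalModule (YD.triv N R h)) :
    toYDMap f ▷ toYD W ≫ (compMu V' W).hom = (compMu V W).hom ≫ toYDMap (f ▷ W) := by
  apply YD.hom_ext
  rw [YD.comp_hom, YD.comp_hom, YD.whiskerRight_hom]
  change underMap f ▷ under W ≫ tensComp V' W = tensComp V W ≫ underMap (f ▷ W)
  apply LocalModule.pr_ext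
  rw [LocalModule.comp_hom, LocalModule.comp_hom, LocalModule.pr_whiskerRight_assoc, pr_tensComp,
    pr_tensComp_assoc, upr_whiskerRight]

theorem compMu_natural_right (V : LocalModule (YD.triv N R h))
    {W W' : LocalModule (YD.triv N R h)} (f : W ⟶ W') :
    toYD V ◁ toYDMap f ≫ (compMu V W').hom = (compMu V W).hom ≫ toYDMap (V ◁ f) := by
  apply YD.hom_ext
  rw [YD.comp_hom, YD.comp_hom, YD.whiskerLeft_hom]
  change under V ◁ underMap f ≫ tensComp V W' = tensComp V W ≫ underMap (V ◁ f)
  apply LocalModule.pr_ext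
  rw [LocalModule.comp_hom, LocalModule.comp_hom, LocalModule.pr_whiskerLeft_assoc, pr_tensComp,
    pr_tensComp_assoc, upr_whiskerLeft]

theorem compMu_associativity (V W P : LocalModule (YD.triv N R h)) :
    (compMu V W).hom ▷ toYD P ≫ (compMu (V ⊗ W) P).hom ≫ toYDMap (α_ V W P).hom =
      (α_ (toYD V) (toYD W) (toYD P)).hom ≫ toYD V ◁ (compMu W P).hom ≫
        (compMu V (W ⊗ P)).hom := by
  apply YD.hom_ext
  rw [YD.comp_hom, YD.comp_hom, YD.comp_hom, YD.comp_hom, YD.whiskerRight_hom, YD.whiskerLeft_hom]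
  change tensComp V W ▷ under P ≫ tensComp (V ⊗ W) P ≫ underMap (α_ V W P).hom =
    (α_ (under V) (under W) (under P)).hom ≫ under V ◁ tensComp W P ≫ tensComp V (W ⊗ P)
  apply LocalModule.pr_ext
  -- The three-fold relative tensor product is reached from `C` by two projections; this cancels the
  -- inner one.
  rw [← cancel_epi (LocalModule.pr (under V) (under W) ▷ (under P).X)]
  simp only [LocalModule.comp_hom, LocalModule.pr_whiskerRight_assoc, pr_tensComp_assoc,
    LocalModule.pr_associator_assoc, LocalModule.pr_whiskerLeft_assoc, pr_tensComp]
  rw [← comp_whiskerRight_assoc, pr_tensComp, ← whiskerLeft_comp_assoc, pr_tensComp,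
    upr_associator]

theorem compMu_left_unitality (V : LocalModule (YD.triv N R h)) :
    (λ_ (toYD V)).hom =
      compUnit.hom ▷ toYD V ≫ (compMu (𝟙_ _) V).hom ≫ toYDMap (λ_ V).hom := by
  apply YD.hom_ext
  rw [YD.comp_hom, YD.comp_hom, YD.whiskerRight_hom]
  change (λ_ (under V)).hom = unitComp.hom ▷ under V ≫ tensComp (𝟙_ _) V ≫ underMap (λ_ V).hom
  apply LocalModule.hom_ext
  -- This composite identifies `𝟙_ C ⊗ V` with `R ⊗_R V`, so the identity may be tested on the unit
  -- of `R` alone.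
  rw [← cancel_epi (LocalModule.un R ▷ (under V).X ≫ LocalModule.pr (𝟙_ _) (under V))]
  have h1 : LocalModule.un R ≫ (unitComp (h := h)).hom.hom = uun :=
    Category.comp_id _
  simp only [LocalModule.comp_hom, Category.assoc, LocalModule.pr_leftUnitor,
    LocalModule.pr_whiskerRight_assoc, pr_tensComp_assoc]
  rw [← comp_whiskerRight_assoc, h1, upr_leftUnitor]

theorem compMu_right_unitality (V : LocalModule (YD.triv N R h)) :
    (ρ_ (toYD V)).hom =
      toYD V ◁ compUnit.hom ≫ (compMu V (𝟙_ _)).hom ≫ toYDMap (ρ_ V).hom := by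
  apply YD.hom_ext
  rw [YD.comp_hom, YD.comp_hom, YD.whiskerLeft_hom]
  change (ρ_ (under V)).hom = under V ◁ unitComp.hom ≫ tensComp V (𝟙_ _) ≫ underMap (ρ_ V).hom
  apply LocalModule.hom_ext
  rw [← cancel_epi ((under V).X ◁ LocalModule.un R ≫ LocalModule.pr (under V) (𝟙_ _))]
  have h1 : LocalModule.un R ≫ (unitComp (h := h)).hom.hom = uun :=
    Category.comp_id _
  simp only [LocalModule.comp_hom, Category.assoc, LocalModule.pr_rightUnitor,
    LocalModule.pr_whiskerLeft_assoc, pr_tensComp_assoc]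
  rw [← whiskerLeft_comp_assoc, h1, upr_rightUnitor]

instance : (comparison N R h).Monoidal :=
  Functor.CoreMonoidal.toMonoidal
    { εIso := compUnit
      μIso := compMu
      μIso_hom_natural_left := compMu_natural_left
      μIso_hom_natural_right := fun V f => compMu_natural_right V f
      associativity := compMu_associativity
      left_unitality := compMu_left_unitality
      right_unitality := compMu_right_unitality }

/-- Over the projections both braidings are induced by the half-braiding of `N` in `C`: on one side
by `upr_braiding`, on the other by `half_resAct`. -/
theorem compMu_braided (V W : LocalModule (YD.triv N R h)) :
    (compMu V W).hom ≫ toYDMap (β_ V W).hom = (β_ (toYD V) (toYD W)).hom ≫ (compMu W V).hom := by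
  apply YD.hom_ext
  rw [YD.comp_hom, YD.comp_hom, YD.braiding_hom]
  change tensComp V W ≫ underMap (β_ V W).hom = half (indCo V) (indAct W) ≫ tensComp W V
  apply LocalModule.pr_ext
  have h1 : half (uCo V) (nAct (indAct W)) ≫ LocalModule.pr (under W) (under V) =
      LocalModule.pr (under V) (under W) ≫ (half (indCo V) (indAct W)).hom :=
    half_resAct (U := LocalModule.forget R) (X := under V) (g := genN R N h) (d := uCo V) (d' := indCo V)
      (indCo_incl V) (indAct W)
  rw [LocalModule.comp_hom, LocalModule.comp_hom, pr_tensComp_assoc, upr_braiding,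
    ← reassoc_of% h1, pr_tensComp, nAct_indAct]

instance : (comparison N R h).Braided where
  braided V W := compMu_braided (h := h) V W

end ComparisonMonoidal

end

end BraidedExtension

open BraidedExtension

theorem mainTheorem9 {C : Type u} [Category.{v} C] [MonoidalCategory C] [BraidedCategory C]
    [HasCoequalizers C] [∀ X : C, PreservesColimitsOfShape WalkingParallelPair (tensorLeft X)]
    (N : C) [HopfObj N] [IsIso 𝒮[N]] (R : C) [MonObj R] [IsCommMonObj R]
    (h : (β_ R N).hom ≫ (β_ N R).hom = 𝟙 (R ⊗ N)) :
    ∃ E : LocalModule (YD.triv N R h) ≌ YD (indLoc R N h),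
      Nonempty E.functor.Braided ∧
      Nonempty (E.functor ⋙ YD.forget (indLoc R N h) ⋙ LocalModule.forget R ≅
        LocalModule.forget (YD.triv N R h) ⋙ YD.forget N) :=
  ⟨(comparison N R h).asEquivalence, ⟨(inferInstance : (comparison N R h).Braided)⟩,
    -- The comparison keeps underlying objects and morphisms in `C`, so the two composite functors
    -- agree definitionally.
    ⟨Iso.refl _⟩⟩
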